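/- Let $L\ge 1$ be an integer, let $a_0,a_1,\dots$ be independent standard complex Gaussian random variables ($E a_m=0$, $E|a_m|^2=1$, $E a_m^2=0$), and let $$\psi(z)=\sum_{m=0}^\infty \sqrt{\binom{m+L-1}{m}}\,a_m z^m,\qquad z\in D=\{|z|<1\},$$ be the $SU(1,1)$ random analytic function, with zeros $\zeta_j$ in $D$ counted with multiplicity. For $n\ge 0$ let $D^{(n)}$ be the set of $n$-tuples of pairwise distinct points of $D$. An $n$-point correlation function of the zeros is a function $K_n$, continuous on $D^{(n)}$, such that for all real-valued smooth functions $\phi_1,\dots,\phi_n$ on $\mathbb C$ whose supports are compact, contained in $D$ and pairwise disjoint, the random variable $\prod_{p}\sum_j\phi_p(\zeta_j)$ is integrable and $$E\prod_{p=1}^n\Big(\sum_j\phi_p(\zeta_j)\Big)=\int_{\mathbb C^n}K_n(z_1,\dots,z_n)\prod_{p=1}^n\phi_p(z_p)\,dz_1\cdots dz_n,$$ where $dz_p$ is Lebesgue measure on $\mathbb C$. (This determines $K_n$ on $D^{(n)}$.) Theorem. For every $n$ such a $K_n$ exists, and $K_1>0$ on $D$. The normalized correlation function $$k_n(z_1,\dots,z_n)=\frac{K_n(z_1,\dots,z_n)}{K_1(z_1)\cdots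 K_1(z_n)},\qquad (z_1,\dots,z_n)\in D^{(n)},$$ satisfies $$k_n(Az_1,\dots,Az_n)=k_n(z_1,\dots,z_n)\quad\text{for all } A=\begin{pmatrix}a&b\\c&d\end{pmatrix}\in SU(1,1),\qquad Az=\frac{az+b}{cz+d},$$ where $SU(1,1)$ is the group of complex $2\times2$ matrices of determinant $1$ preserving the Hermitian form $|z_0|^2-|z_1|^2$. Moreover $k_n$ depends only on the pairwise hyperbolic distances: if $z,w\in D^{(n)}$ satisfy $\tau(z_p,z_q)=\tau(w_p,w_q)$ for all $p,q$, then $k_n(z)=k_n(w)$, where $\tanh(\tau(z,w)/2)=|z-w|/|1-z\overline w|$. -/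

import Mathlib

open MeasureTheory ProbabilityTheory Metric
open scoped ContDiff Matrix ComplexConjugate MatrixGroups

namespace SU11

noncomputable section

/-- The standard complex Gaussian law: real and imaginary parts are independent, centred and of
variance `1 / 2`, so that `E a = 0`, `E |a| ^ 2 = 1` and `E a ^ 2 = 0`. -/
def stdComplexGaussian : Measure ℂ :=
  ((gaussianReal 0 (1 / 2)).prod (gaussianReal 0 (1 / 2))).map
    Complex.measurableEquivRealProd.symm

/-- The power series `∑ √C(m + L - 1, m) a_m z ^ m` with coefficient sequence `a`. For independent
standard complex Gaussian `a_m` this is the `SU(1,1)` random analytic function with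
parameter `L ≥ 1`. -/
def randomFunction (L : ℕ) (a : ℕ → ℂ) (z : ℂ) : ℂ :=
  ∑' m : ℕ, ((√((m + L - 1).choose m : ℝ) : ℝ) : ℂ) * a m * z ^ m

/-- The linear statistic `∑_j φ(ζ_j)` over the zeros `ζ_j` of `f` in the open unit disk, counted
with multiplicity. -/
def zeroSum (f : ℂ → ℂ) (φ : ℂ → ℝ) : ℝ :=
  ∑ᶠ ζ ∈ ball (0 : ℂ) 1, (analyticOrderNatAt f ζ : ℝ) * φ ζ

/-- The `n`-tuples of pairwise distinct points of the open unit disk. -/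
def config (n : ℕ) : Set (Fin n → ℂ) :=
  {z | (∀ p, z p ∈ ball (0 : ℂ) 1) ∧ Function.Injective z}

/-- Tuples of smooth test functions, compactly supported in the open unit disk, with pairwise
disjoint supports. -/
structure IsTestTuple {n : ℕ} (φ : Fin n → ℂ → ℝ) : Prop where
  contDiff : ∀ p, ContDiff ℝ ∞ (φ p)
  hasCompactSupport : ∀ p, HasCompactSupport (φ p)
  tsupport_subset : ∀ p, tsupport (φ p) ⊆ ball (0 : ℂ) 1
  disjoint : Pairwise fun p q => Disjoint (tsupport (φ p)) (tsupport (φ q))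

/-- `K` is the `n`-point correlation function of the zeros of the random analytic function with
parameter `L` and random coefficients `a`. The test-function identity determines `K` almost
everywhere on `config n`; continuity selects the pointwise values. The values of `K` outside
`config n` are irrelevant. -/
structure IsCorrelationFunction {Ω : Type*} [MeasurableSpace Ω] (P : Measure Ω) (L : ℕ)
    (a : ℕ → Ω → ℂ) (n : ℕ) (K : (Fin n → ℂ) → ℝ) : Prop where
  continuousOn : ContinuousOn K (config n)
  integrable : ∀ φ : Fin n → ℂ → ℝ, IsTestTuple φ →
    Integrable (fun x => ∏ p, zeroSum (randomFunction L fun m => a m x) (φ p)) P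
  integral_eq : ∀ φ : Fin n → ℂ → ℝ, IsTestTuple φ →
    ∫ x, ∏ p, zeroSum (randomFunction L fun m => a m x) (φ p) ∂P
      = ∫ z : Fin n → ℂ, K z * ∏ p, φ p (z p)

/-- The normalized correlation function `K_n(z_1, …, z_n) / (K_1(z_1) ⋯ K_1(z_n))`. -/
def normalized {n : ℕ} (K₁ : (Fin 1 → ℂ) → ℝ) (K : (Fin n → ℂ) → ℝ) (z : Fin n → ℂ) : ℝ :=
  K z / ∏ p, K₁ fun _ => z p

/-- The group `SU(1,1)`: complex `2 × 2` matrices of determinant one that preserve the indefinite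
Hermitian form of signature `(1,1)`. -/
def group : Subgroup SL(2, ℂ) where
  carrier := {A | (A : Matrix (Fin 2) (Fin 2) ℂ)ᴴ * !![1, 0; 0, -1] * (A : Matrix _ _ ℂ)
    = !![1, 0; 0, -1]}
  one_mem' := by simp
  mul_mem' := by
    intro A B hA hB
    simp only [Set.mem_ofPred_eq, Matrix.SpecialLinearGroup.coe_mul,
      Matrix.conjTranspose_mul] at *
    calc _ = (B : Matrix (Fin 2) (Fin 2) ℂ)ᴴ * ((A : Matrix (Fin 2) (Fin 2) ℂ)ᴴ
          * !![1, 0; 0, -1] * (A : Matrix _ _ ℂ)) * (B : Matrix _ _ ℂ) := by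
            simp only [Matrix.mul_assoc]
      _ = _ := by rw [hA, hB]
  inv_mem' := by
    intro A hA
    simp only [Set.mem_ofPred_eq] at *
    have h : (A : Matrix (Fin 2) (Fin 2) ℂ) * (A⁻¹ : SL(2, ℂ)).1 = 1 := by
      rw [← Matrix.SpecialLinearGroup.coe_mul]; simp
    have h' : (A⁻¹ : SL(2, ℂ)).1ᴴ * (A : Matrix (Fin 2) (Fin 2) ℂ)ᴴ = 1 := by
      rw [← Matrix.conjTranspose_mul, h, Matrix.conjTranspose_one]
    calc _ = (A⁻¹ : SL(2, ℂ)).1ᴴ * ((A : Matrix (Fin 2) (Fin 2) ℂ)ᴴ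
          * !![1, 0; 0, -1] * (A : Matrix _ _ ℂ)) * (A⁻¹ : SL(2, ℂ)).1 := by rw [hA]
      _ = ((A⁻¹ : SL(2, ℂ)).1ᴴ * (A : Matrix (Fin 2) (Fin 2) ℂ)ᴴ) * !![1, 0; 0, -1]
          * ((A : Matrix _ _ ℂ) * (A⁻¹ : SL(2, ℂ)).1) := by simp only [Matrix.mul_assoc]
      _ = _ := by rw [h, h']; simp

/-- The fractional linear action `A z = (a z + b) / (c z + d)`. -/
def act (A : SL(2, ℂ)) (z : ℂ) : ℂ :=
  (A.1 0 0 * z + A.1 0 1) / (A.1 1 0 * z + A.1 1 1)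

/-- The hyperbolic distance `τ` of the unit disk for the metric
`4 (dx² + dy²) / (1 - x² - y²)²`, given by `tanh (τ / 2) = |z - w| / |1 - z w̄|`. -/
def hypDist (z w : ℂ) : ℝ :=
  2 * Real.artanh (‖z - w‖ / ‖1 - z * conj w‖)

end

end SU11

/-! Existence of the correlation functions is a Kac–Rice argument. Fix the coefficients from index
`n` on and let the first `n` vary. At `n` distinct points the Vandermonde determinant is nonzero, so
exactly one choice of the first `n` coefficients makes the series vanish at all of them; this choice
is `interpMap`. The tuples of distinct zeros of the series with head `t` are therefore the fibre of
`interpMap` over `t`, and the area formula `lintegral_mul_tsum_fiber` turns the Gaussian average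
over `t` of a sum over zero tuples into an integral over configurations. Its density is the Gaussian
density at the interpolating head times the Jacobian of `interpMap`, which is a product of squared
derivatives at the zeros divided by `‖det‖ ^ 2` (`abs_det_fderiv_interpMap`). Averaging over the
tail gives `corr`, and moments of `weightSum` dominate the density well enough for integrability and
continuity. By a Sard argument the zeros are almost surely simple (`ae_simpleZeros`), so
multiplicities disappear, and disjoint supports reduce a product of linear statistics to a sum over
tuples of distinct zeros (`tsum_zeroTuples_eq`). Positivity of the one-point function comes from the
derivative at a given point being almost surely nonzero.

Invariance comes from the covariance kernel `(1 - z w̄) ^ (-L)`. For a disk automorphism `σ`, the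
field `ψ ∘ σ` divided by the `L`-th power of the denominator of `σ` is Gaussian with the same
kernel, hence has the same law along a dense sequence (`IsGaussianField.map_eq`), and its zeros are
the preimages under `σ` of those of `ψ`. A linear statistic of the zeros is a measurable functional
of the values on the dense sequence (`zeroFunctional_eq_tsum`), so the two zero sets have the same
statistics. Since test functions determine a continuous correlation function, `K_n` is multiplied
under `σ` by a product of one-point Jacobians, and these cancel in the normalized quotient. The
field `conj (ψ (conj z))` gives invariance under reflection in the same way.

For the last claim, the pairwise hyperbolic distances determine a configuration up to automorphisms
and reflection (`eq_of_pseudoDist_eq`). -/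

namespace SU11

/-! ### The area formula for sums over fibres -/

section AreaFormula

open Set Filter Topology
open scoped ENNReal

variable {E : Type*} [NormedAddCommGroup E] [NormedSpace ℝ E] [FiniteDimensional ℝ E]
  [MeasurableSpace E] [BorelSpace E]

/-- Countably many injective pieces cover the regular points of a strictly differentiable map. -/
lemma exists_countable_injOn_partition {R : Set E} (hR : MeasurableSet R) {T : E → E}
    {T' : E → E →L[ℝ] E} (hT : ∀ x ∈ R, HasStrictFDerivAt T (T' x) x)
    (hdet : ∀ x ∈ R, (T' x).det ≠ 0) :
    ∃ s : ℕ → Set E, (∀ i, MeasurableSet (s i)) ∧ Pairwise (Function.onFun Disjoint s) ∧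
      (∀ i, InjOn T (s i)) ∧ ⋃ i, s i = R := by
  have hloc : ∀ x ∈ R, ∃ V, IsOpen V ∧ x ∈ V ∧ InjOn T V := by
    intro x hx
    have h := hT x hx
    let e := (T' x).toContinuousLinearEquivOfDetNeZero (hdet x hx)
    have h' : HasStrictFDerivAt T (e : E →L[ℝ] E) x := by
      rwa [ContinuousLinearMap.coe_toContinuousLinearEquivOfDetNeZero]
    refine ⟨(h'.toOpenPartialHomeomorph T).source, (h'.toOpenPartialHomeomorph T).open_source,
      h'.mem_toOpenPartialHomeomorph_source, ?_⟩
    have := (h'.toOpenPartialHomeomorph T).injOn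
    rwa [h'.toOpenPartialHomeomorph_coe] at this
  choose! V hVo hxV hVinj using hloc
  obtain ⟨c, hcR, hcc, hcov⟩ := TopologicalSpace.countable_cover_nhdsWithin
    (f := V) (s := R) fun x hx => mem_nhdsWithin_of_mem_nhds ((hVo x hx).mem_nhds (hxV x hx))
  rcases c.eq_empty_or_nonempty with rfl | hne
  · have : R = ∅ := by simpa using hcov
    exact ⟨fun _ => ∅, by simp, fun i j _ => by simp [Function.onFun], by simp, by simp [this]⟩
  obtain ⟨e, he⟩ := hcc.exists_eq_range hne
  have heR : ∀ i, e i ∈ R := fun i => hcR (he ▸ mem_range_self i)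
  refine ⟨fun i => R ∩ disjointed (fun i => V (e i)) i, fun i => hR.inter
    (MeasurableSet.disjointed (fun i => (hVo _ (heR i)).measurableSet) i), fun i j hij =>
    (disjoint_disjointed _ hij).mono inter_subset_right inter_subset_right, fun i =>
    (hVinj _ (heR i)).mono (inter_subset_right.trans (disjointed_subset _ i)), ?_⟩
  rw [← inter_iUnion, iUnion_disjointed, inter_eq_left]
  intro x hx
  obtain ⟨y, hy, hxy⟩ := mem_iUnion₂.1 (hcov hx)
  obtain ⟨i, rfl⟩ := he ▸ hy
  exact mem_iUnion.2 ⟨i, hxy⟩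

/-- On an injective piece a fibre has at most one point. Writing the fibre sum as an extension by
zero makes its measurability in `t` available. -/
lemma tsum_fiber_eq_extend {E : Type*} {s : Set E} {T : E → E} (hT : InjOn T s) (Φ : E → ℝ≥0∞) (t : E) :
    ∑' z : ↥(s ∩ T ⁻¹' {t}), Φ z
      = Function.extend (s.domRestrict T) (fun z => Φ z) (fun _ => 0) t := by
  classical
  by_cases h : ∃ z ∈ s, T z = t
  · obtain ⟨z, hz, rfl⟩ := h
    have h1 : s ∩ T ⁻¹' {T z} = {z} := by
      ext w
      simp only [mem_inter_iff, mem_preimage, mem_singleton_iff]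
      exact ⟨fun hw => hT hw.1 hz hw.2, by rintro rfl; exact ⟨hz, rfl⟩⟩
    have h2 := (injOn_iff_injective.1 hT).extend_apply (fun z : s => Φ z) (fun _ => 0) ⟨z, hz⟩
    simp only [domRestrict_apply] at h2
    rw [h1, h2, tsum_singleton]
  · have h1 : s ∩ T ⁻¹' {t} = ∅ := by
      ext w; simp only [mem_inter_iff, mem_preimage, mem_singleton_iff, mem_empty_iff_false,
        iff_false]; exact fun hw => h ⟨w, hw⟩
    rw [h1, Function.extend_apply']
    · simp
    · rintro ⟨⟨z, hz⟩, rfl⟩; exact h ⟨z, hz, rfl⟩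

lemma lintegral_mul_tsum_fiber_of_injOn (μ : Measure E) [μ.IsAddHaarMeasure] {s : Set E}
    (hs : MeasurableSet s) {T : E → E} {T' : E → E →L[ℝ] E}
    (hT : ∀ x ∈ s, HasFDerivWithinAt T (T' x) s x) (hinj : InjOn T s)
    {Φ w : E → ℝ≥0∞} :
    ∫⁻ t, w t * ∑' z : ↥(s ∩ T ⁻¹' {t}), Φ z ∂μ
      = ∫⁻ z in s, ENNReal.ofReal |(T' z).det| * (w (T z) * Φ z) ∂μ := by
  have hext : ∀ z ∈ s, ∑' z' : ↥(s ∩ T ⁻¹' {T z}), Φ z' = Φ z := by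
    intro z hz
    rw [tsum_fiber_eq_extend hinj]
    simpa using (injOn_iff_injective.1 hinj).extend_apply (fun z : s => Φ z) (fun _ => 0) ⟨z, hz⟩
  rw [← setLIntegral_eq_of_support_subset (s := T '' s),
    lintegral_image_eq_lintegral_abs_det_fderiv_mul μ hs hT hinj]
  · exact setLIntegral_congr_fun hs fun z hz => by simp only [hext z hz]
  · intro t ht
    by_contra hn
    refine ht ?_
    have : s ∩ T ⁻¹' {t} = ∅ := by
      ext w; simp only [mem_inter_iff, mem_preimage, mem_singleton_iff, mem_empty_iff_false,
        iff_false]; exact fun hw => hn ⟨w, hw⟩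
    simp [this]

/-- The area formula for maps of a finite dimensional space to itself. -/
theorem lintegral_mul_tsum_fiber (μ : Measure E) [μ.IsAddHaarMeasure] {U : Set E}
    (hU : MeasurableSet U) {T : E → E} {T' : E → E →L[ℝ] E}
    (hT : ∀ x ∈ U, HasStrictFDerivAt T (T' x) x)
    {Φ w : E → ℝ≥0∞} (hΦ : Measurable Φ) (hw : Measurable w) :
    ∫⁻ t, w t * ∑' z : ↥(U ∩ T ⁻¹' {t}), Φ z ∂μ
      = ∫⁻ z in U, ENNReal.ofReal |(T' z).det| * (w (T z) * Φ z) ∂μ := by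
  set R : Set E := U ∩ {x | (fderiv ℝ T x).det ≠ 0} with hRdef
  have hfd : ∀ x ∈ U, fderiv ℝ T x = T' x := fun x hx => (hT x hx).hasFDerivAt.fderiv
  have hmeas : Measurable fun x => (fderiv ℝ T x).det :=
    ContinuousLinearMap.continuous_det.measurable.comp (measurable_fderiv ℝ T)
  have hR : MeasurableSet R := hU.inter (hmeas (measurableSet_singleton 0).compl)
  have hRU : R ⊆ U := inter_subset_left
  obtain ⟨s, hsm, hsd, hsinj, hsR⟩ := exists_countable_injOn_partition hR
    (fun x hx => hT x (hRU hx)) (fun x hx => by rw [← hfd x (hRU hx)]; exact hx.2)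
  have hsRi : ∀ i, s i ⊆ R := fun i => hsR ▸ subset_iUnion s i
  have hder : ∀ i, ∀ x ∈ s i, HasFDerivWithinAt T (T' x) (s i) x := fun i x hx =>
    (hT x (hRU (hsRi i hx))).hasFDerivAt.hasFDerivWithinAt
  -- Sard's lemma in equal dimensions: the critical values are null, so almost every fibre lies in
  -- the regular set `R`.
  have hcrit : μ (T '' (U \ R)) = 0 :=
    addHaar_image_eq_zero_of_det_fderivWithin_eq_zero (f' := T') μ
      (fun x hx => (hT x hx.1).hasFDerivAt.hasFDerivWithinAt) fun x hx => by
        have := hx.2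
        simp only [hRdef, mem_inter_iff, not_and, mem_ofPred_eq, not_not] at this
        rw [← hfd x hx.1]; exact this hx.1
  have h1 : ∀ᵐ t ∂μ, w t * ∑' z : ↥(U ∩ T ⁻¹' {t}), Φ z
      = ∑' i, w t * ∑' z : ↥(s i ∩ T ⁻¹' {t}), Φ z := by
    filter_upwards [measure_eq_zero_iff_ae_notMem.1 hcrit] with t ht
    have h2 : U ∩ T ⁻¹' {t} = ⋃ i, s i ∩ T ⁻¹' {t} := by
      rw [← iUnion_inter, hsR]
      ext z
      simp only [mem_inter_iff, mem_preimage, mem_singleton_iff]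
      refine ⟨fun h => ⟨?_, h.2⟩, fun h => ⟨hRU h.1, h.2⟩⟩
      by_contra hn
      exact ht ⟨z, ⟨h.1, hn⟩, h.2⟩
    rw [ENNReal.tsum_mul_left, h2, ENNReal.tsum_biUnion]
    intro i _ j _ hij
    exact (hsd hij).mono inter_subset_left inter_subset_left
  have h3 : ∀ i, Measurable fun t => ∑' z : ↥(s i ∩ T ⁻¹' {t}), Φ z := by
    intro i
    simp_rw [tsum_fiber_eq_extend (hsinj i)]
    exact (measurableEmbedding_of_fderivWithin (hsm i) (hder i) (hsinj i)).measurable_extend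
      (hΦ.comp measurable_subtype_coe) measurable_const
  rw [lintegral_congr_ae h1, lintegral_tsum fun i => by have := h3 i; fun_prop]
  simp_rw [lintegral_mul_tsum_fiber_of_injOn μ (hsm _) (hder _) (hsinj _)]
  rw [← lintegral_iUnion hsm hsd, hsR]
  conv_rhs => rw [← sdiff_union_of_subset hRU, lintegral_union hR disjoint_sdiff_left]
  rw [setLIntegral_congr_fun (hU.diff hR) (g := fun _ => 0), lintegral_zero, zero_add]
  intro x hx
  have := hx.2
  simp only [hRdef, mem_inter_iff, not_and, mem_ofPred_eq, not_not] at this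
  simp [← hfd x hx.1, this hx.1]

end AreaFormula

end SU11

namespace SU11

/-! ### Linear statistics as measurable functionals of countably many values -/

section ZeroFunctional

open Set Filter Topology
open scoped ENNReal

noncomputable section

instance : Nonempty (ball (0 : ℂ) 1) := ⟨⟨0, by simp⟩⟩

/-- A dense sequence in the unit disk. -/
def diskSeq : ℕ → ball (0 : ℂ) 1 := TopologicalSpace.denseSeq _

lemma exists_diskSeq_mem {U : Set ℂ} (hU : IsOpen U) (h : (U ∩ ball (0 : ℂ) 1).Nonempty) :
    ∃ j, (diskSeq j : ℂ) ∈ U := by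
  obtain ⟨z, hz, hz1⟩ := h
  obtain ⟨_, hy, j, rfl⟩ := (TopologicalSpace.denseRange_denseSeq (ball (0 : ℂ) 1)).inter_open_nonempty
    (Subtype.val ⁻¹' U) (hU.preimage continuous_subtype_val) ⟨⟨z, hz1⟩, hz⟩
  exact ⟨j, hy⟩

/-- A countable condition on the values of a function along `diskSeq` which expresses that the
function has a zero in a closed ball. -/
def HasZeroIn {E : Type*} [Norm E] (x : ℕ → E) (c : ℂ) (r : ℝ) : Prop :=
  ∀ k : ℕ, ∃ j, (diskSeq j : ℂ) ∈ ball c r ∧ ‖x j‖ < 1 / (k + 1)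

/-- On the compact ball `‖H‖` attains its minimum, which must be zero if the sampled values become
arbitrarily small. Conversely a zero on the boundary sphere is still approached by sample points
from the open ball. -/
lemma hasZeroIn_iff {E : Type*} [NormedAddCommGroup E] {H : ℂ → E}
    (hH : ContinuousOn H (ball 0 1)) {c : ℂ} {r : ℝ} (hr : 0 < r)
    (hsub : closedBall c r ⊆ ball 0 1) :
    HasZeroIn (fun j => H (diskSeq j)) c r ↔ ∃ ζ ∈ closedBall c r, H ζ = 0 := by
  constructor
  · intro h
    obtain ⟨ζ, hζ, hmin⟩ := (isCompact_closedBall c r).exists_isMinOn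
      ⟨c, mem_closedBall_self hr.le⟩ (hH.mono hsub).norm
    refine ⟨ζ, hζ, ?_⟩
    by_contra hne
    obtain ⟨k, hk⟩ := exists_nat_one_div_lt (norm_pos_iff.2 hne)
    obtain ⟨j, hj, hj'⟩ := h k
    exact absurd (isMinOn_iff.1 hmin _ (ball_subset_closedBall hj)) (not_le.2 (hj'.trans hk))
  · rintro ⟨ζ, hζ, h0⟩ k
    have hcont : ContinuousAt H ζ := hH.continuousAt (isOpen_ball.mem_nhds (hsub hζ))
    have hev : ∀ᶠ w in 𝓝 ζ, ‖H w‖ < 1 / (k + 1 : ℝ) :=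
      hcont.norm.eventually_lt_const (by simp only [h0, norm_zero]; positivity)
    obtain ⟨O, hO, hOo, hζO⟩ := _root_.eventually_nhds_iff.1 hev
    have hcl : ζ ∈ closure (ball c r) := by rwa [closure_ball c hr.ne']
    obtain ⟨w, hw⟩ := mem_closure_iff.1 hcl O hOo hζO
    obtain ⟨j, hj⟩ := exists_diskSeq_mem (hOo.inter isOpen_ball)
      ⟨w, hw, hsub (ball_subset_closedBall hw.2)⟩
    exact ⟨j, hj.2, hO _ hj.1⟩

lemma measurableSet_hasZeroIn {E : Type*} [NormedAddCommGroup E] [MeasurableSpace E] [BorelSpace E]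
    (c : ℂ) (r : ℝ) : MeasurableSet {x : ℕ → E | HasZeroIn x c r} := by
  simp only [HasZeroIn, ofPred_forall, ofPred_exists]
  refine MeasurableSet.iInter fun k => MeasurableSet.iUnion fun j => ?_
  refine MeasurableSet.inter (MeasurableSet.const _) ?_
  exact measurableSet_lt (measurable_norm.comp (measurable_pi_apply j)) measurable_const

/-- A countable family of closed balls. -/
def diskBall (i : ℕ × ℕ) : Set ℂ := closedBall (diskSeq i.1) (1 / (i.2 + 1))

lemma exists_diskBall {V : Set ℂ} {ζ : ℂ} (hV : V ∈ 𝓝 ζ) (hζ : ζ ∈ ball (0 : ℂ) 1) :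
    ∃ i, ζ ∈ diskBall i ∧ diskBall i ⊆ V := by
  obtain ⟨ε, hε, hb⟩ := Metric.mem_nhds_iff.1 hV
  obtain ⟨k, hk⟩ := exists_nat_one_div_lt (half_pos hε)
  have hk0 : (0 : ℝ) < 1 / (k + 1) := by positivity
  obtain ⟨j, hj⟩ := exists_diskSeq_mem (isOpen_ball (x := ζ) (ε := 1 / (k + 1)))
    ⟨ζ, mem_ball_self hk0, hζ⟩
  refine ⟨(j, k), ?_, fun w hw => hb ?_⟩
  · simpa [diskBall, dist_comm] using (mem_ball.1 hj).le
  · have h1 : dist w (diskSeq j) ≤ 1 / (k + 1) := hw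
    have h2 := mem_ball.1 hj
    have := dist_triangle w (diskSeq j) ζ
    rw [mem_ball]; linarith

/-- The zeros of `f` in the unit disk. -/
def zeroSet (f : ℂ → ℂ) : Set ℂ := {ζ | ζ ∈ ball (0 : ℂ) 1 ∧ f ζ = 0}

open Classical in
/-- The linear statistic over the zeros, as a function of the values along `diskSeq`. -/
def zeroFunctional (φ : ℂ → ℝ≥0∞) (x : ℕ → ℂ) : ℝ≥0∞ :=
  ⨆ F : {F : Finset (ℕ × ℕ) // (∀ i ∈ F, diskBall i ⊆ ball 0 1) ∧
    (F : Set (ℕ × ℕ)).PairwiseDisjoint diskBall},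
    ∑ i ∈ F.1, if HasZeroIn x (diskSeq i.1) (1 / (i.2 + 1)) then ⨅ z ∈ diskBall i, φ z else 0

lemma measurable_zeroFunctional (φ : ℂ → ℝ≥0∞) : Measurable (zeroFunctional φ) := by
  unfold zeroFunctional
  refine Measurable.iSup fun F => Finset.measurable_sum _ fun i _ => ?_
  exact Measurable.ite (measurableSet_hasZeroIn _ _) measurable_const measurable_const

/-- A family of disjoint balls counts each chosen zero at most once and with at most its own weight.
In the other direction, finitely many zeros can be separated by small balls on which `φ` has dropped
by less than `δ`. -/
theorem zeroFunctional_eq_tsum {f : ℂ → ℂ} (hf : ContinuousOn f (ball 0 1)) {φ : ℂ → ℝ}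
    (hφ : Continuous φ) :
    zeroFunctional (fun z => ENNReal.ofReal (φ z)) (fun j => f (diskSeq j))
      = ∑' ζ : zeroSet f, ENNReal.ofReal (φ ζ) := by
  classical
  have hpos : ∀ k : ℕ, (0 : ℝ) < 1 / (k + 1) := fun k => by positivity
  apply le_antisymm
  · refine iSup_le fun ⟨F, hF, hd⟩ => ?_
    rw [← Finset.sum_filter,
      tsum_subtype (zeroSet f) fun ζ => ENNReal.ofReal (φ ζ)]
    have hz : ∀ i ∈ F.filter fun i => HasZeroIn (fun j => f (diskSeq j)) (diskSeq i.1)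
        (1 / (i.2 + 1)), ∃ ζ ∈ diskBall i, f ζ = 0 := fun i hi =>
      (hasZeroIn_iff hf (hpos _) (hF i (Finset.mem_filter.1 hi).1)).1 (Finset.mem_filter.1 hi).2
    choose! ζ hζ hζ0 using hz
    set G := F.filter fun i => HasZeroIn (fun j => f (diskSeq j)) (diskSeq i.1) (1 / (i.2 + 1))
    have hGF : ∀ i ∈ G, i ∈ F := fun i hi => (Finset.mem_filter.1 hi).1
    have hinj : InjOn ζ G := by
      intro i hi j hj hij
      by_contra hne
      exact disjoint_left.1 (hd (hGF i hi) (hGF j hj) hne) (hζ i hi) (hij ▸ hζ j hj)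
    refine le_trans (Finset.sum_le_sum fun i hi => (?_ :
      _ ≤ (zeroSet f).indicator (fun ζ => ENNReal.ofReal (φ ζ)) (ζ i))) ?_
    · rw [indicator_of_mem (show ζ i ∈ zeroSet f from
        ⟨hF i (hGF i hi) (hζ i hi), hζ0 i hi⟩)]
      exact iInf₂_le _ (hζ i hi)
    · rw [← Finset.sum_image (g := ζ) hinj]
      exact ENNReal.sum_le_tsum _
  · rw [ENNReal.tsum_eq_iSup_sum]
    refine iSup_le fun s => ENNReal.le_of_forall_pos_le_add fun ε hε _ => ?_
    -- The loss of `δ` at each of the `s.card` zeros adds up to at most `ε`; the `+ 1` covers empty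
    -- `s`.
    set δ : ℝ := ε / (s.card + 1) with hδ
    have hδ0 : 0 < δ := by positivity
    obtain ⟨U, hU, hUd⟩ := (s.finite_toSet.image Subtype.val).t2_separation
    have hex : ∀ ζ : zeroSet f, ∃ i, (ζ : ℂ) ∈ diskBall i ∧
        diskBall i ⊆ U ζ ∩ ball 0 1 ∩ {w | φ ζ - δ < φ w} := fun ζ =>
      exists_diskBall ((((hU ζ).2.inter isOpen_ball).inter
        (isOpen_lt continuous_const hφ)).mem_nhds
        ⟨⟨(hU ζ).1, ζ.2.1⟩, by simp [hδ0]⟩) ζ.2.1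
    choose i hi hisub using hex
    have hdis : ∀ ζ ∈ s, ∀ ξ ∈ s, ζ ≠ ξ → Disjoint (diskBall (i ζ)) (diskBall (i ξ)) := by
      intro ζ hζ ξ hξ hne
      refine (hUd (mem_image_of_mem _ hζ) (mem_image_of_mem _ hξ)
        fun h => hne (Subtype.ext h)).mono ?_ ?_
      · exact fun w hw => (hisub ζ hw).1.1
      · exact fun w hw => (hisub ξ hw).1.1
    have hinj : InjOn i s := by
      intro ζ hζ ξ hξ h
      by_contra hne
      exact disjoint_left.1 (hdis ζ hζ ξ hξ hne) (hi ζ) (h ▸ hi ζ)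
    have hle : ∑ ζ ∈ s, ENNReal.ofReal (φ ζ - δ)
        ≤ zeroFunctional (fun z => ENNReal.ofReal (φ z)) (fun j => f (diskSeq j)) := by
      refine le_trans ?_ (le_iSup _ (⟨s.image i, ?_, ?_⟩ : {F : Finset (ℕ × ℕ) //
        (∀ i ∈ F, diskBall i ⊆ ball 0 1) ∧ (F : Set (ℕ × ℕ)).PairwiseDisjoint diskBall}))
      · rw [Finset.sum_image hinj]
        refine Finset.sum_le_sum fun ζ _ => ?_
        rw [if_pos ((hasZeroIn_iff hf (hpos _) (fun w hw => (hisub ζ hw).1.2)).2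
          ⟨ζ, hi ζ, ζ.2.2⟩)]
        exact le_iInf₂ fun w hw => ENNReal.ofReal_le_ofReal (hisub ζ hw).2.le
      · intro j hj
        obtain ⟨ζ, -, rfl⟩ := Finset.mem_image.1 hj
        exact fun w hw => (hisub ζ hw).1.2
      · intro j hj k hk hjk
        obtain ⟨ζ, hζ, rfl⟩ := Finset.mem_image.1 (Finset.mem_coe.1 hj)
        obtain ⟨ξ, hξ, rfl⟩ := Finset.mem_image.1 (Finset.mem_coe.1 hk)
        exact hdis ζ hζ ξ hξ fun h => hjk (by rw [h])
    calc ∑ ζ ∈ s, ENNReal.ofReal (φ ζ)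
        ≤ ∑ ζ ∈ s, (ENNReal.ofReal (φ ζ - δ) + ENNReal.ofReal δ) :=
          Finset.sum_le_sum fun ζ _ => by
            refine le_trans ?_ ENNReal.ofReal_add_le
            simp
      _ = ∑ ζ ∈ s, ENNReal.ofReal (φ ζ - δ) + s.card * ENNReal.ofReal δ := by
          rw [Finset.sum_add_distrib]; simp
      _ ≤ _ := by
          refine add_le_add hle ?_
          rw [← ENNReal.ofReal_natCast, ← ENNReal.ofReal_mul (by positivity),
            ← ENNReal.ofReal_coe_nnreal]
          refine ENNReal.ofReal_le_ofReal ?_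
          rw [hδ, mul_div_assoc', div_le_iff₀ (by positivity)]
          nlinarith [ε.2]

end

end ZeroFunctional

end SU11

namespace SU11

/-! ### Convergence of the power series and separation of its first coefficients -/

section PowerSeries

open Set Filter Topology
open scoped ENNReal

noncomputable section

/-- The coefficients `√C(m + L - 1, m)`. -/
def coeff (L m : ℕ) : ℝ := √((m + L - 1).choose m : ℝ)

lemma coeff_nonneg (L m : ℕ) : 0 ≤ coeff L m := Real.sqrt_nonneg _

lemma coeff_pos {L : ℕ} (hL : 1 ≤ L) (m : ℕ) : 0 < coeff L m :=
  Real.sqrt_pos.2 (by exact_mod_cast Nat.choose_pos (by omega))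

lemma coeff_sq (L m : ℕ) : coeff L m ^ 2 = ((m + L - 1).choose m : ℝ) :=
  Real.sq_sqrt (by positivity)

lemma randomFunction_eq (L : ℕ) (a : ℕ → ℂ) (z : ℂ) :
    randomFunction L a z = ∑' m, (coeff L m : ℂ) * a m * z ^ m := rfl

/-- The termwise derivative of `randomFunction`. -/
def randomDeriv (L : ℕ) (a : ℕ → ℂ) (z : ℂ) : ℂ :=
  ∑' m : ℕ, (coeff L m : ℂ) * a m * (m * z ^ (m - 1))

/-- A sequence of radii increasing to `1`. -/
def radius (k : ℕ) : ℝ := 1 - 1 / (k + 2)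

lemma half_le_radius (k : ℕ) : 1 / 2 ≤ radius k := by
  have h : (1 : ℝ) / (k + 2) ≤ 1 / 2 := one_div_le_one_div_of_le (by norm_num) (by linarith [k.cast_nonneg (α := ℝ)])
  unfold radius; linarith

lemma radius_pos (k : ℕ) : 0 < radius k := by linarith [half_le_radius k]

lemma radius_lt_one (k : ℕ) : radius k < 1 := by
  have : (0 : ℝ) < 1 / (k + 2) := by positivity
  unfold radius; linarith

lemma exists_lt_radius {r : ℝ} (hr : r < 1) : ∃ k, r < radius k := by
  obtain ⟨k, hk⟩ := exists_nat_one_div_lt (sub_pos.2 hr)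
  refine ⟨k, ?_⟩
  have h : (1 : ℝ) / (k + 2) ≤ 1 / (k + 1) := one_div_le_one_div_of_le (by positivity) (by linarith)
  unfold radius; linarith

/-- Weights that dominate the terms of the power series and of its derivative. -/
def weight (L k m : ℕ) : ℝ := (m + 1) * coeff L m * radius k ^ (m - 1)

lemma weight_nonneg (L k m : ℕ) : 0 ≤ weight L k m := by
  have := coeff_nonneg L m
  have := (radius_pos k).le
  unfold weight; positivity

lemma coeff_mul_pow_le_weight (L k m : ℕ) {r : ℝ} (h0 : 0 ≤ r) (h : r ≤ radius k) :
    coeff L m * r ^ m ≤ weight L k m := by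
  have hc := coeff_nonneg L m
  have hR := (radius_pos k).le
  have h1 : r ^ m ≤ radius k ^ (m - 1) := by
    refine (pow_le_pow_left₀ h0 h m).trans ?_
    exact pow_le_pow_of_le_one hR (radius_lt_one k).le (Nat.sub_le m 1)
  unfold weight
  calc coeff L m * r ^ m ≤ coeff L m * radius k ^ (m - 1) := by gcongr
    _ = 1 * coeff L m * radius k ^ (m - 1) := by ring
    _ ≤ _ := by gcongr; linarith [m.cast_nonneg (α := ℝ)]

lemma coeff_mul_deriv_le_weight (L k m : ℕ) {r : ℝ} (h0 : 0 ≤ r) (h : r ≤ radius k) :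
    coeff L m * (m * r ^ (m - 1)) ≤ weight L k m := by
  have hc := coeff_nonneg L m
  have hR := (radius_pos k).le
  unfold weight
  calc coeff L m * (m * r ^ (m - 1)) = m * coeff L m * r ^ (m - 1) := by ring
    _ ≤ (m + 1) * coeff L m * radius k ^ (m - 1) := by gcongr; linarith

/-- The binomial coefficient is at least one, hence dominates its square root; the factor `m + 1` is
absorbed by raising the lower index of the binomial, leaving a convergent negative binomial series.
-/
lemma summable_weight {L : ℕ} (hL : 1 ≤ L) (k : ℕ) : Summable (weight L k) := by
  obtain ⟨l, rfl⟩ : ∃ l, L = l + 1 := ⟨L - 1, by omega⟩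
  have hR := radius_pos k
  have hs : Summable fun m : ℕ => ((m + (l + 1)).choose (l + 1) : ℝ) * radius k ^ m :=
    summable_choose_mul_geometric_of_norm_lt_one (l + 1)
      (by rw [Real.norm_eq_abs, abs_of_pos hR]; exact radius_lt_one k)
  refine Summable.of_nonneg_of_le (fun m => weight_nonneg _ k m) (fun m => ?_)
    (hs.mul_left (2 * ((l : ℝ) + 1)))
  have hc : coeff (l + 1) m ≤ ((m + l).choose l : ℝ) := by
    have h1 : ((m + (l + 1) - 1).choose m) = (m + l).choose l := by
      rw [show m + (l + 1) - 1 = m + l by omega]; exact Nat.choose_symm_add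
    have h2 : (1 : ℝ) ≤ ((m + l).choose l : ℝ) := by
      exact_mod_cast Nat.choose_pos (by omega)
    unfold coeff
    rw [h1, Real.sqrt_le_left (by positivity)]
    nlinarith
  have hid : ((m : ℝ) + l + 1) * (m + l).choose l = (m + (l + 1)).choose (l + 1) * (l + 1) := by
    exact_mod_cast Nat.add_one_mul_choose_eq (m + l) l
  -- Restoring the lost power costs a factor `2` because the radii are at least `1 / 2`; at `m = 0`
  -- the truncated exponent is harmless.
  have hp : radius k ^ (m - 1) ≤ 2 * radius k ^ m := by
    rcases m with _ | m
    · simp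
    · simp only [Nat.add_sub_cancel, pow_succ]
      nlinarith [half_le_radius k, pow_pos hR m]
  have hc0 := coeff_nonneg (l + 1) m
  calc weight (l + 1) k m ≤ (m + l + 1) * (m + l).choose l * (2 * radius k ^ m) := by
        unfold weight; gcongr; linarith [l.cast_nonneg (α := ℝ)]
    _ = _ := by rw [hid]; ring

/-- The weighted sum of the absolute values of the coefficients. -/
def weightSum (L k : ℕ) (a : ℕ → ℂ) : ℝ≥0∞ := ∑' m, ENNReal.ofReal (weight L k m) * ‖a m‖ₑ

/-- Coefficient sequences for which the power series converges in the disk. -/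
def IsTame (L : ℕ) (a : ℕ → ℂ) : Prop := ∀ k, weightSum L k a ≠ ⊤

lemma measurable_weightSum (L k : ℕ) : Measurable (weightSum L k) :=
  Measurable.tsum fun m => ((measurable_pi_apply m).enorm).const_mul _

lemma measurableSet_isTame (L : ℕ) : MeasurableSet {a | IsTame L a} := by
  simp only [IsTame, ofPred_forall]
  exact MeasurableSet.iInter fun k => (measurable_weightSum L k (measurableSet_singleton ⊤)).compl

lemma weightSum_term (L k : ℕ) (a : ℕ → ℂ) (m : ℕ) :
    ENNReal.ofReal (weight L k m) * ‖a m‖ₑ = ENNReal.ofReal (weight L k m * ‖a m‖) := by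
  rw [ENNReal.ofReal_mul (weight_nonneg L k m), ofReal_norm]

lemma IsTame.summable {L : ℕ} {a : ℕ → ℂ} (ha : IsTame L a) (k : ℕ) :
    Summable fun m => weight L k m * ‖a m‖ := by
  have h := ha k
  simp only [weightSum, weightSum_term] at h
  exact (ENNReal.summable_toReal h).congr fun m =>
    ENNReal.toReal_ofReal (mul_nonneg (weight_nonneg L k m) (norm_nonneg _))

lemma IsTame.toReal_weightSum {L : ℕ} {a : ℕ → ℂ} (ha : IsTame L a) (k : ℕ) :
    (weightSum L k a).toReal = ∑' m, weight L k m * ‖a m‖ := by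
  simp only [weightSum, weightSum_term]
  rw [← ENNReal.ofReal_tsum_of_nonneg
    (fun m => mul_nonneg (weight_nonneg L k m) (norm_nonneg _)) (ha.summable k),
    ENNReal.toReal_ofReal (tsum_nonneg fun m => mul_nonneg (weight_nonneg L k m) (norm_nonneg _))]

lemma norm_term_le (L k : ℕ) (a : ℕ → ℂ) {z : ℂ} (hz : ‖z‖ ≤ radius k) (m : ℕ) :
    ‖(coeff L m : ℂ) * a m * z ^ m‖ ≤ weight L k m * ‖a m‖ := by
  rw [norm_mul, norm_mul, norm_pow, Complex.norm_real, Real.norm_of_nonneg (coeff_nonneg L m)]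
  calc coeff L m * ‖a m‖ * ‖z‖ ^ m = coeff L m * ‖z‖ ^ m * ‖a m‖ := by ring
    _ ≤ _ := by gcongr; exact coeff_mul_pow_le_weight L k m (norm_nonneg z) hz

lemma norm_deriv_term_le (L k : ℕ) (a : ℕ → ℂ) {z : ℂ} (hz : ‖z‖ ≤ radius k) (m : ℕ) :
    ‖(coeff L m : ℂ) * a m * (m * z ^ (m - 1))‖ ≤ weight L k m * ‖a m‖ := by
  rw [norm_mul, norm_mul, norm_mul, norm_pow, Complex.norm_real,
    Real.norm_of_nonneg (coeff_nonneg L m), Complex.norm_natCast]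
  calc coeff L m * ‖a m‖ * (m * ‖z‖ ^ (m - 1)) = coeff L m * (m * ‖z‖ ^ (m - 1)) * ‖a m‖ := by ring
    _ ≤ _ := by gcongr; exact coeff_mul_deriv_le_weight L k m (norm_nonneg z) hz

variable {L : ℕ} {a b : ℕ → ℂ} {z : ℂ}

lemma IsTame.summable_term (ha : IsTame L a) (hz : z ∈ ball (0 : ℂ) 1) :
    Summable fun m => (coeff L m : ℂ) * a m * z ^ m := by
  obtain ⟨k, hk⟩ := exists_lt_radius (mem_ball_zero_iff.1 hz)
  exact Summable.of_norm_bounded (ha.summable k) fun m => norm_term_le L k a hk.le m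

lemma IsTame.summable_deriv_term (ha : IsTame L a) (hz : z ∈ ball (0 : ℂ) 1) :
    Summable fun m => (coeff L m : ℂ) * a m * (m * z ^ (m - 1)) := by
  obtain ⟨k, hk⟩ := exists_lt_radius (mem_ball_zero_iff.1 hz)
  exact Summable.of_norm_bounded (ha.summable k) fun m => norm_deriv_term_le L k a hk.le m

lemma IsTame.norm_randomFunction_le (ha : IsTame L a) {k : ℕ} (hz : ‖z‖ ≤ radius k) :
    ‖randomFunction L a z‖ ≤ (weightSum L k a).toReal := by
  rw [ha.toReal_weightSum, randomFunction_eq]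
  exact tsum_of_norm_bounded (ha.summable k).hasSum fun m => norm_term_le L k a hz m

lemma IsTame.norm_randomDeriv_le (ha : IsTame L a) {k : ℕ} (hz : ‖z‖ ≤ radius k) :
    ‖randomDeriv L a z‖ ≤ (weightSum L k a).toReal := by
  rw [ha.toReal_weightSum, randomDeriv]
  exact tsum_of_norm_bounded (ha.summable k).hasSum fun m => norm_deriv_term_le L k a hz m

lemma IsTame.hasDerivAt (ha : IsTame L a) (hz : z ∈ ball (0 : ℂ) 1) :
    HasDerivAt (randomFunction L a) (randomDeriv L a z) z := by
  obtain ⟨k, hk⟩ := exists_lt_radius (mem_ball_zero_iff.1 hz)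
  have hder : ∀ (m : ℕ) (y : ℂ), y ∈ ball (0 : ℂ) (radius k) →
      HasDerivAt (fun z => (coeff L m : ℂ) * a m * z ^ m)
        ((coeff L m : ℂ) * a m * (m * y ^ (m - 1))) y := fun m y _ =>
    (hasDerivAt_pow m y).const_mul ((coeff L m : ℂ) * a m)
  have hbd : ∀ (m : ℕ) (y : ℂ), y ∈ ball (0 : ℂ) (radius k) →
      ‖(coeff L m : ℂ) * a m * (m * y ^ (m - 1))‖ ≤ weight L k m * ‖a m‖ := fun m y hy =>
    norm_deriv_term_le L k a (mem_ball_zero_iff.1 hy).le m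
  exact hasDerivAt_tsum_of_isPreconnected (ha.summable k) isOpen_ball
    (convex_ball (0 : ℂ) (radius k)).isPreconnected hder hbd
    (mem_ball_self (radius_pos k)) (ha.summable_term (mem_ball_self one_pos))
    (mem_ball_zero_iff.2 hk)

lemma IsTame.differentiableOn (ha : IsTame L a) :
    DifferentiableOn ℂ (randomFunction L a) (ball 0 1) := fun _ hz =>
  (ha.hasDerivAt hz).differentiableAt.differentiableWithinAt

lemma IsTame.continuousOn (ha : IsTame L a) : ContinuousOn (randomFunction L a) (ball 0 1) :=
  ha.differentiableOn.continuousOn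

lemma IsTame.analyticAt (ha : IsTame L a) (hz : z ∈ ball (0 : ℂ) 1) :
    AnalyticAt ℂ (randomFunction L a) z :=
  ha.differentiableOn.analyticAt (isOpen_ball.mem_nhds hz)

lemma IsTame.continuousOn_randomDeriv (ha : IsTame L a) :
    ContinuousOn (randomDeriv L a) (ball 0 1) := by
  have h : ContinuousOn (deriv (randomFunction L a)) (ball 0 1) :=
    (ha.differentiableOn.deriv isOpen_ball).continuousOn
  exact h.congr fun z hz => (ha.hasDerivAt hz).deriv.symm

/-- The concatenation of a finite tuple and a sequence. -/
def join (n : ℕ) (t : Fin n → ℂ) (b : ℕ → ℂ) (m : ℕ) : ℂ :=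
  if h : m < n then t ⟨m, h⟩ else b (m - n)

lemma join_add {n : ℕ} (t : Fin n → ℂ) (b : ℕ → ℂ) (m : ℕ) :
    join n t b m = join n t 0 m + join n 0 b m := by
  unfold join; split_ifs <;> simp

lemma measurable_join (n : ℕ) : Measurable fun p : (Fin n → ℂ) × (ℕ → ℂ) => join n p.1 p.2 := by
  refine measurable_pi_lambda _ fun m => ?_
  unfold join
  split_ifs
  · exact (measurable_pi_apply _).comp measurable_fst
  · exact (measurable_pi_apply _).comp measurable_snd

lemma weightSum_join_zero_ne_top {n : ℕ} (t : Fin n → ℂ) (k : ℕ) :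
    weightSum L k (join n t 0) ≠ ⊤ := by
  rw [weightSum, tsum_eq_sum (s := Finset.range n)]
  · exact ENNReal.sum_ne_top.2 fun m _ => ENNReal.mul_ne_top ENNReal.ofReal_ne_top enorm_ne_top
  · intro m hm
    simp [join, Finset.mem_range.not.1 hm]

lemma weightSum_join_zero_le {n : ℕ} (t : Fin n → ℂ) (b : ℕ → ℂ) (k : ℕ) :
    weightSum L k (join n 0 b) ≤ weightSum L k (join n t b) := by
  refine ENNReal.tsum_le_tsum fun m => ?_
  gcongr
  unfold join; split_ifs <;> simp

lemma isTame_join_zero_left (n : ℕ) (t : Fin n → ℂ) : IsTame L (join n t 0) :=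
  weightSum_join_zero_ne_top t

/-- Changing finitely many coefficients does not affect convergence, so tameness can be fixed once
for the tail before the head is varied. -/
lemma isTame_join_iff {n : ℕ} (t : Fin n → ℂ) (b : ℕ → ℂ) :
    IsTame L (join n t b) ↔ IsTame L (join n 0 b) := by
  refine ⟨fun h k => ne_top_of_le_ne_top (h k) (weightSum_join_zero_le t b k), fun h k => ?_⟩
  refine ne_top_of_le_ne_top (ENNReal.add_ne_top.2 ⟨weightSum_join_zero_ne_top t k, h k⟩)
    (?_ : _ ≤ weightSum L k (join n t 0) + weightSum L k (join n 0 b))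
  rw [weightSum, weightSum, weightSum, ← ENNReal.tsum_add]
  refine ENNReal.tsum_le_tsum fun m => ?_
  rw [← mul_add, join_add]
  gcongr
  exact enorm_add_le _ _

lemma randomFunction_join {n : ℕ} (t : Fin n → ℂ) {b : ℕ → ℂ} (hb : IsTame L (join n 0 b))
    (hz : z ∈ ball (0 : ℂ) 1) :
    randomFunction L (join n t b) z
      = (∑ i : Fin n, (coeff L i : ℂ) * t i * z ^ (i : ℕ)) + randomFunction L (join n 0 b) z := by
  have h1 : randomFunction L (join n t 0) z = ∑ i : Fin n, (coeff L i : ℂ) * t i * z ^ (i : ℕ) := by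
    rw [randomFunction_eq, tsum_eq_sum (s := Finset.range n), Finset.sum_range]
    · simp [join]
    · intro m hm
      simp [join, Finset.mem_range.not.1 hm]
  rw [← h1]
  simp only [randomFunction_eq]
  rw [← ((isTame_join_zero_left n t).summable_term hz).tsum_add (hb.summable_term hz)]
  refine tsum_congr fun m => ?_
  rw [join_add]; ring

lemma randomDeriv_join {n : ℕ} (t : Fin n → ℂ) {b : ℕ → ℂ} (hb : IsTame L (join n 0 b))
    (hz : z ∈ ball (0 : ℂ) 1) :
    randomDeriv L (join n t b) z
      = (∑ i : Fin n, (coeff L i : ℂ) * t i * ((i : ℕ) * z ^ ((i : ℕ) - 1)))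
        + randomDeriv L (join n 0 b) z := by
  have h1 : randomDeriv L (join n t 0) z
      = ∑ i : Fin n, (coeff L i : ℂ) * t i * ((i : ℕ) * z ^ ((i : ℕ) - 1)) := by
    rw [randomDeriv, tsum_eq_sum (s := Finset.range n), Finset.sum_range]
    · simp [join]
    · intro m hm
      simp [join, Finset.mem_range.not.1 hm]
  rw [← h1]
  simp only [randomDeriv]
  rw [← ((isTame_join_zero_left n t).summable_deriv_term hz).tsum_add (hb.summable_deriv_term hz)]
  refine tsum_congr fun m => ?_
  rw [join_add]; ring

lemma measurable_tsum_of_summable {α : Type*} [MeasurableSpace α] {s : Set α} (hs : MeasurableSet s)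
    {u : ℕ → α → ℂ} (hu : ∀ m, Measurable (u m)) (hsum : ∀ x ∈ s, Summable fun m => u m x) :
    Measurable (s.indicator fun x => ∑' m, u m x) := by
  refine measurable_of_tendsto_metrizable (f := fun N => s.indicator fun x =>
    ∑ m ∈ Finset.range N, u m x) (fun N => ?_) ?_
  · exact (Finset.measurable_sum _ fun m _ => hu m).indicator hs
  · rw [tendsto_pi_nhds]
    intro x
    by_cases hx : x ∈ s
    · simpa only [indicator_of_mem hx] using (hsum x hx).hasSum.tendsto_sum_nat
    · simp only [indicator_of_notMem hx]; exact tendsto_const_nhds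

lemma measurableSet_isTame_disk (L : ℕ) :
    MeasurableSet {p : (ℕ → ℂ) × ℂ | IsTame L p.1 ∧ p.2 ∈ ball (0 : ℂ) 1} :=
  (measurable_fst (measurableSet_isTame L)).inter (measurable_snd measurableSet_ball)

lemma measurable_randomFunction (L : ℕ) :
    Measurable ({p : (ℕ → ℂ) × ℂ | IsTame L p.1 ∧ p.2 ∈ ball (0 : ℂ) 1}.indicator
      fun p => randomFunction L p.1 p.2) :=
  measurable_tsum_of_summable (measurableSet_isTame_disk L) (fun m => by fun_prop)
    fun _ hp => hp.1.summable_term hp.2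

lemma measurable_randomDeriv (L : ℕ) :
    Measurable ({p : (ℕ → ℂ) × ℂ | IsTame L p.1 ∧ p.2 ∈ ball (0 : ℂ) 1}.indicator
      fun p => randomDeriv L p.1 p.2) :=
  measurable_tsum_of_summable (measurableSet_isTame_disk L) (fun m => by fun_prop)
    fun _ hp => hp.1.summable_deriv_term hp.2

end

end PowerSeries

end SU11

namespace SU11

/-! ### The Gaussian sequence: independence of head and tail, and moments -/

section GaussianSequence

open Set Filter Topology
open scoped ENNReal NNReal

noncomputable section

/-- The density of `stdComplexGaussian`. -/
def gaussDensity (z : ℂ) : ℝ :=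
  gaussianPDFReal 0 (1 / 2) z.re * gaussianPDFReal 0 (1 / 2) z.im

lemma gaussDensity_pos (z : ℂ) : 0 < gaussDensity z :=
  mul_pos (gaussianPDFReal_pos _ _ _ (by norm_num)) (gaussianPDFReal_pos _ _ _ (by norm_num))

lemma continuous_gaussDensity : Continuous gaussDensity := by
  unfold gaussDensity
  simp only [gaussianPDFReal]
  fun_prop

lemma gaussDensity_le (z : ℂ) : gaussDensity z ≤ gaussDensity 0 := by
  have h : ∀ x : ℝ, gaussianPDFReal 0 (1 / 2) x ≤ gaussianPDFReal 0 (1 / 2) 0 := by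
    intro x
    simp only [gaussianPDFReal]
    gcongr ?_ * Real.exp ?_
    have : 0 ≤ (x - 0) ^ 2 / (2 * ((1 / 2 : ℝ≥0) : ℝ)) := by positivity
    rw [neg_div]
    simpa using this
  unfold gaussDensity
  exact mul_le_mul (h _) (h _) (gaussianPDFReal_nonneg _ _ _) (gaussianPDFReal_nonneg _ _ _)

lemma stdComplexGaussian_eq_withDensity :
    stdComplexGaussian = volume.withDensity fun z => ENNReal.ofReal (gaussDensity z) := by
  have hv : (1 / 2 : ℝ≥0) ≠ 0 := by norm_num
  have hmp := Complex.volume_preserving_equiv_real_prod.symm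
  rw [stdComplexGaussian, gaussianReal_of_var_ne_zero 0 hv,
    prod_withDensity (measurable_gaussianPDF _ _) (measurable_gaussianPDF _ _)]
  ext s hs
  rw [MeasurableEquiv.map_apply, withDensity_apply _
    (Complex.measurableEquivRealProd.symm.measurable hs), withDensity_apply _ hs]
  rw [← hmp.setLIntegral_comp_preimage_emb Complex.measurableEquivRealProd.symm.measurableEmbedding]
  refine lintegral_congr fun p => ?_
  simp only [gaussDensity, gaussianPDF_def]
  rw [← ENNReal.ofReal_mul (gaussianPDFReal_nonneg _ _ _)]
  simp [Complex.measurableEquivRealProd_symm_apply]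

instance : IsProbabilityMeasure stdComplexGaussian := by
  unfold stdComplexGaussian
  exact Measure.isProbabilityMeasure_map (MeasurableEquiv.measurable _).aemeasurable

lemma lintegral_pi_fin_prod {n : ℕ} {f : Fin n → ℂ → ℝ≥0∞} (hf : ∀ i, Measurable (f i)) :
    ∫⁻ t : Fin n → ℂ, ∏ i, f i (t i) = ∏ i, ∫⁻ z, f i z := by
  induction n with
  | zero => simp [volume_pi]
  | succ n ih =>
    have hmp := (volume_preserving_piFinSuccAbove (fun _ : Fin (n + 1) => ℂ) 0).symm
    rw [← hmp.lintegral_comp_emb (MeasurableEquiv.measurableEmbedding _)]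
    simp only [Fin.prod_univ_succ]
    rw [← ih fun i => hf i.succ]
    rw [Measure.volume_eq_prod, ← lintegral_prod_mul (hf 0).aemeasurable]
    · refine lintegral_congr fun p => ?_
      simp [MeasurableEquiv.piFinSuccAbove_symm_apply]
    · exact (Finset.measurable_prod _ fun i _ =>
        (hf i.succ).comp (measurable_pi_apply i)).aemeasurable

lemma pi_stdComplexGaussian (n : ℕ) :
    Measure.pi (fun _ : Fin n => stdComplexGaussian)
      = volume.withDensity fun t : Fin n → ℂ => ENNReal.ofReal (∏ i, gaussDensity (t i)) := by
  refine Measure.pi_eq fun s hs => ?_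
  have hd : Measurable fun z => ENNReal.ofReal (gaussDensity z) :=
    continuous_gaussDensity.measurable.ennreal_ofReal
  rw [withDensity_apply _ (MeasurableSet.univ_pi hs),
    ← lintegral_indicator (MeasurableSet.univ_pi hs)]
  simp_rw [stdComplexGaussian_eq_withDensity, withDensity_apply _ (hs _),
    ← lintegral_indicator (hs _)]
  rw [← lintegral_pi_fin_prod fun i => hd.indicator (hs i)]
  refine lintegral_congr fun t => ?_
  by_cases ht : t ∈ univ.pi s
  · rw [indicator_of_mem ht, ENNReal.ofReal_prod_of_nonneg fun i _ => (gaussDensity_pos _).le]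
    exact Finset.prod_congr rfl fun i _ => by rw [indicator_of_mem (ht i (mem_univ i))]
  · rw [indicator_of_notMem ht]
    simp only [Set.mem_pi, mem_univ, true_implies, not_forall] at ht
    obtain ⟨i, hi⟩ := ht
    exact (Finset.prod_eq_zero (Finset.mem_univ i) (by rw [indicator_of_notMem hi])).symm

/-- The law of a sequence of independent standard complex Gaussian variables. -/
def gaussSeq : Measure (ℕ → ℂ) := Measure.infinitePi fun _ => stdComplexGaussian

instance : IsProbabilityMeasure gaussSeq := by unfold gaussSeq; infer_instance

/-- Prepending `n` independent Gaussians to an independent Gaussian sequence reproduces the law of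
the sequence. It suffices to compare cylinder sets, which split into a head box and a tail cylinder.
-/
lemma map_join_gaussSeq (n : ℕ) :
    ((Measure.pi fun _ : Fin n => stdComplexGaussian).prod gaussSeq).map
      (fun p => join n p.1 p.2) = gaussSeq := by
  classical
  refine Measure.eq_infinitePi _ fun s t ht => ?_
  set t₀ : ℕ → Set ℂ := fun m => if m ∈ s then t m else univ with ht₀
  have ht₀m : ∀ m, MeasurableSet (t₀ m) := fun m => by
    simp only [ht₀]; split_ifs; exacts [ht m, MeasurableSet.univ]
  obtain ⟨N, hN⟩ : ∃ N, s ⊆ Finset.range (n + N) := by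
    obtain ⟨N, hN⟩ := s.exists_nat_subset_range
    exact ⟨N, hN.trans (Finset.range_mono (by omega))⟩
  have hpre : (fun p : (Fin n → ℂ) × (ℕ → ℂ) => join n p.1 p.2) ⁻¹' (s : Set ℕ).pi t
      = (univ.pi fun i : Fin n => t₀ i) ×ˢ
        ((Finset.range N : Set ℕ).pi fun m => t₀ (n + m)) := by
    ext p
    simp only [mem_preimage, Set.mem_pi, Finset.mem_coe, mem_prod, mem_univ, true_implies,
      Finset.mem_range, ht₀]
    constructor
    · intro h
      refine ⟨fun i => ?_, fun m _ => ?_⟩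
      · split_ifs with hi
        · simpa [join] using h i hi
        · trivial
      · split_ifs with hi
        · simpa [join] using h _ hi
        · trivial
    · rintro ⟨h1, h2⟩ m hm
      by_cases hmn : m < n
      · simpa [join, hmn, hm] using h1 ⟨m, hmn⟩
      · have hm2 := Finset.mem_range.1 (hN hm)
        have := h2 (m - n) (by omega)
        rw [show n + (m - n) = m by omega, if_pos hm] at this
        simpa [join, hmn] using this
  rw [Measure.map_apply (measurable_join n) (MeasurableSet.pi s.countable_toSet fun m _ => ht m),
    hpre, Measure.prod_prod, Measure.pi_pi, gaussSeq, Measure.infinitePi_pi _ fun m _ => ht₀m _,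
    ← Finset.prod_range (fun m => stdComplexGaussian (t₀ m)), ← Finset.prod_range_add,
    ← Finset.prod_subset hN]
  · exact Finset.prod_congr rfl fun m hm => by simp [ht₀, hm]
  · intro m _ hm; simp [ht₀, hm]

lemma lintegral_gaussSeq_join (n : ℕ) {F : (ℕ → ℂ) → ℝ≥0∞} (hF : AEMeasurable F gaussSeq) :
    ∫⁻ a, F a ∂gaussSeq = ∫⁻ b, (∫⁻ t : Fin n → ℂ,
      ENNReal.ofReal (∏ i, gaussDensity (t i)) * F (join n t b)) ∂gaussSeq := by
  have hF' := hF
  rw [← map_join_gaussSeq n] at hF'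
  have hj : AEMeasurable (fun p : (Fin n → ℂ) × (ℕ → ℂ) => join n p.1 p.2)
    ((Measure.pi fun _ : Fin n => stdComplexGaussian).prod gaussSeq) :=
    (measurable_join n).aemeasurable
  conv_lhs => rw [← map_join_gaussSeq n]
  rw [lintegral_map' hF' hj,
    lintegral_prod_symm (fun p : (Fin n → ℂ) × (ℕ → ℂ) => F (join n p.1 p.2))
      (hF'.comp_aemeasurable hj)]
  refine lintegral_congr fun b => ?_
  -- For a fixed tail, measurability of `F (join n t b)` in `t` is not known, so the version that
  -- only asks for a finite measurable density is used.
  rw [pi_stdComplexGaussian, lintegral_withDensity_eq_lintegral_mul_non_measurable _ ?_ (by simp)]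
  · rfl
  · have := continuous_gaussDensity
    exact Measurable.ennreal_ofReal (by fun_prop)

lemma ae_gaussSeq_of_join (n : ℕ) {p : (ℕ → ℂ) → Prop} (hp : MeasurableSet {a | p a})
    (h : ∀ᵐ b ∂gaussSeq, ∀ᵐ t : Fin n → ℂ, p (join n t b)) : ∀ᵐ a ∂gaussSeq, p a := by
  have h0 : ∫⁻ a, {a | p a}ᶜ.indicator 1 a ∂gaussSeq = 0 := by
    rw [lintegral_gaussSeq_join n ((measurable_one.indicator hp.compl).aemeasurable),
      lintegral_eq_zero_of_ae_eq_zero]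
    filter_upwards [h] with b hb
    refine lintegral_eq_zero_of_ae_eq_zero ?_
    filter_upwards [hb] with t ht
    simp [ht]
  rw [lintegral_indicator_one hp.compl] at h0
  exact h0

lemma ae_join_of_gaussSeq (n : ℕ) {p : (ℕ → ℂ) → Prop} (hp : ∀ᵐ a ∂gaussSeq, p a) :
    ∀ᵐ b ∂gaussSeq, ∀ᵐ t ∂(Measure.pi fun _ : Fin n => stdComplexGaussian), p (join n t b) := by
  rw [← map_join_gaussSeq n] at hp
  have h1 := ae_of_ae_map (measurable_join n).aemeasurable hp
  have h2 := Measure.measurePreserving_swap.quasiMeasurePreserving.ae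
    (μa := gaussSeq.prod (Measure.pi fun _ : Fin n => stdComplexGaussian)) h1
  exact Measure.ae_ae_of_ae_prod h2

lemma map_eval_gaussSeq (m : ℕ) : gaussSeq.map (fun a => a m) = stdComplexGaussian :=
  Measure.infinitePi_map_eval _ m

lemma lintegral_enorm_pow_stdComplexGaussian (k : ℕ) :
    ∫⁻ z, ‖z‖ₑ ^ k ∂stdComplexGaussian ≠ ⊤ := by
  have h1 : MemLp (fun z : ℂ => z) k stdComplexGaussian := by
    unfold stdComplexGaussian
    refine (memLp_map_measure_iff (by fun_prop) (MeasurableEquiv.measurable _).aemeasurable).2 ?_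
    have hre := ((memLp_id_gaussianReal' (μ := 0) (v := 1 / 2) (k : ℝ≥0∞) (by simp)).comp_fst
      (gaussianReal 0 (1 / 2))).ofReal (K := ℂ)
    have him := ((memLp_id_gaussianReal' (μ := 0) (v := 1 / 2) (k : ℝ≥0∞) (by simp)).comp_snd
      (gaussianReal 0 (1 / 2))).ofReal (K := ℂ)
    refine (hre.add (him.const_mul Complex.I)).congr_norm ?_ (ae_of_all _ fun p => ?_)
    · exact (MeasurableEquiv.measurable _).aestronglyMeasurable
    · simp only [Pi.add_apply, Function.comp_apply, Complex.measurableEquivRealProd_symm_apply]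
      congr 1
      apply Complex.ext <;> simp
  rcases Nat.eq_zero_or_pos k with rfl | hk
  · simp
  have h2 := lintegral_rpow_enorm_lt_top_of_eLpNorm_lt_top (by simp; omega) (by simp) h1.2
  simpa using h2.ne

/-- The weighted power mean inequality: it holds for the partial sums, and the total weight enters
with exponent `j - 1`. It reduces moments of the whole series to moments of one Gaussian. -/
lemma pow_weightSum_le (L k : ℕ) {j : ℕ} (hj : 1 ≤ j) (a : ℕ → ℂ) :
    weightSum L k a ^ j ≤ ((∑' m, ENNReal.ofReal (weight L k m)) ^ (1 - (j : ℝ)⁻¹)) ^ j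
      * ∑' m, ENNReal.ofReal (weight L k m) * ‖a m‖ₑ ^ j := by
  have hj' : (1 : ℝ) ≤ j := by exact_mod_cast hj
  refine le_of_tendsto ((ENNReal.continuous_pow j).continuousAt.tendsto.comp
    (ENNReal.tendsto_nat_tsum _)) (Eventually.of_forall fun N => ?_)
  have h := ENNReal.inner_le_weight_mul_Lp_of_nonneg (Finset.range N) hj'
    (fun m => ENNReal.ofReal (weight L k m)) fun m => ‖a m‖ₑ
  simp only [Function.comp_apply]
  calc _ ≤ _ := pow_le_pow_left' h j
    _ = ((∑ m ∈ Finset.range N, ENNReal.ofReal (weight L k m)) ^ (1 - (j : ℝ)⁻¹)) ^ j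
        * ∑ m ∈ Finset.range N, ENNReal.ofReal (weight L k m) * ‖a m‖ₑ ^ j := by
        rw [mul_pow]
        congr 1
        rw [← ENNReal.rpow_natCast, ← ENNReal.rpow_mul, inv_mul_cancel₀ (by positivity),
          ENNReal.rpow_one]
        simp
    _ ≤ _ := by
        gcongr
        · have : (j : ℝ)⁻¹ ≤ 1 := inv_le_one_of_one_le₀ hj'
          linarith
        · exact ENNReal.sum_le_tsum _
        · exact ENNReal.sum_le_tsum _

lemma tsum_weight_ne_top {L : ℕ} (hL : 1 ≤ L) (k : ℕ) :
    ∑' m, ENNReal.ofReal (weight L k m) ≠ ⊤ := by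
  rw [← ENNReal.ofReal_tsum_of_nonneg (weight_nonneg L k) (summable_weight hL k)]
  exact ENNReal.ofReal_ne_top

lemma lintegral_weightSum_pow {L : ℕ} (hL : 1 ≤ L) (k j : ℕ) :
    ∫⁻ a, weightSum L k a ^ j ∂gaussSeq ≠ ⊤ := by
  rcases Nat.eq_zero_or_pos j with rfl | hj
  · simp
  have hj' : (1 : ℝ) ≤ j := by exact_mod_cast hj
  have hm : ∀ m : ℕ, Measurable fun a : ℕ → ℂ => ‖a m‖ₑ ^ j := fun m => by fun_prop
  refine ne_top_of_le_ne_top ?_ (lintegral_mono fun a => pow_weightSum_le L k hj a)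
  rw [lintegral_const_mul _ (Measurable.tsum fun m => (hm m).const_mul _),
    lintegral_tsum fun m => ((hm m).const_mul _).aemeasurable]
  have heq : ∀ m, ∫⁻ a, ENNReal.ofReal (weight L k m) * ‖a m‖ₑ ^ j ∂gaussSeq
      = ENNReal.ofReal (weight L k m) * ∫⁻ z, ‖z‖ₑ ^ j ∂stdComplexGaussian := fun m => by
    rw [lintegral_const_mul _ (hm m), ← map_eval_gaussSeq m, lintegral_map (by fun_prop) (by fun_prop)]
  simp_rw [heq]
  rw [ENNReal.tsum_mul_right]
  refine ENNReal.mul_ne_top (ENNReal.pow_ne_top (ENNReal.rpow_ne_top_of_nonneg ?_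
    (tsum_weight_ne_top hL k))) (ENNReal.mul_ne_top (tsum_weight_ne_top hL k)
    (lintegral_enorm_pow_stdComplexGaussian j))
  have : (j : ℝ)⁻¹ ≤ 1 := inv_le_one_of_one_le₀ hj'
  linarith

lemma ae_isTame {L : ℕ} (hL : 1 ≤ L) : ∀ᵐ a ∂gaussSeq, IsTame L a := by
  simp only [IsTame]
  rw [ae_all_iff]
  intro k
  have h := lintegral_weightSum_pow hL k 1
  simp only [pow_one] at h
  filter_upwards [ae_lt_top (measurable_weightSum L k) h] with a ha using ha.ne

lemma lintegral_weightSum_join_pow {L : ℕ} (hL : 1 ≤ L) (n k j : ℕ) :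
    ∫⁻ b, weightSum L k (join n 0 b) ^ j ∂gaussSeq ≠ ⊤ := by
  refine ne_top_of_le_ne_top (lintegral_weightSum_pow hL k j) ?_
  have hm : Measurable fun a => weightSum L k a ^ j := (measurable_weightSum L k).pow_const j
  conv_rhs => rw [← map_join_gaussSeq n]
  rw [lintegral_map hm (measurable_join n),
    lintegral_prod_symm (fun p : (Fin n → ℂ) × (ℕ → ℂ) => weightSum L k (join n p.1 p.2) ^ j)
      (hm.comp (measurable_join n)).aemeasurable]
  refine lintegral_mono fun b => ?_
  calc weightSum L k (join n 0 b) ^ j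
      = ∫⁻ _, weightSum L k (join n 0 b) ^ j ∂(Measure.pi fun _ : Fin n => stdComplexGaussian) := by
        simp
    _ ≤ _ := lintegral_mono fun t => pow_le_pow_left' (weightSum_join_zero_le t b k) j

lemma ae_isTame_join {L : ℕ} (hL : 1 ≤ L) (n : ℕ) :
    ∀ᵐ b ∂gaussSeq, IsTame L (join n 0 b) := by
  filter_upwards [ae_join_of_gaussSeq n (ae_isTame hL)] with b hb
  obtain ⟨t, ht⟩ := hb.exists
  exact (isTame_join_iff t b).1 ht

end

end GaussianSequence

end SU11

namespace SU11

/-! ### Almost sure simplicity of the zeros, and sums over tuples of zeros -/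

section SimpleZeros

open Set Filter Topology
open scoped ENNReal NNReal

noncomputable section

variable {L : ℕ} {a : ℕ → ℂ}

/-- All zeros of the random function in the unit disk are simple. -/
def HasSimpleZeros (L : ℕ) (a : ℕ → ℂ) : Prop :=
  ∀ ζ ∈ ball (0 : ℂ) 1, randomFunction L a ζ = 0 → randomDeriv L a ζ ≠ 0

/-- Values of the random function along `diskSeq`. -/
def diskValues (L : ℕ) (a : ℕ → ℂ) (j : ℕ) : ℂ :=
  {p : (ℕ → ℂ) × ℂ | IsTame L p.1 ∧ p.2 ∈ ball (0 : ℂ) 1}.indicator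
    (fun p => randomFunction L p.1 p.2) (a, diskSeq j)

lemma IsTame.diskValues_eq (ha : IsTame L a) :
    diskValues L a = fun j => randomFunction L a (diskSeq j) := by
  funext j
  exact indicator_of_mem (show (a, (diskSeq j : ℂ)) ∈ {p : (ℕ → ℂ) × ℂ | IsTame L p.1 ∧
    p.2 ∈ ball (0 : ℂ) 1} from ⟨ha, (diskSeq j).2⟩) _

lemma measurable_diskValues (L : ℕ) : Measurable (diskValues L) :=
  measurable_pi_lambda _ fun _ =>
    (measurable_randomFunction L).comp (measurable_id.prodMk measurable_const)

/-- A multiple zero is a zero of the continuous pair formed by the function and its derivative, so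
`hasZeroIn_iff` turns its absence from each closed ball of radius `radius k` into countably many
conditions. -/
lemma measurableSet_simpleZeros (L : ℕ) :
    MeasurableSet {a | IsTame L a ∧ HasSimpleZeros L a} := by
  set V : (ℕ → ℂ) → ℕ → ℂ × ℂ := fun a j => (diskValues L a j,
    {p : (ℕ → ℂ) × ℂ | IsTame L p.1 ∧ p.2 ∈ ball (0 : ℂ) 1}.indicator
      (fun p => randomDeriv L p.1 p.2) (a, diskSeq j)) with hV
  have hVm : Measurable V := measurable_pi_lambda _ fun j =>
    ((measurable_pi_apply j).comp (measurable_diskValues L)).prodMk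
      ((measurable_randomDeriv L).comp (measurable_id.prodMk measurable_const))
  have hset : {a | IsTame L a ∧ HasSimpleZeros L a}
      = {a | IsTame L a} ∩ ⋂ k, (V ⁻¹' {x | HasZeroIn x 0 (radius k)})ᶜ := by
    ext a
    simp only [mem_ofPred_eq, mem_inter_iff, mem_iInter, mem_compl_iff, mem_preimage]
    refine and_congr_right fun ha => ?_
    have hVa : V a = fun j => (fun z => (randomFunction L a z, randomDeriv L a z)) (diskSeq j) := by
      funext j
      simp only [hV, ha.diskValues_eq]
      rw [indicator_of_mem (show (a, (diskSeq j : ℂ)) ∈ {p : (ℕ → ℂ) × ℂ | IsTame L p.1 ∧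
        p.2 ∈ ball (0 : ℂ) 1} from ⟨ha, (diskSeq j).2⟩)]
    have hsub : ∀ k, closedBall (0 : ℂ) (radius k) ⊆ ball 0 1 := fun k =>
      closedBall_subset_ball (radius_lt_one k)
    simp_rw [hVa, hasZeroIn_iff (ha.continuousOn.prodMk ha.continuousOn_randomDeriv)
      (radius_pos _) (hsub _)]
    constructor
    · rintro h k ⟨ζ, hζ, h0⟩
      exact h ζ (hsub k hζ) (congrArg Prod.fst h0) (congrArg Prod.snd h0)
    · intro h ζ hζ h0 h1
      obtain ⟨k, hk⟩ := exists_lt_radius (mem_ball_zero_iff.1 hζ)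
      exact h k ⟨ζ, mem_closedBall_zero_iff.2 hk.le, Prod.ext h0 h1⟩
  rw [hset]
  exact (measurableSet_isTame L).inter (MeasurableSet.iInter fun k =>
    (hVm (measurableSet_hasZeroIn _ _)).compl)

/-- Vary only the constant coefficient. With `g` the rest of the series, a double zero at `z` forces
that coefficient to equal `-g z / coeff L 0` at a critical point of `g`; by Sard such critical
values form a null set. -/
lemma ae_simpleZeros (hL : 1 ≤ L) :
    ∀ᵐ a ∂gaussSeq, IsTame L a ∧ HasSimpleZeros L a := by
  refine ae_gaussSeq_of_join 1 (measurableSet_simpleZeros L) ?_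
  filter_upwards [ae_isTame_join hL 1] with b hb
  have hc : (coeff L 0 : ℂ) ≠ 0 := by exact_mod_cast (coeff_pos hL 0).ne'
  set g := randomFunction L (join 1 0 b)
  set s : Set ℂ := {z | z ∈ ball (0 : ℂ) 1 ∧ randomDeriv L (join 1 0 b) z = 0}
  set h : ℂ → ℂ := fun z => -g z / coeff L 0
  have hnull : (volume : Measure ℂ) (h '' s) = 0 := by
    refine addHaar_image_eq_zero_of_det_fderivWithin_eq_zero (f' := fun _ => 0) volume ?_ ?_
    · intro z hz
      have h1 : HasDerivAt h 0 z := by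
        have := ((hb.hasDerivAt hz.1).neg).div_const (coeff L 0 : ℂ)
        rwa [hz.2, neg_zero, zero_div] at this
      have h2 := h1.hasFDerivAt.restrictScalars ℝ
      refine HasFDerivAt.hasFDerivWithinAt (h2.congr_fderiv ?_)
      ext; simp
    · intro z _
      simp [ContinuousLinearMap.det]
  have hnull' : (volume : Measure (Fin 1 → ℂ)) (Function.eval 0 ⁻¹' (h '' s)) = 0 :=
    Measure.pi_eval_preimage_null _ hnull
  filter_upwards [measure_eq_zero_iff_ae_notMem.1 hnull'] with t ht
  refine ⟨(isTame_join_iff t b).2 hb, fun ζ hζ h0 h1 => ht ⟨ζ, ⟨hζ, ?_⟩, ?_⟩⟩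
  · simpa [randomDeriv_join t hb hζ] using h1
  · rw [randomFunction_join t hb hζ] at h0
    simp only [Fin.sum_univ_one, Fin.val_zero, pow_zero, mul_one] at h0
    simp only [h, Function.eval]
    rw [div_eq_iff hc, neg_eq_iff_add_eq_zero, add_comm, mul_comm]
    exact h0

/-- Infinitely many zeros in a compact set would accumulate at a zero, which is isolated because the
derivative there is nonzero. -/
lemma finite_zeroSet_inter (ha : IsTame L a) (hs : HasSimpleZeros L a) {C : Set ℂ}
    (hC : IsCompact C) (hCD : C ⊆ ball 0 1) : (zeroSet (randomFunction L a) ∩ C).Finite := by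
  by_contra hinf
  obtain ⟨ζ, hζ, hacc⟩ := Set.Infinite.exists_accPt_of_subset_isCompact hinf hC inter_subset_right
  rw [accPt_iff_frequently_nhdsNE] at hacc
  have hfr : ∃ᶠ w in 𝓝[≠] ζ, randomFunction L a w = 0 := hacc.mono fun w hw => hw.1.2
  have han := ha.analyticAt (hCD hζ)
  have h0 : randomFunction L a ζ = 0 := han.frequently_zero_iff_eventually_zero.1 hfr |>.self_of_nhds
  exact hfr ((ha.hasDerivAt (hCD hζ)).eventually_ne (hs ζ (hCD hζ) h0))

lemma zeroSum_eq_finsum (ha : IsTame L a) (hs : HasSimpleZeros L a) (φ : ℂ → ℝ) :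
    zeroSum (randomFunction L a) φ = ∑ᶠ ζ ∈ zeroSet (randomFunction L a), φ ζ := by
  unfold zeroSum
  refine finsum_congr fun ζ => ?_
  by_cases hζ : ζ ∈ ball (0 : ℂ) 1
  · by_cases h0 : randomFunction L a ζ = 0
    · have h1 : analyticOrderAt (randomFunction L a) ζ = 1 :=
        (ha.analyticAt hζ).analyticOrderAt_eq_one_of_zero_deriv_ne_zero h0
          (by rw [(ha.hasDerivAt hζ).deriv]; exact hs ζ hζ h0)
      rw [mem_ball_zero_iff] at hζ
      simp [zeroSet, hζ, h0, analyticOrderNatAt, h1]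
    · have h1 : analyticOrderAt (randomFunction L a) ζ = 0 :=
        (ha.analyticAt hζ).analyticOrderAt_eq_zero.2 h0
      simp [zeroSet, h0, analyticOrderNatAt, h1]
  · rw [mem_ball_zero_iff] at hζ
    simp [zeroSet, hζ]

/-- Test functions: continuous with compact support in the disk. -/
structure IsDiskTest (φ : ℂ → ℝ) : Prop where
  continuous : Continuous φ
  hasCompactSupport : HasCompactSupport φ
  tsupport_subset : tsupport φ ⊆ ball 0 1

lemma IsDiskTest.abs {φ : ℂ → ℝ} (h : IsDiskTest φ) : IsDiskTest fun z => |φ z| := by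
  have hsub : tsupport (fun z => |φ z|) ⊆ tsupport φ :=
    closure_mono fun z hz => by simpa using hz
  exact ⟨h.continuous.abs, h.hasCompactSupport.of_isClosed_subset (isClosed_tsupport _) hsub,
    hsub.trans h.tsupport_subset⟩

lemma zeroSum_eq_sum (ha : IsTame L a) (hs : HasSimpleZeros L a) {φ : ℂ → ℝ} {F : Finset ℂ}
    (hF : ∀ ζ ∈ F, ζ ∈ zeroSet (randomFunction L a))
    (hF' : ∀ ζ ∈ zeroSet (randomFunction L a), φ ζ ≠ 0 → ζ ∈ F) :
    zeroSum (randomFunction L a) φ = ∑ ζ ∈ F, φ ζ := by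
  rw [zeroSum_eq_finsum ha hs]
  refine finsum_mem_eq_sum_of_inter_support_eq _ ?_
  ext ζ
  simp only [mem_inter_iff, Function.mem_support, Finset.mem_coe]
  exact ⟨fun h => ⟨hF' ζ h.1 h.2, h.2⟩, fun h => ⟨hF ζ h.1, h.2⟩⟩

/-- The linear statistic as a measurable functional of the values along `diskSeq`. -/
def realZeroFunctional (φ : ℂ → ℝ) (x : ℕ → ℂ) : ℝ :=
  (zeroFunctional (fun z => ENNReal.ofReal (φ z)) x).toReal
    - (zeroFunctional (fun z => ENNReal.ofReal (-φ z)) x).toReal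

lemma measurable_realZeroFunctional (φ : ℂ → ℝ) : Measurable (realZeroFunctional φ) :=
  (measurable_zeroFunctional _).ennreal_toReal.sub (measurable_zeroFunctional _).ennreal_toReal

lemma tsum_zeroSet_eq_sum {f : ℂ → ℂ} {φ : ℂ → ℝ≥0∞} {F : Finset ℂ}
    (hF : ∀ ζ ∈ F, ζ ∈ zeroSet f) (hF' : ∀ ζ ∈ zeroSet f, φ ζ ≠ 0 → ζ ∈ F) :
    ∑' ζ : zeroSet f, φ ζ = ∑ ζ ∈ F, φ ζ := by
  rw [tsum_subtype (zeroSet f) φ, tsum_eq_sum (s := F)]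
  · exact Finset.sum_congr rfl fun ζ hζ => indicator_of_mem (hF ζ hζ) _
  · intro ζ hζ
    by_contra h
    by_cases hz : ζ ∈ zeroSet f
    · rw [indicator_of_mem hz] at h; exact hζ (hF' ζ hz h)
    · exact h (indicator_of_notMem hz _)

lemma realZeroFunctional_eq_finsum {f : ℂ → ℂ} (hf : ContinuousOn f (ball 0 1)) {φ : ℂ → ℝ}
    (hφ : Continuous φ) (hfin : (zeroSet f ∩ tsupport φ).Finite) :
    realZeroFunctional φ (fun j => f (diskSeq j)) = ∑ᶠ ζ ∈ zeroSet f, φ ζ := by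
  have hF : ∀ ζ ∈ hfin.toFinset, ζ ∈ zeroSet f := fun ζ h => ((Finite.mem_toFinset _).1 h).1
  have hF' : ∀ ζ ∈ zeroSet f, φ ζ ≠ 0 → ζ ∈ hfin.toFinset := fun ζ h1 h2 =>
    (Finite.mem_toFinset _).2 ⟨h1, subset_tsupport _ h2⟩
  have hsum : ∑ᶠ ζ ∈ zeroSet f, φ ζ = ∑ ζ ∈ hfin.toFinset, φ ζ := by
    refine finsum_mem_eq_sum_of_inter_support_eq _ ?_
    ext ζ
    simp only [mem_inter_iff, Function.mem_support, Finset.mem_coe]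
    exact ⟨fun h => ⟨hF' ζ h.1 h.2, h.2⟩, fun h => ⟨hF ζ h.1, h.2⟩⟩
  rw [realZeroFunctional, zeroFunctional_eq_tsum hf hφ, zeroFunctional_eq_tsum hf (φ := fun z => -φ z) hφ.neg, hsum,
    tsum_zeroSet_eq_sum (φ := fun ζ => ENNReal.ofReal (φ ζ)) hF,
    tsum_zeroSet_eq_sum (φ := fun ζ => ENNReal.ofReal (-φ ζ)) hF,
    ENNReal.toReal_sum (by simp), ENNReal.toReal_sum (by simp), ← Finset.sum_sub_distrib]
  · refine Finset.sum_congr rfl fun ζ _ => ?_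
    simp only [ENNReal.toReal_ofReal']
    exact max_zero_sub_eq_self _
  · exact fun ζ h1 h2 => hF' ζ h1 fun h => h2 (by simp [h])
  · exact fun ζ h1 h2 => hF' ζ h1 fun h => h2 (by simp [h])

lemma zeroSum_eq_realZeroFunctional (ha : IsTame L a) (hs : HasSimpleZeros L a) {φ : ℂ → ℝ}
    (hφ : IsDiskTest φ) :
    zeroSum (randomFunction L a) φ = realZeroFunctional φ (diskValues L a) := by
  rw [ha.diskValues_eq, realZeroFunctional_eq_finsum ha.continuousOn hφ.continuous
    (finite_zeroSet_inter ha hs hφ.hasCompactSupport hφ.tsupport_subset), zeroSum_eq_finsum ha hs]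

lemma aemeasurable_zeroSum (hL : 1 ≤ L) {φ : ℂ → ℝ} (hφ : IsDiskTest φ) :
    AEMeasurable (fun a => zeroSum (randomFunction L a) φ) gaussSeq := by
  refine ⟨fun a => realZeroFunctional φ (diskValues L a),
    (measurable_realZeroFunctional φ).comp (measurable_diskValues L), ?_⟩
  filter_upwards [ae_simpleZeros hL] with a ha
  exact zeroSum_eq_realZeroFunctional ha.1 ha.2 hφ

lemma IsTestTuple.isDiskTest {n : ℕ} {φ : Fin n → ℂ → ℝ} (hφ : IsTestTuple φ) (p : Fin n) :
    IsDiskTest (φ p) :=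
  ⟨(hφ.contDiff p).continuous, hφ.hasCompactSupport p, hφ.tsupport_subset p⟩

/-- The tuples of distinct zeros of `f` in the disk. -/
def zeroTuples (n : ℕ) (f : ℂ → ℂ) : Set (Fin n → ℂ) := {z | z ∈ config n ∧ ∀ p, f (z p) = 0}

/-- Because the supports are disjoint, any tuple of zeros with `z p` in the support of `φ p`
automatically has distinct entries, so products of sums expand into sums over `zeroTuples`. The two
signs `ε` isolate the positive and negative parts, through `max x 0 = (|x| + x) / 2`, so that
nonnegative integrals suffice later. -/
lemma tsum_zeroTuples_eq (ha : IsTame L a) (hs : HasSimpleZeros L a) {n : ℕ} {φ : Fin n → ℂ → ℝ}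
    (hφ : IsTestTuple φ) (ε : ℝ) (hε : ε = 1 ∨ ε = -1) :
    ∑' z : zeroTuples n (randomFunction L a), ENNReal.ofReal (ε * ∏ p, φ p (z.1 p))
      = ENNReal.ofReal ((∏ p, zeroSum (randomFunction L a) (fun w => |φ p w|)
        + ε * ∏ p, zeroSum (randomFunction L a) (φ p)) / 2) ∧
      |∏ p, zeroSum (randomFunction L a) (φ p)|
        ≤ ∏ p, zeroSum (randomFunction L a) (fun w => |φ p w|) := by
  classical
  set f := randomFunction L a
  have hfin : ∀ p, (zeroSet f ∩ tsupport (φ p)).Finite := fun p =>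
    finite_zeroSet_inter ha hs (hφ.hasCompactSupport p) (hφ.tsupport_subset p)
  set F : Fin n → Finset ℂ := fun p => (hfin p).toFinset with hFdef
  have hF : ∀ p, ∀ ζ ∈ F p, ζ ∈ zeroSet f := fun p ζ h => ((Finite.mem_toFinset _).1 h).1
  have hFt : ∀ p, ∀ ζ ∈ F p, ζ ∈ tsupport (φ p) := fun p ζ h => ((Finite.mem_toFinset _).1 h).2
  have hF' : ∀ p, ∀ ζ ∈ zeroSet f, φ p ζ ≠ 0 → ζ ∈ F p := fun p ζ h1 h2 =>
    (Finite.mem_toFinset _).2 ⟨h1, subset_tsupport _ h2⟩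
  have h1 : ∑' z : zeroTuples n f, ENNReal.ofReal (ε * ∏ p, φ p (z.1 p))
      = ∑ z ∈ Fintype.piFinset F, ENNReal.ofReal (ε * ∏ p, φ p (z p)) := by
    rw [tsum_subtype (zeroTuples n f) fun z => ENNReal.ofReal (ε * ∏ p, φ p (z p)),
      tsum_eq_sum (s := Fintype.piFinset F)]
    · refine Finset.sum_congr rfl fun z hz => indicator_of_mem ?_ _
      rw [Fintype.mem_piFinset] at hz
      refine ⟨⟨fun p => (hF p _ (hz p)).1, fun p q hpq => ?_⟩, fun p => (hF p _ (hz p)).2⟩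
      by_contra hne
      exact disjoint_left.1 (hφ.disjoint hne) (hFt p _ (hz p)) (hpq ▸ hFt q _ (hz q))
    · intro z hz
      by_contra h
      by_cases hzt : z ∈ zeroTuples n f
      · rw [indicator_of_mem hzt] at h
        refine hz (Fintype.mem_piFinset.2 fun p => hF' p _ ⟨hzt.1.1 p, hzt.2 p⟩ fun h0 => h ?_)
        rw [Finset.prod_eq_zero (Finset.mem_univ p) h0]; simp
      · exact h (indicator_of_notMem hzt _)
  have h2 : ∏ p, zeroSum f (φ p) = ∑ z ∈ Fintype.piFinset F, ∏ p, φ p (z p) := by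
    rw [← Finset.prod_univ_sum]
    exact Finset.prod_congr rfl fun p _ => zeroSum_eq_sum ha hs (hF p) (hF' p)
  have h3 : ∏ p, zeroSum f (fun w => |φ p w|)
      = ∑ z ∈ Fintype.piFinset F, |∏ p, φ p (z p)| := by
    simp_rw [Finset.abs_prod]
    rw [← Finset.prod_univ_sum F fun p w => |φ p w|]
    exact Finset.prod_congr rfl fun p _ => zeroSum_eq_sum ha hs (hF p)
      fun ζ hζ h => hF' p ζ hζ (by simpa using h)
  refine ⟨?_, by rw [h2, h3]; exact Finset.abs_sum_le_sum_abs _ _⟩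
  rw [h1, h2, h3, Finset.mul_sum, ← Finset.sum_add_distrib, Finset.sum_div,
    ENNReal.ofReal_sum_of_nonneg]
  · refine Finset.sum_congr rfl fun z _ => ?_
    have habs : |ε * ∏ p, φ p (z p)| = |∏ p, φ p (z p)| := by
      rcases hε with rfl | rfl <;> simp
    rw [← habs]
    rcases le_total 0 (ε * ∏ p, φ p (z p)) with h | h
    · rw [abs_of_nonneg h]; congr 1; ring
    · rw [abs_of_nonpos h, ENNReal.ofReal_of_nonpos h]; simp
  · intro z _
    have := abs_le.1 (le_refl |∏ p, φ p (z p)|)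
    rcases hε with rfl | rfl <;> linarith

end

end SimpleZeros

end SU11

namespace SU11

/-! ### Interpolation at prescribed zeros and its Jacobian -/

section Interpolation

open Set Filter Topology
open scoped ENNReal NNReal

noncomputable section

variable {n L : ℕ}

lemma isOpen_config (n : ℕ) : IsOpen (config n) := by
  have h : config n = (⋂ p : Fin n, (fun z : Fin n → ℂ => z p) ⁻¹' ball 0 1) ∩
      ⋂ p : Fin n, ⋂ q : Fin n, ⋂ _ : p ≠ q, {z : Fin n → ℂ | z p ≠ z q} := by
    ext z
    simp only [config, mem_ofPred_eq, mem_inter_iff, mem_iInter, mem_preimage]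
    refine and_congr_right fun _ => ⟨fun h p q hpq => h.ne hpq, fun h p q hpq => ?_⟩
    by_contra hne
    exact h p q hne hpq
  rw [h]
  refine (isOpen_iInter_of_finite fun p => isOpen_ball.preimage (continuous_apply p)).inter
    (isOpen_iInter_of_finite fun p => isOpen_iInter_of_finite fun q =>
      isOpen_iInter_of_finite fun _ => ?_)
  exact isOpen_ne_fun (continuous_apply p) (continuous_apply q)

/-- The matrix that evaluates the first `n` basis functions at `n` points. -/
def evalMatrix (L : ℕ) (z : Fin n → ℂ) : Matrix (Fin n) (Fin n) ℂ :=
  Matrix.of fun q m => (coeff L m : ℂ) * z q ^ (m : ℕ)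

/-- The matrix that evaluates the derivatives of the first `n` basis functions at `n` points. -/
def derivMatrix (L : ℕ) (z : Fin n → ℂ) : Matrix (Fin n) (Fin n) ℂ :=
  Matrix.of fun q m => (coeff L m : ℂ) * ((m : ℕ) * z q ^ ((m : ℕ) - 1))

lemma det_evalMatrix_ne_zero (hL : 1 ≤ L) {z : Fin n → ℂ} (hz : z ∈ config n) :
    (evalMatrix L z).det ≠ 0 := by
  have h : evalMatrix L z
      = Matrix.vandermonde z * Matrix.diagonal fun m : Fin n => (coeff L m : ℂ) := by
    ext q m
    simp [evalMatrix, Matrix.mul_diagonal, Matrix.vandermonde, mul_comm]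
  rw [h, Matrix.det_mul, Matrix.det_diagonal]
  refine mul_ne_zero (Matrix.det_vandermonde_ne_zero_iff.2 hz.2) (Finset.prod_ne_zero_iff.2 fun m _ => ?_)
  exact_mod_cast (coeff_pos hL m).ne'

/-- The coefficients of the interpolating combination of basis functions with values `-G`. -/
def interp (L : ℕ) (z G : Fin n → ℂ) : Fin n → ℂ := (evalMatrix L z)⁻¹ *ᵥ (-G)

/-- The derivatives at `z` of a function vanishing at `z`, in terms of the values `G` and `G'` of
its tail and of the derivative of the tail. -/
def slope (L : ℕ) (z G G' : Fin n → ℂ) : Fin n → ℂ := derivMatrix L z *ᵥ interp L z G + G'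

/-- The density of zeros at `z`, given the values of the tail. -/
def krDensity (L : ℕ) (z G G' : Fin n → ℂ) : ℝ :=
  (∏ i, gaussDensity (interp L z G i)) *
    ((∏ q, ‖slope L z G G' q‖ ^ 2) / ‖(evalMatrix L z).det‖ ^ 2)

lemma krDensity_nonneg (z G G' : Fin n → ℂ) : 0 ≤ krDensity L z G G' := by
  have : 0 ≤ ∏ i, gaussDensity (interp L z G i) :=
    Finset.prod_nonneg fun i _ => (gaussDensity_pos _).le
  unfold krDensity; positivity

lemma contDiffAt_det {𝕜 E ι : Type*} [NontriviallyNormedField 𝕜] [NormedAddCommGroup E]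
    [NormedSpace 𝕜 E] [Fintype ι] [DecidableEq ι] {M : E → Matrix ι ι 𝕜} {x : E} {k : WithTop ℕ∞}
    (h : ∀ i j, ContDiffAt 𝕜 k (fun y => M y i j) x) :
    ContDiffAt 𝕜 k (fun y => (M y).det) x := by
  simp only [Matrix.det_apply]
  exact ContDiffAt.sum fun σ _ => (contDiffAt_prod fun i _ => h _ _).const_smul _

lemma contDiffAt_inv_apply {𝕜 E ι : Type*} [NontriviallyNormedField 𝕜] [NormedAddCommGroup E]
    [NormedSpace 𝕜 E] [CompleteSpace 𝕜] [Fintype ι] [DecidableEq ι] {M : E → Matrix ι ι 𝕜} {x : E}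
    {k : WithTop ℕ∞} (h : ∀ i j, ContDiffAt 𝕜 k (fun y => M y i j) x) (hx : (M x).det ≠ 0)
    (i j : ι) : ContDiffAt 𝕜 k (fun y => (M y)⁻¹ i j) x := by
  simp only [Matrix.inv_def, Matrix.smul_apply, Ring.inverse_eq_inv', Matrix.adjugate_apply,
    smul_eq_mul]
  refine ((contDiffAt_det h).inv hx).mul (contDiffAt_det fun p q => ?_)
  by_cases hp : p = j
  · subst hp; simp only [Matrix.updateRow_self]; exact contDiffAt_const
  · simp only [Matrix.updateRow_ne hp]; exact h p q

lemma contDiff_evalMatrix (L : ℕ) (q m : Fin n) :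
    ContDiff ℂ 1 fun z : Fin n → ℂ => evalMatrix L z q m := by
  simp only [evalMatrix, Matrix.of_apply]
  fun_prop

lemma contDiffAt_evalMatrix_inv (hL : 1 ≤ L) {z : Fin n → ℂ} (hz : z ∈ config n) (m p : Fin n) :
    ContDiffAt ℂ 1 (fun z : Fin n → ℂ => (evalMatrix L z)⁻¹ m p) z :=
  contDiffAt_inv_apply (fun q m => (contDiff_evalMatrix L q m).contDiffAt)
    (det_evalMatrix_ne_zero hL hz) m p

lemma continuousAt_det_evalMatrix (z : Fin n → ℂ) :
    ContinuousAt (fun z : Fin n → ℂ => (evalMatrix L z).det) z :=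
  (contDiffAt_det fun q m => (contDiff_evalMatrix L q m).contDiffAt).continuousAt

lemma continuous_derivMatrix (q m : Fin n) :
    Continuous fun z : Fin n → ℂ => derivMatrix L z q m := by
  simp only [derivMatrix, Matrix.of_apply]
  fun_prop

lemma continuousAt_krDensity (hL : 1 ≤ L) {x : (Fin n → ℂ) × (Fin n → ℂ) × (Fin n → ℂ)}
    (hx : x.1 ∈ config n) :
    ContinuousAt (fun x : (Fin n → ℂ) × (Fin n → ℂ) × (Fin n → ℂ) =>
      krDensity L x.1 x.2.1 x.2.2) x := by
  have hinv : ∀ m p, ContinuousAt (fun x : (Fin n → ℂ) × (Fin n → ℂ) × (Fin n → ℂ) =>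
      (evalMatrix L x.1)⁻¹ m p) x := fun m p =>
    ContinuousAt.comp (f := Prod.fst) (contDiffAt_evalMatrix_inv hL hx m p).continuousAt
      continuousAt_fst
  have hint : ∀ m, ContinuousAt (fun x : (Fin n → ℂ) × (Fin n → ℂ) × (Fin n → ℂ) =>
      interp L x.1 x.2.1 m) x := fun m => by
    simp only [interp, Matrix.mulVec, dotProduct]
    exact tendsto_finsetSum _ fun p _ => (hinv m p).mul (by fun_prop)
  have hslope : ∀ q, ContinuousAt (fun x : (Fin n → ℂ) × (Fin n → ℂ) × (Fin n → ℂ) =>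
      slope L x.1 x.2.1 x.2.2 q) x := fun q => by
    simp only [slope, Matrix.mulVec, dotProduct, Pi.add_apply]
    refine ContinuousAt.add (tendsto_finsetSum _ fun m _ => ?_) (by fun_prop)
    exact ((continuous_derivMatrix q m).comp continuous_fst).continuousAt.mul (hint m)
  unfold krDensity
  refine ContinuousAt.mul ?_ (ContinuousAt.div ?_ ?_ ?_)
  · exact tendsto_finsetProd _ fun i _ => continuous_gaussDensity.continuousAt.comp (hint i)
  · exact tendsto_finsetProd _ fun q _ => (hslope q).norm.pow 2
  · exact (ContinuousAt.comp (f := Prod.fst) (continuousAt_det_evalMatrix x.1)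
      continuousAt_fst).norm.pow 2
  · exact pow_ne_zero 2 (norm_ne_zero_iff.2 (det_evalMatrix_ne_zero hL hx))

/-- The constant in the bound for `krDensity`. -/
def krBound (L : ℕ) (z : Fin n → ℂ) : ℝ :=
  gaussDensity 0 ^ n * ((∏ q, (∑ m, ‖derivMatrix L z q m‖ * ∑ p, ‖(evalMatrix L z)⁻¹ m p‖ + 1) ^ 2)
    / ‖(evalMatrix L z).det‖ ^ 2)

lemma continuousAt_krBound (hL : 1 ≤ L) {z : Fin n → ℂ} (hz : z ∈ config n) :
    ContinuousAt (krBound (n := n) L) z := by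
  unfold krBound
  refine continuousAt_const.mul (ContinuousAt.div ?_ ?_ ?_)
  · refine tendsto_finsetProd _ fun q _ => (ContinuousAt.add (tendsto_finsetSum _ fun m _ => ?_)
      continuousAt_const).pow 2
    exact (continuous_derivMatrix q m).continuousAt.norm.mul (tendsto_finsetSum _ fun p _ =>
      (contDiffAt_evalMatrix_inv hL hz m p).continuousAt.norm)
  · exact (continuousAt_det_evalMatrix z).norm.pow 2
  · exact pow_ne_zero 2 (norm_ne_zero_iff.2 (det_evalMatrix_ne_zero hL hz))

/-- The slopes are linear in the tail values, so their squared product has degree `2 * n`, while the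
Gaussian factor is at most its value at the origin. Polynomial growth is what the moments of
`weightSum` can absorb. -/
lemma krDensity_le {z G G' : Fin n → ℂ} {x : ℝ} (hG : ∀ p, ‖G p‖ ≤ x)
    (hG' : ∀ p, ‖G' p‖ ≤ x) : krDensity L z G G' ≤ krBound L z * x ^ (2 * n) := by
  have h1 : ∀ m, ‖interp L z G m‖ ≤ (∑ p, ‖(evalMatrix L z)⁻¹ m p‖) * x := fun m => by
    simp only [interp, Matrix.mulVec, dotProduct]
    rw [Finset.sum_mul]
    refine (norm_sum_le _ _).trans (Finset.sum_le_sum fun p _ => ?_)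
    rw [norm_mul, Pi.neg_apply, norm_neg]
    gcongr
    exact hG p
  have h2 : ∀ q, ‖slope L z G G' q‖
      ≤ (∑ m, ‖derivMatrix L z q m‖ * ∑ p, ‖(evalMatrix L z)⁻¹ m p‖ + 1) * x := fun q => by
    simp only [slope, Matrix.mulVec, dotProduct, Pi.add_apply]
    rw [add_mul, one_mul, Finset.sum_mul]
    refine (norm_add_le _ _).trans (add_le_add ((norm_sum_le _ _).trans
      (Finset.sum_le_sum fun m _ => ?_)) (hG' q))
    rw [norm_mul, mul_assoc]
    gcongr
    exact h1 m
  have h3 : ∏ i, gaussDensity (interp L z G i) ≤ gaussDensity 0 ^ n := by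
    calc _ ≤ ∏ _i : Fin n, gaussDensity 0 :=
          Finset.prod_le_prod (fun i _ => (gaussDensity_pos _).le) fun i _ => gaussDensity_le _
      _ = _ := by simp
  have h4 : ∏ q, ‖slope L z G G' q‖ ^ 2
      ≤ (∏ q, (∑ m, ‖derivMatrix L z q m‖ * ∑ p, ‖(evalMatrix L z)⁻¹ m p‖ + 1) ^ 2)
        * x ^ (2 * n) := by
    have : x ^ (2 * n) = ∏ _q : Fin n, x ^ 2 := by simp [pow_mul]
    rw [this, ← Finset.prod_mul_distrib]
    refine Finset.prod_le_prod (fun q _ => by positivity) fun q _ => ?_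
    rw [← mul_pow]
    gcongr
    exact h2 q
  have hg := (gaussDensity_pos 0).le
  unfold krDensity krBound
  rw [mul_assoc, div_mul_eq_mul_div]
  gcongr

/-- The tuple of values of a function. -/
def evalAt (g : ℂ → ℂ) (z : Fin n → ℂ) : Fin n → ℂ := fun p => g (z p)

variable {b : ℕ → ℂ} {z : Fin n → ℂ}

/-- Vanishing at all `z p` is a linear system for the head with invertible matrix `evalMatrix L z`.
This identifies tuples of zeros with a fibre of the interpolation map. -/
lemma mem_zeroTuples_join_iff (hL : 1 ≤ L) (hb : IsTame L (join n 0 b)) (t : Fin n → ℂ)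
    (hz : z ∈ config n) :
    z ∈ zeroTuples n (randomFunction L (join n t b))
      ↔ interp L z (evalAt (randomFunction L (join n 0 b)) z) = t := by
  have hdet := (det_evalMatrix_ne_zero hL hz).isUnit
  have h1 : z ∈ zeroTuples n (randomFunction L (join n t b))
      ↔ evalMatrix L z *ᵥ t = -evalAt (randomFunction L (join n 0 b)) z := by
    rw [funext_iff]
    refine ⟨fun h p => ?_, fun h => ⟨hz, fun p => ?_⟩⟩
    · have h2 := h.2 p
      rw [randomFunction_join t hb (hz.1 p)] at h2
      rw [Pi.neg_apply, eq_neg_iff_add_eq_zero, ← h2]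
      simp only [evalMatrix, Matrix.mulVec, dotProduct, Matrix.of_apply, evalAt]
      congr 1
      exact Finset.sum_congr rfl fun i _ => by ring
    · rw [randomFunction_join t hb (hz.1 p)]
      have h2 := h p
      rw [Pi.neg_apply, eq_neg_iff_add_eq_zero] at h2
      rw [← h2]
      simp only [evalMatrix, Matrix.mulVec, dotProduct, Matrix.of_apply, evalAt]
      congr 1
      exact Finset.sum_congr rfl fun i _ => by ring
  rw [h1, interp]
  constructor
  · intro h
    rw [← h, Matrix.mulVec_mulVec, Matrix.nonsing_inv_mul _ hdet, Matrix.one_mulVec]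
  · rintro rfl
    rw [Matrix.mulVec_mulVec, Matrix.mul_nonsing_inv _ hdet, Matrix.one_mulVec]

/-- The coefficients of the interpolation, as a function of the points. -/
def interpMap (L n : ℕ) (b : ℕ → ℂ) (z : Fin n → ℂ) : Fin n → ℂ :=
  interp L z (evalAt (randomFunction L (join n 0 b)) z)

lemma contDiffAt_interpMap (hL : 1 ≤ L) (hb : IsTame L (join n 0 b)) (hz : z ∈ config n) :
    ContDiffAt ℂ 1 (interpMap L n b) z := by
  refine contDiffAt_pi.2 fun m => ?_
  simp only [interpMap, interp, Matrix.mulVec, dotProduct, Pi.neg_apply, evalAt]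
  refine ContDiffAt.sum fun p _ => (contDiffAt_evalMatrix_inv hL hz m p).mul (ContDiffAt.neg ?_)
  exact ContDiffAt.comp z (g := randomFunction L (join n 0 b)) (f := fun z : Fin n → ℂ => z p)
    (hb.analyticAt (hz.1 p)).contDiffAt (contDiff_apply ℂ ℂ p).contDiffAt

/-- Implicit differentiation of the interpolation identity. Row `q` depends on the points other than
`z q` only through the coefficients, so moving the points contributes a diagonal matrix whose
entries are the derivatives of the full function at its zeros. -/
lemma evalMatrix_mulVec_fderiv (hL : 1 ≤ L) (hb : IsTame L (join n 0 b)) (hz : z ∈ config n)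
    (v : Fin n → ℂ) :
    evalMatrix L z *ᵥ (fderiv ℂ (interpMap L n b) z v)
      = Matrix.diagonal (-slope L z (evalAt (randomFunction L (join n 0 b)) z)
          (evalAt (randomDeriv L (join n 0 b)) z)) *ᵥ v := by
  set T := interpMap L n b
  set T' := fderiv ℂ T z
  funext q
  have hT : HasFDerivAt T T' z :=
    ((contDiffAt_interpMap hL hb hz).differentiableAt one_ne_zero).hasFDerivAt
  have hγ : HasDerivAt (fun s : ℂ => z + s • v) v 0 := by
    simpa using ((hasDerivAt_id (0 : ℂ)).smul_const v).const_add z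
  have hγq : HasDerivAt (fun s : ℂ => z q + s * v q) (v q) 0 := by
    simpa using ((hasDerivAt_id (0 : ℂ)).mul_const (v q)).const_add (z q)
  have hTγ : HasDerivAt (fun s : ℂ => T (z + s • v)) (T' v) 0 := by
    have hT0 : HasFDerivAt T T' (z + (0 : ℂ) • v) := by simpa using hT
    exact hT0.comp_hasDerivAt (0 : ℂ) hγ
  have hg : HasDerivAt (fun s : ℂ => randomFunction L (join n 0 b) (z q + s * v q))
      (randomDeriv L (join n 0 b) (z q) * v q) 0 := by
    have h0 : HasDerivAt (randomFunction L (join n 0 b)) (randomDeriv L (join n 0 b) (z q))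
        (z q + 0 * v q) := by simpa using hb.hasDerivAt (hz.1 q)
    exact h0.comp (0 : ℂ) hγq
  have hsum : HasDerivAt (fun s : ℂ => (∑ m : Fin n, (coeff L m : ℂ) * (z q + s * v q) ^ (m : ℕ) *
        T (z + s • v) m) + randomFunction L (join n 0 b) (z q + s * v q))
      ((∑ m : Fin n, ((coeff L m : ℂ) * (((m : ℕ) * z q ^ ((m : ℕ) - 1)) * v q) * T z m
        + (coeff L m : ℂ) * z q ^ (m : ℕ) * T' v m)) + randomDeriv L (join n 0 b) (z q) * v q) 0 := by
    refine HasDerivAt.add (HasDerivAt.fun_sum fun m _ => ?_) hg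
    have h1 := (((hγq.pow (m : ℕ)).const_mul (coeff L m : ℂ)).mul (hasDerivAt_pi.1 hTγ m))
    simpa [Pi.mul_def] using h1
  -- Configurations form an open set, so the interpolation identity holds along a short piece of the
  -- line `z + s • v`, and its derivative at `s = 0` vanishes.
  have hzero : (fun s : ℂ => (∑ m : Fin n, (coeff L m : ℂ) * (z q + s * v q) ^ (m : ℕ) *
        T (z + s • v) m) + randomFunction L (join n 0 b) (z q + s * v q)) =ᶠ[𝓝 0] fun _ => 0 := by
    have hcont : ContinuousAt (fun s : ℂ => z + s • v) 0 := by fun_prop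
    have hmem : ∀ᶠ s in 𝓝 (0 : ℂ), z + s • v ∈ config n :=
      hcont.eventually_mem ((isOpen_config n).mem_nhds (by simpa using hz))
    filter_upwards [hmem] with s hs
    have h1 := ((mem_zeroTuples_join_iff hL hb (T (z + s • v)) hs).2 rfl).2 q
    rw [randomFunction_join _ hb (hs.1 q)] at h1
    rw [← h1]
    simp only [Pi.add_apply, Pi.smul_apply, smul_eq_mul]
    congr 1
    exact Finset.sum_congr rfl fun i _ => by ring
  have h0 := hsum.unique ((hasDerivAt_const (0 : ℂ) (0 : ℂ)).congr_of_eventuallyEq hzero)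
  rw [Matrix.mulVec_diagonal]
  simp only [evalMatrix, slope, derivMatrix, Matrix.mulVec, dotProduct, Matrix.of_apply,
    Pi.neg_apply, Pi.add_apply]
  rw [Finset.sum_add_distrib] at h0
  rw [neg_mul, eq_neg_iff_add_eq_zero, ← h0, add_mul, Finset.sum_mul]
  simp only [evalAt, T, interpMap]
  rw [← add_assoc]
  congr 1
  rw [add_comm]
  congr 1
  exact Finset.sum_congr rfl fun i _ => by ring

lemma abs_det_fderiv_interpMap (hL : 1 ≤ L) (hb : IsTame L (join n 0 b)) (hz : z ∈ config n) :
    |((fderiv ℂ (interpMap L n b) z).restrictScalars ℝ).det|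
      = (∏ q, ‖slope L z (evalAt (randomFunction L (join n 0 b)) z)
          (evalAt (randomDeriv L (join n 0 b)) z) q‖ ^ 2) / ‖(evalMatrix L z).det‖ ^ 2 := by
  set D := slope L z (evalAt (randomFunction L (join n 0 b)) z)
          (evalAt (randomDeriv L (join n 0 b)) z)
  set T' := fderiv ℂ (interpMap L n b) z
  have hcomp : Matrix.toLin' (evalMatrix L z) ∘ₗ (T' : (Fin n → ℂ) →ₗ[ℂ] (Fin n → ℂ))
      = Matrix.toLin' (Matrix.diagonal (-D)) := by
    refine LinearMap.ext fun v => ?_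
    simpa using evalMatrix_mulVec_fderiv hL hb hz v
  have hdet := congrArg LinearMap.det hcomp
  rw [LinearMap.det_comp, LinearMap.det_toLin', LinearMap.det_toLin', Matrix.det_diagonal] at hdet
  have hM := det_evalMatrix_ne_zero hL hz
  -- The real determinant of a complex linear map is the squared modulus of its complex determinant;
  -- this produces the squares in the density.
  have h1 : ((T'.restrictScalars ℝ).det : ℝ)
      = Algebra.norm ℝ (LinearMap.det (T' : (Fin n → ℂ) →ₗ[ℂ] (Fin n → ℂ))) := by
    rw [← LinearMap.det_restrictScalars]; rfl
  rw [h1, Algebra.norm_complex_apply, Complex.normSq_eq_norm_sq, abs_of_nonneg (by positivity),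
    eq_div_iff (by positivity), ← mul_pow, ← norm_mul, mul_comm, hdet, norm_prod,
    ← Finset.prod_pow]
  simp

end

end Interpolation

end SU11

namespace SU11

/-! ### The Kac–Rice formula, existence and positivity -/

section KacRice

open Set Filter Topology
open scoped ENNReal NNReal

noncomputable section

variable {n L : ℕ}

/-- The density of zeros at `z` for a given tail of the power series. -/
def tailDensity (L n : ℕ) (z : Fin n → ℂ) (b : ℕ → ℂ) : ℝ :=
  krDensity L z (evalAt (randomFunction L (join n 0 b)) z) (evalAt (randomDeriv L (join n 0 b)) z)

/-- The correlation function given by the Kac–Rice formula. -/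
def corr (L n : ℕ) (z : Fin n → ℂ) : ℝ := ∫ b, tailDensity L n z b ∂gaussSeq

lemma tailDensity_nonneg (z : Fin n → ℂ) (b : ℕ → ℂ) : 0 ≤ tailDensity L n z b :=
  krDensity_nonneg _ _ _

lemma corr_nonneg (z : Fin n → ℂ) : 0 ≤ corr L n z := integral_nonneg fun b => tailDensity_nonneg z b

/-- A jointly measurable version of `tailDensity`. -/
def tailDensityMeas (L n : ℕ) (x : (Fin n → ℂ) × (ℕ → ℂ)) : ℝ :=
  {y : (Fin n → ℂ) × (Fin n → ℂ) × (Fin n → ℂ) | y.1 ∈ config n}.indicator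
    (fun y => krDensity L y.1 y.2.1 y.2.2)
    (x.1, (fun p => {p : (ℕ → ℂ) × ℂ | IsTame L p.1 ∧ p.2 ∈ ball (0 : ℂ) 1}.indicator
      (fun p => randomFunction L p.1 p.2) (join n 0 x.2, x.1 p)),
    fun p => {p : (ℕ → ℂ) × ℂ | IsTame L p.1 ∧ p.2 ∈ ball (0 : ℂ) 1}.indicator
      (fun p => randomDeriv L p.1 p.2) (join n 0 x.2, x.1 p))

lemma measurable_tailDensityMeas (hL : 1 ≤ L) (n : ℕ) : Measurable (tailDensityMeas L n) := by
  classical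
  have hS : MeasurableSet {y : (Fin n → ℂ) × (Fin n → ℂ) × (Fin n → ℂ) | y.1 ∈ config n} :=
    measurable_fst (isOpen_config n).measurableSet
  have h1 : Measurable ({y : (Fin n → ℂ) × (Fin n → ℂ) × (Fin n → ℂ) | y.1 ∈ config n}.indicator
      fun y => krDensity L y.1 y.2.1 y.2.2) := by
    rw [← piecewise_eq_indicator]
    refine ContinuousOn.measurable_piecewise (fun y hy => ?_) continuousOn_const hS
    exact (continuousAt_krDensity hL hy).continuousWithinAt
  have hj : Measurable fun x : (Fin n → ℂ) × (ℕ → ℂ) => join n 0 x.2 :=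
    (measurable_join n).comp (measurable_const.prodMk measurable_snd)
  refine h1.comp (measurable_fst.prodMk (Measurable.prodMk ?_ ?_))
  · refine measurable_pi_lambda _ fun p => (measurable_randomFunction L).comp (hj.prodMk ?_)
    exact (measurable_pi_apply p).comp measurable_fst
  · refine measurable_pi_lambda _ fun p => (measurable_randomDeriv L).comp (hj.prodMk ?_)
    exact (measurable_pi_apply p).comp measurable_fst

lemma tailDensityMeas_eq {z : Fin n → ℂ} (hz : z ∈ config n) {b : ℕ → ℂ}
    (hb : IsTame L (join n 0 b)) : tailDensityMeas L n (z, b) = tailDensity L n z b := by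
  unfold tailDensityMeas tailDensity
  rw [indicator_of_mem (by exact hz)]
  have h : ∀ p, (join n 0 b, z p) ∈ {p : (ℕ → ℂ) × ℂ | IsTame L p.1 ∧ p.2 ∈ ball (0 : ℂ) 1} :=
    fun p => ⟨hb, hz.1 p⟩
  simp only [indicator_of_mem (h _)]
  rfl

lemma aestronglyMeasurable_tailDensity (hL : 1 ≤ L) {z : Fin n → ℂ} (hz : z ∈ config n) :
    AEStronglyMeasurable (tailDensity L n z) gaussSeq := by
  refine ⟨fun b => tailDensityMeas L n (z, b), ((measurable_tailDensityMeas hL n).comp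
    (measurable_const.prodMk measurable_id)).stronglyMeasurable, ?_⟩
  filter_upwards [ae_isTame_join hL n] with b hb
  exact (tailDensityMeas_eq hz hb).symm

/-- Near `z₀` all points stay within one radius and `krBound` stays below its value at `z₀` plus
one. A single moment of the tail thus dominates uniformly, which serves both integrability and
continuity of `corr`. -/
lemma exists_tailDensity_bound (hL : 1 ≤ L) {z₀ : Fin n → ℂ} (hz₀ : z₀ ∈ config n) :
    ∃ B : (ℕ → ℂ) → ℝ, Integrable B gaussSeq ∧
      ∀ᶠ z in 𝓝 z₀, z ∈ config n ∧ ∀ᵐ b ∂gaussSeq, ‖tailDensity L n z b‖ ≤ B b := by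
  obtain ⟨k, hk⟩ : ∃ k, ∀ p, ‖z₀ p‖ < radius k := by
    obtain ⟨r, hr1, hr⟩ : ∃ r < (1 : ℝ), ∀ p, ‖z₀ p‖ ≤ r := by
      rcases isEmpty_or_nonempty (Fin n) with h | h
      · exact ⟨0, one_pos, fun p => h.elim p⟩
      · obtain ⟨p, hp⟩ := Finite.exists_max fun p => ‖z₀ p‖
        exact ⟨_, mem_ball_zero_iff.1 (hz₀.1 p), hp⟩
    obtain ⟨k, hk⟩ := exists_lt_radius hr1
    exact ⟨k, fun p => (hr p).trans_lt hk⟩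
  refine ⟨fun b => (krBound L z₀ + 1) * (weightSum L k (join n 0 b) ^ (2 * n)).toReal,
    Integrable.const_mul (integrable_toReal_of_lintegral_ne_top ?_
      (lintegral_weightSum_join_pow hL n k (2 * n))) _, ?_⟩
  · refine ((measurable_weightSum L k).comp ?_ |>.pow_const _).aemeasurable
    exact (measurable_join n).comp (measurable_const.prodMk measurable_id)
  · have h1 : ∀ᶠ z : Fin n → ℂ in 𝓝 z₀, ∀ p, ‖z p‖ < radius k := by
      rw [eventually_all]
      exact fun p => (continuous_apply p).norm.continuousAt.eventually_lt_const (hk p)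
    have h2 : ∀ᶠ z in 𝓝 z₀, krBound L z < krBound L z₀ + 1 :=
      (continuousAt_krBound hL hz₀).eventually_lt_const (by linarith)
    filter_upwards [h1, h2, (isOpen_config n).mem_nhds hz₀] with z hz1 hz2 hz3
    refine ⟨hz3, ?_⟩
    filter_upwards [ae_isTame_join hL n] with b hb
    rw [Real.norm_of_nonneg (tailDensity_nonneg z b), ENNReal.toReal_pow]
    refine (krDensity_le (x := (weightSum L k (join n 0 b)).toReal)
      (fun p => hb.norm_randomFunction_le (hz1 p).le)
      (fun p => hb.norm_randomDeriv_le (hz1 p).le)).trans ?_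
    gcongr

lemma integrable_tailDensity (hL : 1 ≤ L) {z : Fin n → ℂ} (hz : z ∈ config n) :
    Integrable (tailDensity L n z) gaussSeq := by
  obtain ⟨B, hB, h⟩ := exists_tailDensity_bound hL hz
  exact hB.mono' (aestronglyMeasurable_tailDensity hL hz) h.self_of_nhds.2

lemma continuousOn_corr (hL : 1 ≤ L) (n : ℕ) : ContinuousOn (corr L n) (config n) := by
  intro z₀ hz₀
  obtain ⟨B, hB, h⟩ := exists_tailDensity_bound hL hz₀
  refine (continuousAt_of_dominated (h.mono fun z hz => aestronglyMeasurable_tailDensity hL hz.1)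
    (h.mono fun z hz => hz.2) hB ?_).continuousWithinAt
  filter_upwards [ae_isTame_join hL n] with b hb
  have hval : ∀ g : ℂ → ℂ, ContinuousOn g (ball 0 1) → ContinuousAt (evalAt (n := n) g) z₀ :=
    fun g hg => continuousAt_pi.2 fun p => ContinuousAt.comp (f := fun z : Fin n → ℂ => z p)
      (hg.continuousAt (isOpen_ball.mem_nhds (hz₀.1 p))) (continuous_apply p).continuousAt
  exact ContinuousAt.comp (g := fun x : (Fin n → ℂ) × (Fin n → ℂ) × (Fin n → ℂ) =>
      krDensity L x.1 x.2.1 x.2.2) (f := fun z => (z, evalAt (randomFunction L (join n 0 b)) z,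
      evalAt (randomDeriv L (join n 0 b)) z))
    (continuousAt_krDensity hL hz₀) (continuousAt_id.prodMk
      ((hval _ hb.continuousOn).prodMk (hval _ hb.continuousOn_randomDeriv)))

/-- The area formula for `interpMap`, with the Gaussian density of the head as the weight on the
target. -/
lemma lintegral_zeroTuples_join (hL : 1 ≤ L) {b : ℕ → ℂ} (hb : IsTame L (join n 0 b))
    {Φ : (Fin n → ℂ) → ℝ≥0∞} (hΦ : Measurable Φ) :
    ∫⁻ t : Fin n → ℂ, ENNReal.ofReal (∏ i, gaussDensity (t i)) *
        ∑' z : zeroTuples n (randomFunction L (join n t b)), Φ z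
      = ∫⁻ z in config n, ENNReal.ofReal (tailDensityMeas L n (z, b)) * Φ z := by
  have hset : ∀ t : Fin n → ℂ, zeroTuples n (randomFunction L (join n t b))
      = config n ∩ interpMap L n b ⁻¹' {t} := fun t => by
    ext z
    by_cases hz : z ∈ config n
    · rw [mem_zeroTuples_join_iff hL hb t hz]
      simp [hz, interpMap]
    · exact ⟨fun h => (hz h.1).elim, fun h => (hz h.1).elim⟩
  have hw : Measurable fun t : Fin n → ℂ => ENNReal.ofReal (∏ i, gaussDensity (t i)) := by
    have := continuous_gaussDensity
    exact Measurable.ennreal_ofReal (by fun_prop)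
  rw [lintegral_congr fun t => by rw [hset t], lintegral_mul_tsum_fiber volume (isOpen_config n).measurableSet
    (T' := fun z => (fderiv ℂ (interpMap L n b) z).restrictScalars ℝ)
    (fun z hz => ((contDiffAt_interpMap hL hb hz).hasStrictFDerivAt
      one_ne_zero).restrictScalars ℝ) hΦ hw]
  refine setLIntegral_congr_fun (isOpen_config n).measurableSet fun z hz => ?_
  rw [abs_det_fderiv_interpMap hL hb hz, tailDensityMeas_eq hz hb, ← mul_assoc,
    ← ENNReal.ofReal_mul (by positivity), mul_comm (_ / _)]
  rfl

/-- Average the fixed-tail identity over the tail and exchange integrals by Tonelli. Measurability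
of the sum over zero tuples is assumed here; for test functions it comes from the measurable linear
statistics. -/
theorem kacRice (hL : 1 ≤ L) {Φ : (Fin n → ℂ) → ℝ≥0∞} (hΦ : Measurable Φ)
    (hS : AEMeasurable (fun a => ∑' z : zeroTuples n (randomFunction L a), Φ z) gaussSeq) :
    ∫⁻ a, ∑' z : zeroTuples n (randomFunction L a), Φ z ∂gaussSeq
      = ∫⁻ z in config n, Φ z * ENNReal.ofReal (corr L n z) := by
  have hm : Measurable fun x : (Fin n → ℂ) × (ℕ → ℂ) => ENNReal.ofReal (tailDensityMeas L n x) :=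
    (measurable_tailDensityMeas hL n).ennreal_ofReal
  rw [lintegral_gaussSeq_join n hS]
  have h1 : ∀ᵐ b ∂gaussSeq, ∫⁻ t : Fin n → ℂ, ENNReal.ofReal (∏ i, gaussDensity (t i)) *
        ∑' z : zeroTuples n (randomFunction L (join n t b)), Φ z
      = ∫⁻ z in config n, ENNReal.ofReal (tailDensityMeas L n (z, b)) * Φ z := by
    filter_upwards [ae_isTame_join hL n] with b hb
    exact lintegral_zeroTuples_join hL hb hΦ
  rw [lintegral_congr_ae h1, lintegral_lintegral_swap]
  · refine setLIntegral_congr_fun (isOpen_config n).measurableSet fun z hz => ?_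
    have hmz : Measurable fun b => ENNReal.ofReal (tailDensityMeas L n (z, b)) :=
      hm.comp (measurable_const.prodMk measurable_id)
    rw [lintegral_mul_const _ hmz, mul_comm, corr,
      ofReal_integral_eq_lintegral_ofReal (integrable_tailDensity hL hz)
        (ae_of_all _ fun b => tailDensity_nonneg z b)]
    congr 1
    refine lintegral_congr_ae ?_
    filter_upwards [ae_isTame_join hL n] with b hb
    rw [tailDensityMeas_eq hz hb]
  · exact ((hm.comp measurable_swap).mul (hΦ.comp measurable_snd)).aemeasurable

lemma IsTestTuple.prod_eq_zero {φ : Fin n → ℂ → ℝ} (hφ : IsTestTuple φ) {z : Fin n → ℂ}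
    (hz : z ∉ config n) : ∏ p, φ p (z p) = 0 := by
  by_contra h
  have h0 : ∀ p, z p ∈ tsupport (φ p) := fun p =>
    subset_tsupport _ fun h1 => h (Finset.prod_eq_zero (Finset.mem_univ p) h1)
  refine hz ⟨fun p => hφ.tsupport_subset p (h0 p), fun p q hpq => ?_⟩
  by_contra hne
  exact disjoint_left.1 (hφ.disjoint hne) (h0 p) (hpq ▸ h0 q)

lemma continuous_prod_apply {φ : Fin n → ℂ → ℝ} (hφ : ∀ p, Continuous (φ p)) :
    Continuous fun z : Fin n → ℂ => ∏ p, φ p (z p) :=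
  continuous_finsetProd _ fun p _ => (hφ p).comp (continuous_apply p)

lemma integrable_mul_prod {K : (Fin n → ℂ) → ℝ} (hK : ContinuousOn K (config n))
    {φ : Fin n → ℂ → ℝ} (hφ : IsTestTuple φ) :
    Integrable fun z : Fin n → ℂ => K z * ∏ p, φ p (z p) := by
  set C : Set (Fin n → ℂ) := univ.pi fun p => tsupport (φ p)
  have hC : IsCompact C := isCompact_univ_pi fun p => hφ.hasCompactSupport p
  have hCc : C ⊆ config n := by
    intro z hz
    refine ⟨fun p => hφ.tsupport_subset p (hz p trivial), fun p q hpq => ?_⟩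
    by_contra hne
    exact disjoint_left.1 (hφ.disjoint hne) (hz p trivial) (hpq ▸ hz q trivial)
  have h1 : IntegrableOn (fun z : Fin n → ℂ => K z * ∏ p, φ p (z p)) C :=
    ((hK.mono hCc).mul (continuous_prod_apply fun p =>
      (hφ.contDiff p).continuous).continuousOn).integrableOn_compact hC
  refine h1.integrable_of_forall_notMem_eq_zero fun z hz => ?_
  simp only [C, Set.mem_pi, mem_univ, true_implies, not_forall] at hz
  obtain ⟨p, hp⟩ := hz
  rw [Finset.prod_eq_zero (Finset.mem_univ p) (image_eq_zero_of_notMem_tsupport (f := φ p) hp), mul_zero]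

theorem isCorrelationFunction_corr (hL : 1 ≤ L) (n : ℕ) :
    IsCorrelationFunction gaussSeq L (fun m a => a m) n (corr L n) := by
  have key : ∀ φ : Fin n → ℂ → ℝ, IsTestTuple φ →
      Integrable (fun a => ∏ p, zeroSum (randomFunction L a) (φ p)) gaussSeq ∧
      ∫ a, ∏ p, zeroSum (randomFunction L a) (φ p) ∂gaussSeq
        = ∫ z : Fin n → ℂ, corr L n z * ∏ p, φ p (z p) := by
    intro φ hφ
    set S : ℝ → (ℕ → ℂ) → ℝ≥0∞ := fun ε a =>
      ∑' z : zeroTuples n (randomFunction L a), ENNReal.ofReal (ε * ∏ p, φ p (z.1 p)) with hSdef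
    have hae := ae_simpleZeros hL
    have hSm : ∀ ε : ℝ, ε = 1 ∨ ε = -1 → AEMeasurable (S ε) gaussSeq := fun ε hε => by
      have hm : AEMeasurable (fun a => ENNReal.ofReal
          ((∏ p, zeroSum (randomFunction L a) (fun w => |φ p w|)
            + ε * ∏ p, zeroSum (randomFunction L a) (φ p)) / 2)) gaussSeq := by
        refine AEMeasurable.ennreal_ofReal (AEMeasurable.div_const (AEMeasurable.add ?_
          (AEMeasurable.const_mul ?_ _)) _)
        · exact Finset.aemeasurable_fun_prod _ fun p _ =>
            aemeasurable_zeroSum hL (hφ.isDiskTest p).abs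
        · exact Finset.aemeasurable_fun_prod _ fun p _ => aemeasurable_zeroSum hL (hφ.isDiskTest p)
      refine hm.congr ?_
      filter_upwards [hae] with a ha
      exact (tsum_zeroTuples_eq ha.1 ha.2 hφ ε hε).1.symm
    have hΦm : ∀ ε : ℝ, Measurable fun z : Fin n → ℂ => ENNReal.ofReal (ε * ∏ p, φ p (z p)) :=
      fun ε => ((continuous_prod_apply fun p =>
        (hφ.contDiff p).continuous).measurable.const_mul ε).ennreal_ofReal
    have hSint : ∀ ε : ℝ, ε = 1 ∨ ε = -1 → ∫⁻ a, S ε a ∂gaussSeq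
        = ∫⁻ z : Fin n → ℂ, ENNReal.ofReal (ε * (corr L n z * ∏ p, φ p (z p))) := fun ε hε => by
      rw [hSdef, kacRice hL (hΦm ε) (hSm ε hε), ← lintegral_indicator
        (isOpen_config n).measurableSet]
      refine lintegral_congr fun z => ?_
      by_cases hz : z ∈ config n
      · rw [indicator_of_mem hz, ← ENNReal.ofReal_mul' (corr_nonneg z)]
        congr 1; ring
      · rw [indicator_of_notMem hz, hφ.prod_eq_zero hz]; simp
    have hint := integrable_mul_prod (continuousOn_corr hL n) hφ
    have hfin : ∀ ε : ℝ, ε = 1 ∨ ε = -1 → ∫⁻ a, S ε a ∂gaussSeq ≠ ⊤ := fun ε hε => by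
      rw [hSint ε hε]
      exact (hint.const_mul ε).lintegral_lt_top.ne
    have hSi : ∀ ε : ℝ, ε = 1 ∨ ε = -1 → Integrable (fun a => (S ε a).toReal) gaussSeq :=
      fun ε hε => integrable_toReal_of_lintegral_ne_top (hSm ε hε) (hfin ε hε)
    have hSI : ∀ ε : ℝ, ε = 1 ∨ ε = -1 → ∫ a, (S ε a).toReal ∂gaussSeq
        = (∫⁻ a, S ε a ∂gaussSeq).toReal := fun ε hε =>
      integral_toReal (hSm ε hε) (ae_lt_top' (hSm ε hε) (hfin ε hε))
    -- The product of the signed statistics is the difference of its two nonnegative fibre sums,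
    -- both of finite expectation.
    have hR : (fun a => (S 1 a).toReal - (S (-1) a).toReal)
        =ᵐ[gaussSeq] fun a => ∏ p, zeroSum (randomFunction L a) (φ p) := by
      filter_upwards [hae] with a ha
      have h1 := tsum_zeroTuples_eq ha.1 ha.2 hφ 1 (Or.inl rfl)
      have h2 := tsum_zeroTuples_eq ha.1 ha.2 hφ (-1) (Or.inr rfl)
      have h3 := abs_le.1 h1.2
      simp only [hSdef]
      rw [h1.1, h2.1, ENNReal.toReal_ofReal (by linarith), ENNReal.toReal_ofReal (by linarith)]
      ring
    refine ⟨((hSi 1 (Or.inl rfl)).sub (hSi (-1) (Or.inr rfl))).congr hR, ?_⟩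
    rw [← integral_congr_ae hR, integral_sub (hSi 1 (Or.inl rfl)) (hSi (-1) (Or.inr rfl)),
      hSI 1 (Or.inl rfl), hSI (-1) (Or.inr rfl), hSint 1 (Or.inl rfl), hSint (-1) (Or.inr rfl),
      integral_eq_lintegral_pos_part_sub_lintegral_neg_part hint]
    simp only [one_mul, neg_one_mul]
  exact ⟨continuousOn_corr hL n, fun φ hφ => (key φ hφ).1, fun φ hφ => (key φ hφ).2⟩

lemma join_join (t : Fin 1 → ℂ) (b : ℕ → ℂ) : join 1 0 (join 1 t b) = join 2 ![0, t 0] b := by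
  funext m
  rcases m with _ | _ | m
  · simp [join]
  · simp [join]
  · simp [join]

/-- The coefficient of index one enters the derivative at `w` with the constant factor `coeff L 1`.
With all later coefficients fixed, the derivative vanishes for only one value of it, a null event.
-/
lemma ae_randomDeriv_join_ne_zero (hL : 1 ≤ L) {w : ℂ} (hw : w ∈ ball (0 : ℂ) 1) :
    ∀ᵐ b ∂gaussSeq, IsTame L (join 1 0 b) ∧ randomDeriv L (join 1 0 b) w ≠ 0 := by
  set D : ((ℕ → ℂ) × ℂ) → ℂ := {p : (ℕ → ℂ) × ℂ | IsTame L p.1 ∧ p.2 ∈ ball (0 : ℂ) 1}.indicator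
      fun p => randomDeriv L p.1 p.2
  have hj : Measurable fun b : ℕ → ℂ => join 1 0 b :=
    (measurable_join 1).comp (measurable_const.prodMk measurable_id)
  have hset : {b | IsTame L (join 1 0 b) ∧ randomDeriv L (join 1 0 b) w ≠ 0}
      = {b | IsTame L (join 1 0 b)} ∩ (fun b => D (join 1 0 b, w)) ⁻¹' {0}ᶜ := by
    ext b
    simp only [mem_ofPred_eq, mem_inter_iff, mem_preimage, mem_compl_iff, mem_singleton_iff]
    refine and_congr_right fun hb => ?_
    simp only [D]
    rw [indicator_of_mem (show (join 1 0 b, w) ∈ {p : (ℕ → ℂ) × ℂ | IsTame L p.1 ∧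
      p.2 ∈ ball (0 : ℂ) 1} from ⟨hb, hw⟩)]
  refine ae_gaussSeq_of_join 1 ?_ ?_
  · rw [hset]
    exact (hj (measurableSet_isTame L)).inter (((measurable_randomDeriv L).comp
      (hj.prodMk measurable_const)) (measurableSet_singleton 0).compl)
  · filter_upwards [ae_isTame_join hL 2] with b hb
    have hc : (coeff L 1 : ℂ) ≠ 0 := by exact_mod_cast (coeff_pos hL 1).ne'
    set v := -randomDeriv L (join 2 0 b) w / coeff L 1
    have hnull : (volume : Measure (Fin 1 → ℂ)) (Function.eval 0 ⁻¹' {v}) = 0 :=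
      Measure.pi_eval_preimage_null _ (measure_singleton v)
    filter_upwards [measure_eq_zero_iff_ae_notMem.1 hnull] with t ht
    rw [join_join]
    refine ⟨(isTame_join_iff _ b).2 hb, fun h => ht ?_⟩
    rw [randomDeriv_join _ hb hw] at h
    simp only [Fin.sum_univ_two, Matrix.cons_val_zero, Matrix.cons_val_one, Fin.val_zero,
      Fin.val_one, mul_zero, zero_mul, Nat.cast_one, Nat.sub_self, pow_zero, mul_one,
      zero_add] at h
    simp only [mem_preimage, Function.eval, mem_singleton_iff, v]
    rw [eq_div_iff hc, eq_neg_iff_add_eq_zero, mul_comm]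
    exact h

/-- For `n = 1` the interpolating basis function is constant, so the slope is just the derivative of
the tail. It is almost surely nonzero, which makes the integrand almost surely positive. -/
lemma corr_one_pos (hL : 1 ≤ L) {w : ℂ} (hw : w ∈ ball (0 : ℂ) 1) :
    0 < corr L 1 fun _ => w := by
  have hz : (fun _ => w : Fin 1 → ℂ) ∈ config 1 :=
    ⟨fun _ => hw, fun p q _ => Subsingleton.elim p q⟩
  unfold corr
  rw [integral_pos_iff_support_of_nonneg (fun b => tailDensity_nonneg _ b)
    (integrable_tailDensity hL hz)]
  have h : ∀ᵐ b ∂gaussSeq, b ∈ Function.support (tailDensity L 1 fun _ => w) := by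
    filter_upwards [ae_randomDeriv_join_ne_zero hL hw] with b hb
    rw [Function.mem_support]
    refine ne_of_gt ?_
    unfold tailDensity krDensity
    refine mul_pos (Finset.prod_pos fun i _ => gaussDensity_pos _) (div_pos
      (Finset.prod_pos fun q _ => ?_) ?_)
    · have h1 : slope L (fun _ => w) (evalAt (randomFunction L (join 1 0 b)) fun _ => w)
          (evalAt (randomDeriv L (join 1 0 b)) fun _ => w) q = randomDeriv L (join 1 0 b) w := by
        simp [slope, derivMatrix, Matrix.mulVec, dotProduct, evalAt]
      rw [h1]
      have := norm_pos_iff.2 hb.2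
      positivity
    · have := norm_pos_iff.2 (det_evalMatrix_ne_zero hL hz)
      positivity
  refine pos_iff_ne_zero.2 fun h0 => ?_
  obtain ⟨b, hb, hb'⟩ := (h.and (measure_eq_zero_iff_ae_notMem.1 h0)).exists
  exact hb' hb

end

end KacRice

end SU11

namespace SU11

/-! ### Uniqueness of continuous correlation functions -/

section Uniqueness

open Set Filter Topology
open scoped ENNReal NNReal

variable {n : ℕ}

/-- If `D` were positive at `z₀`, a product of bumps supported in a small polydisc around `z₀` would
have positive integral against it. -/
lemma nonpos_of_integral_mul_prod_eq_zero {D : (Fin n → ℂ) → ℝ} (hD : ContinuousOn D (config n))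
    (h : ∀ φ : Fin n → ℂ → ℝ, IsTestTuple φ → ∫ z : Fin n → ℂ, D z * ∏ p, φ p (z p) = 0)
    {z₀ : Fin n → ℂ} (hz₀ : z₀ ∈ config n) : D z₀ ≤ 0 := by
  by_contra! hpos
  have hopen := (isOpen_config n).mem_nhds hz₀
  have hev : ∀ᶠ z in 𝓝 z₀, z ∈ config n ∧ 0 < D z :=
    (show ∀ᶠ z in 𝓝 z₀, z ∈ config n from hopen).and ((hD.continuousAt hopen).eventually_const_lt hpos)
  obtain ⟨r, hr, hball⟩ := Metric.nhds_basis_closedBall.eventually_iff.1 hev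
  -- The sup-norm ball is a polydisc, so coordinates can be changed one at a time without leaving
  -- it. As it consists of configurations, its factor disks lie in the unit disk, and two of them
  -- cannot share a point.
  have hupd : ∀ (p : Fin n) (w : ℂ), w ∈ closedBall (z₀ p) r → ∀ z ∈ closedBall z₀ r,
      Function.update z p w ∈ closedBall z₀ r := by
    intro p w hw z hz
    rw [closedBall_pi _ hr.le] at hz ⊢
    intro q _
    by_cases hq : q = p
    · subst hq; simpa using hw
    · simpa [hq] using hz q trivial
  have hself : z₀ ∈ closedBall z₀ r := mem_closedBall_self hr.le
  let φ : ∀ p : Fin n, ContDiffBump (z₀ p) := fun p => ⟨r / 2, r, by linarith, by linarith⟩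
  have hts : ∀ p, tsupport (φ p) = closedBall (z₀ p) r := fun p => (φ p).tsupport_eq
  have htest : IsTestTuple fun p => (φ p : ℂ → ℝ) := by
    refine ⟨fun p => (φ p).contDiff, fun p => (φ p).hasCompactSupport, fun p w hw => ?_,
      fun p q hpq => ?_⟩
    · rw [hts] at hw
      simpa using (hball (hupd p w hw z₀ hself)).1.1 p
    · simp only [hts]
      refine disjoint_left.2 fun w hwp hwq => hpq ?_
      refine (hball (hupd p w hwp _ (hupd q w hwq z₀ hself))).1.2 ?_
      simp [Function.update_of_ne hpq.symm]
  have hnn : ∀ z : Fin n → ℂ, 0 ≤ D z * ∏ p, φ p (z p) := by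
    intro z
    by_cases hz : z ∈ closedBall z₀ r
    · exact mul_nonneg (hball hz).2.le (Finset.prod_nonneg fun p _ => (φ p).nonneg)
    · rw [closedBall_pi _ hr.le] at hz
      simp only [Set.mem_pi, mem_univ, true_implies, not_forall] at hz
      obtain ⟨p, hp⟩ := hz
      have h0 : φ p (z p) = 0 := (φ p).zero_of_le_dist (not_le.1 hp).le
      rw [Finset.prod_eq_zero (Finset.mem_univ p) h0, mul_zero]
  refine (lt_irrefl (0 : ℝ)) (lt_of_lt_of_eq ?_ (h _ htest))
  rw [integral_pos_iff_support_of_nonneg hnn (integrable_mul_prod hD htest)]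
  refine (isOpen_ball.measure_pos volume ⟨z₀, mem_ball_self hr⟩).trans_le (measure_mono ?_)
  intro z hz
  have hz' := hz
  rw [ball_pi _ hr] at hz'
  exact (mul_pos (hball (ball_subset_closedBall hz)).2 (Finset.prod_pos fun p _ =>
    (φ p).pos_of_mem_ball (hz' p trivial))).ne'

lemma eqOn_of_integral_mul_prod_eq {K K' : (Fin n → ℂ) → ℝ} (hK : ContinuousOn K (config n))
    (hK' : ContinuousOn K' (config n))
    (h : ∀ φ : Fin n → ℂ → ℝ, IsTestTuple φ →
      ∫ z : Fin n → ℂ, K z * ∏ p, φ p (z p) = ∫ z : Fin n → ℂ, K' z * ∏ p, φ p (z p)) :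
    EqOn K K' (config n) := by
  have key : ∀ {K K' : (Fin n → ℂ) → ℝ}, ContinuousOn K (config n) → ContinuousOn K' (config n) →
      (∀ φ : Fin n → ℂ → ℝ, IsTestTuple φ →
        ∫ z : Fin n → ℂ, K z * ∏ p, φ p (z p) = ∫ z : Fin n → ℂ, K' z * ∏ p, φ p (z p)) →
      ∀ z ∈ config n, K z ≤ K' z := by
    intro K K' hK hK' h z hz
    refine sub_nonpos.1 (nonpos_of_integral_mul_prod_eq_zero (hK.sub hK') (fun φ hφ => ?_) hz)
    simp only [Pi.sub_apply, sub_mul]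
    rw [integral_sub (integrable_mul_prod hK hφ) (integrable_mul_prod hK' hφ), h φ hφ, sub_self]
  exact fun z hz => le_antisymm (key hK hK' h z hz)
    (key hK' hK (fun φ hφ => (h φ hφ).symm) z hz)

lemma IsCorrelationFunction.eqOn {Ω : Type*} [MeasurableSpace Ω] {P : Measure Ω} {L : ℕ}
    {a : ℕ → Ω → ℂ} {K K' : (Fin n → ℂ) → ℝ} (h : IsCorrelationFunction P L a n K)
    (h' : IsCorrelationFunction P L a n K') : EqOn K K' (config n) :=
  eqOn_of_integral_mul_prod_eq h.continuousOn h'.continuousOn fun φ hφ => by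
    rw [← h.integral_eq φ hφ, h'.integral_eq φ hφ]

end Uniqueness

/-! ### A Gaussian field is determined in law by its covariance -/

section GaussianField

open Set Filter Topology
open scoped ENNReal NNReal

noncomputable section

/-- The real part of `κ * z` is a centred real Gaussian of variance `‖κ‖ ^ 2 / 2`, whence the
constant `1 / 4`. -/
lemma integral_cexp_stdComplexGaussian (κ : ℂ) :
    ∫ z, Complex.exp (Complex.I * ((κ * z).re : ℂ)) ∂stdComplexGaussian
      = Complex.exp (-(1 / 4) * (κ * conj κ)) := by
  rw [stdComplexGaussian, integral_map_equiv]
  have h : ∀ p : ℝ × ℝ, Complex.exp (Complex.I *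
      ((κ * Complex.measurableEquivRealProd.symm p).re : ℂ))
      = Complex.exp ((κ.re : ℂ) * p.1 * Complex.I) * Complex.exp (((-κ.im : ℝ) : ℂ) * p.2 * Complex.I) := by
    intro p
    rw [← Complex.exp_add]
    congr 1
    simp only [Complex.measurableEquivRealProd_symm_apply, Complex.mul_re]
    push_cast; ring
  simp_rw [h]
  rw [integral_prod_mul (fun x : ℝ => Complex.exp ((κ.re : ℂ) * x * Complex.I))
    (fun y : ℝ => Complex.exp (((-κ.im : ℝ) : ℂ) * y * Complex.I)), ← charFun_apply_real,
    ← charFun_apply_real, charFun_gaussianReal, charFun_gaussianReal, ← Complex.exp_add]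
  congr 1
  rw [Complex.mul_conj, Complex.normSq_apply]
  push_cast; ring

lemma integral_prod_gaussSeq (N : ℕ) (f : ℕ → ℂ → ℂ) (hf : ∀ m, Measurable (f m)) :
    ∫ a, ∏ m ∈ Finset.range N, f m (a m) ∂gaussSeq
      = ∏ m ∈ Finset.range N, ∫ z, f m z ∂stdComplexGaussian := by
  have hm : Measurable fun y : (Finset.range N) → ℂ => ∏ m : Finset.range N, f m (y m) :=
    Finset.measurable_fun_prod _ fun m _ => (hf m).comp (measurable_pi_apply m)
  have h := integral_restrict_infinitePi (μ := fun _ : ℕ => stdComplexGaussian)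
    (s := Finset.range N) (f := fun y => ∏ m : Finset.range N, f m (y m)) hm.aestronglyMeasurable
  rw [integral_fintype_prod_eq_prod (fun (m : Finset.range N) z => f m z)] at h
  rw [Finset.prod_coe_sort (Finset.range N) fun m => ∫ z, f m z ∂stdComplexGaussian] at h
  rw [← h, gaussSeq]
  refine integral_congr_ae (ae_of_all _ fun a => ?_)
  exact (Finset.prod_coe_sort (Finset.range N) fun m => f m (a m)).symm

lemma integral_cexp_tsum {κ : ℕ → ℂ} {c : ℂ} (hsum : ∀ᵐ a ∂gaussSeq, Summable fun m => κ m * a m)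
    (hc : HasSum (fun m => κ m * conj (κ m)) c) :
    ∫ a, Complex.exp (Complex.I * ((∑' m, κ m * a m).re : ℂ)) ∂gaussSeq
      = Complex.exp (-(1 / 4) * c) := by
  have hpart : ∀ N : ℕ, ∫ a, Complex.exp (Complex.I *
      ((∑ m ∈ Finset.range N, κ m * a m).re : ℂ)) ∂gaussSeq
      = Complex.exp (-(1 / 4) * ∑ m ∈ Finset.range N, κ m * conj (κ m)) := by
    intro N
    rw [Finset.mul_sum, Complex.exp_sum]
    simp_rw [← integral_cexp_stdComplexGaussian]
    rw [← integral_prod_gaussSeq N _ fun m => by fun_prop]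
    refine integral_congr_ae (ae_of_all _ fun a => ?_)
    simp only
    rw [← Complex.exp_sum, Complex.re_sum, Complex.ofReal_sum, Finset.mul_sum]
  have h1 : Tendsto (fun N : ℕ => ∫ a, Complex.exp (Complex.I *
      ((∑ m ∈ Finset.range N, κ m * a m).re : ℂ)) ∂gaussSeq) atTop
      (𝓝 (∫ a, Complex.exp (Complex.I * ((∑' m, κ m * a m).re : ℂ)) ∂gaussSeq)) := by
    refine tendsto_integral_of_dominated_convergence (fun _ => 1) (fun N => ?_)
      (integrable_const _) (fun N => ae_of_all _ fun a => ?_) ?_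
    · exact Measurable.aestronglyMeasurable (by fun_prop)
    · rw [mul_comm, Complex.norm_exp_ofReal_mul_I]
    · filter_upwards [hsum] with a ha
      have hcont : Continuous fun w : ℂ => Complex.exp (Complex.I * (w.re : ℂ)) := by fun_prop
      exact (hcont.tendsto _).comp ha.hasSum.tendsto_sum_nat
  refine tendsto_nhds_unique h1 ?_
  simp_rw [hpart]
  have hcont : Continuous fun w : ℂ => Complex.exp (-(1 / 4) * w) := by fun_prop
  exact (hcont.tendsto _).comp hc.tendsto_sum_nat

/-- The process `X` is a centred circular complex Gaussian process with covariance `C`. -/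
structure IsGaussianField (X : (ℕ → ℂ) → ℕ → ℂ) (C : ℕ → ℕ → ℂ) : Prop where
  aemeasurable : AEMeasurable X gaussSeq
  integral_cexp : ∀ (J : Finset ℕ) (l : ℕ → ℂ),
    ∫ a, Complex.exp (Complex.I * ((∑ j ∈ J, l j * X a j).re : ℂ)) ∂gaussSeq
      = Complex.exp (-(1 / 4) * ∑ j ∈ J, ∑ k ∈ J, l j * conj (l k) * C j k)

lemma isGaussianField_of_hasSum {X : (ℕ → ℂ) → ℕ → ℂ} {C κ : ℕ → ℕ → ℂ}
    (hX : AEMeasurable X gaussSeq) (hκ : ∀ᵐ a ∂gaussSeq, ∀ j, HasSum (fun m => κ j m * a m) (X a j))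
    (hC : ∀ j k, HasSum (fun m => κ j m * conj (κ k m)) (C j k)) : IsGaussianField X C := by
  refine ⟨hX, fun J l => ?_⟩
  have hsum : ∀ᵐ a ∂gaussSeq, HasSum (fun m => (∑ j ∈ J, l j * κ j m) * a m)
      (∑ j ∈ J, l j * X a j) := by
    filter_upwards [hκ] with a ha
    refine (hasSum_sum (s := J) fun j _ => (ha j).mul_left (l j)).congr_fun fun m => ?_
    rw [Finset.sum_mul]
    exact Finset.sum_congr rfl fun j _ => by ring
  have hcov : HasSum (fun m => (∑ j ∈ J, l j * κ j m) * conj (∑ j ∈ J, l j * κ j m))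
      (∑ j ∈ J, ∑ k ∈ J, l j * conj (l k) * C j k) := by
    refine (hasSum_sum (s := J) fun j _ => hasSum_sum (s := J) fun k _ =>
      (hC j k).mul_left (l j * conj (l k))).congr_fun fun m => ?_
    rw [map_sum, Finset.sum_mul_sum]
    refine Finset.sum_congr rfl fun j _ => Finset.sum_congr rfl fun k _ => ?_
    rw [map_mul]; ring
  rw [← integral_cexp_tsum (hsum.mono fun a ha => ha.summable) hcov]
  refine integral_congr_ae ?_
  filter_upwards [hsum] with a ha
  rw [ha.tsum_eq]

lemma IsGaussianField.conj {X : (ℕ → ℂ) → ℕ → ℂ} {C : ℕ → ℕ → ℂ} (h : IsGaussianField X C) :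
    IsGaussianField (fun a j => conj (X a j)) fun j k => C k j := by
  refine ⟨?_, fun J l => ?_⟩
  · exact aemeasurable_pi_iff.2 fun j => Complex.continuous_conj.measurable.comp_aemeasurable
      (aemeasurable_pi_iff.1 h.aemeasurable j)
  · have h1 := h.integral_cexp J fun j => (starRingEnd ℂ) (l j)
    have h2 : ∀ a, (∑ j ∈ J, l j * (starRingEnd ℂ) (X a j)).re
        = (∑ j ∈ J, (starRingEnd ℂ) (l j) * X a j).re := fun a => by
      rw [← Complex.conj_re, map_sum]
      congr 1
      refine Finset.sum_congr rfl fun j _ => ?_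
      rw [map_mul, Complex.conj_conj]
    simp_rw [h2]
    rw [h1, Finset.sum_comm]
    congr 2
    refine Finset.sum_congr rfl fun j _ => Finset.sum_congr rfl fun k _ => ?_
    rw [Complex.conj_conj]; ring

/-- A real functional on `ℂ` is the real part of a complex multiple, with multiplier `Λ 1 - i Λ i`.
Hence the complex linear combinations in `IsGaussianField` cover all characteristic functions of the
finite marginals. -/
lemma exists_dual_eq_re_sum (I : Finset ℕ) (Λ : StrongDual ℝ (I → ℂ)) :
    ∃ l : ℕ → ℂ, ∀ x : ℕ → ℂ, Λ (I.restrict x) = (∑ j ∈ I, l j * x j).re := by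
  classical
  refine ⟨fun j => if h : j ∈ I then Λ (Pi.single ⟨j, h⟩ 1)
    - Complex.I * Λ (Pi.single ⟨j, h⟩ Complex.I) else 0, fun x => ?_⟩
  rw [← Finset.sum_coe_sort I, Complex.re_sum]
  conv_lhs => rw [← Finset.univ_sum_single (I.restrict x), map_sum]
  refine Finset.sum_congr rfl fun j _ => ?_
  have h1 : (Pi.single j (I.restrict x j) : I → ℂ)
      = (x j).re • (Pi.single j 1 : I → ℂ) + (x j).im • (Pi.single j Complex.I : I → ℂ) := by
    rw [← Pi.single_smul, ← Pi.single_smul, ← Pi.single_add]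
    congr 1
    simp [Finset.restrict, Complex.re_add_im]
  rw [h1, map_add, map_smul, map_smul]
  simp
  ring

/-- The covariance fixes the characteristic function of every finite marginal, and finite marginals
determine a probability law on the sequence space. -/
lemma IsGaussianField.map_eq {X Y : (ℕ → ℂ) → ℕ → ℂ} {C : ℕ → ℕ → ℂ} (hX : IsGaussianField X C)
    (hY : IsGaussianField Y C) : gaussSeq.map X = gaussSeq.map Y := by
  have hchar : ∀ (I : Finset ℕ) (Λ : StrongDual ℝ (I → ℂ)) (l : ℕ → ℂ),
      (∀ x : ℕ → ℂ, Λ (I.restrict x) = (∑ j ∈ I, l j * x j).re) → ∀ {X : (ℕ → ℂ) → ℕ → ℂ},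
      IsGaussianField X C → charFunDual ((gaussSeq.map X).map I.restrict) Λ
        = Complex.exp (-(1 / 4) * ∑ j ∈ I, ∑ k ∈ I, l j * (starRingEnd ℂ) (l k) * C j k) := by
    intro I Λ l hl X hX
    rw [charFunDual_apply, AEMeasurable.map_map_of_aemeasurable (by fun_prop) hX.aemeasurable,
      integral_map (AEMeasurable.comp_aemeasurable (by fun_prop) hX.aemeasurable)
        (Measurable.aestronglyMeasurable (by fun_prop)), ← hX.integral_cexp]
    refine integral_congr_ae (ae_of_all _ fun a => ?_)
    simp only [Function.comp_apply]
    rw [hl, mul_comm]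
  have : IsProbabilityMeasure (gaussSeq.map X) := Measure.isProbabilityMeasure_map hX.aemeasurable
  have : IsProbabilityMeasure (gaussSeq.map Y) := Measure.isProbabilityMeasure_map hY.aemeasurable
  have hinst : ∀ I : Finset ℕ, IsFiniteMeasure ((gaussSeq.map Y).map I.restrict) := fun I =>
    inferInstance
  refine IsProjectiveLimit.unique (P := fun I => (gaussSeq.map Y).map I.restrict)
    (fun I => Measure.ext_of_charFunDual (funext fun Λ => ?_)) fun I => rfl
  obtain ⟨l, hl⟩ := exists_dual_eq_re_sum I Λ
  rw [hchar I Λ l hl hX, hchar I Λ l hl hY]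

end

end GaussianField

end SU11

namespace SU11

/-! ### Transformation of correlation functions under symmetries of the zero set -/

section Symmetry

open Set Filter Topology
open scoped ENNReal NNReal

noncomputable section

/-- A diffeomorphism `σ` of the disk with inverse `τ` such that the zeros of the random function,
pulled back by `σ`, are the zeros of a random field `h` with the same law. -/
structure IsSymmetry (L : ℕ) (σ τ : ℂ → ℂ) (σ' : ℂ → ℂ →L[ℝ] ℂ) (h : (ℕ → ℂ) → ℂ → ℂ) : Prop where
  mapsTo : MapsTo σ (ball 0 1) (ball 0 1)
  mapsTo_inv : MapsTo τ (ball 0 1) (ball 0 1)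
  leftInv : ∀ z ∈ ball (0 : ℂ) 1, τ (σ z) = z
  rightInv : ∀ z ∈ ball (0 : ℂ) 1, σ (τ z) = z
  hasFDerivAt : ∀ z ∈ ball (0 : ℂ) 1, HasFDerivAt σ (σ' z) z
  continuousOn_det : ContinuousOn (fun z => (σ' z).det) (ball 0 1)
  contDiffAt_inv : ∀ z ∈ ball (0 : ℂ) 1, ContDiffAt ℝ ∞ τ z
  continuousOn : ∀ a, IsTame L a → ContinuousOn (h a) (ball 0 1)
  eq_zero_iff : ∀ a, IsTame L a → ∀ z ∈ ball (0 : ℂ) 1, h a z = 0 ↔ randomFunction L a (σ z) = 0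
  aemeasurable : AEMeasurable (fun a (j : ℕ) => h a (diskSeq j)) gaussSeq
  map_eq : gaussSeq.map (fun a j => h a (diskSeq j)) = gaussSeq.map (diskValues L)

variable {n L : ℕ} {σ τ : ℂ → ℂ} {σ' : ℂ → ℂ →L[ℝ] ℂ} {h : (ℕ → ℂ) → ℂ → ℂ}

/-- The push-forward of a test function. -/
def pushTest (τ : ℂ → ℂ) (φ : ℂ → ℝ) : ℂ → ℝ := (ball (0 : ℂ) 1).indicator fun w => φ (τ w)

lemma IsSymmetry.continuousOn_map (hs : IsSymmetry L σ τ σ' h) : ContinuousOn σ (ball 0 1) :=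
  fun z hz => (hs.hasFDerivAt z hz).continuousAt.continuousWithinAt

lemma IsSymmetry.injOn (hs : IsSymmetry L σ τ σ' h) : InjOn σ (ball 0 1) :=
  fun z hz w hw hzw => by rw [← hs.leftInv z hz, ← hs.leftInv w hw, hzw]

lemma IsSymmetry.pushTest_apply (hs : IsSymmetry L σ τ σ' h) (φ : ℂ → ℝ) {z : ℂ}
    (hz : z ∈ ball (0 : ℂ) 1) : pushTest τ φ (σ z) = φ z := by
  rw [pushTest, indicator_of_mem (hs.mapsTo hz), hs.leftInv z hz]

lemma IsSymmetry.pushTest_eq_zero (hs : IsSymmetry L σ τ σ' h) {φ : ℂ → ℝ} {w : ℂ}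
    (hw : w ∉ σ '' tsupport φ) : pushTest τ φ w = 0 := by
  by_cases hwb : w ∈ ball (0 : ℂ) 1
  · rw [pushTest, indicator_of_mem hwb]
    by_contra h0
    exact hw ⟨τ w, subset_tsupport _ h0, hs.rightInv w hwb⟩
  · rw [pushTest, indicator_of_notMem hwb]

lemma IsSymmetry.isCompact_image (hs : IsSymmetry L σ τ σ' h) {φ : ℂ → ℝ} (hφ : IsDiskTest φ) :
    IsCompact (σ '' tsupport φ) :=
  hφ.hasCompactSupport.isCompact.image_of_continuousOn (hs.continuousOn_map.mono hφ.tsupport_subset)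

lemma IsSymmetry.tsupport_pushTest (hs : IsSymmetry L σ τ σ' h) {φ : ℂ → ℝ} (hφ : IsDiskTest φ) :
    tsupport (pushTest τ φ) ⊆ σ '' tsupport φ :=
  closure_minimal (fun w hw => by
    by_contra hn
    exact hw (hs.pushTest_eq_zero hn)) (hs.isCompact_image hφ).isClosed

lemma IsSymmetry.isTestTuple (hs : IsSymmetry L σ τ σ' h) {φ : Fin n → ℂ → ℝ}
    (hφ : IsTestTuple φ) : IsTestTuple fun p => pushTest τ (φ p) := by
  have hsub : ∀ p, σ '' tsupport (φ p) ⊆ ball 0 1 := fun p =>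
    image_subset_iff.2 fun z hz => hs.mapsTo (hφ.tsupport_subset p hz)
  refine ⟨fun p => contDiff_iff_contDiffAt.2 fun w => ?_, fun p => ?_, fun p => ?_,
    fun p q hpq => ?_⟩
  · by_cases hw : w ∈ ball (0 : ℂ) 1
    · have h1 : ContDiffAt ℝ ∞ (fun w => φ p (τ w)) w :=
        (hφ.contDiff p).contDiffAt.comp w (hs.contDiffAt_inv w hw)
      refine h1.congr_of_eventuallyEq ?_
      filter_upwards [isOpen_ball.mem_nhds hw] with y hy
      rw [pushTest, indicator_of_mem hy]
    · refine (contDiffAt_const (c := (0 : ℝ))).congr_of_eventuallyEq ?_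
      filter_upwards [(hs.isCompact_image (hφ.isDiskTest p)).isClosed.isOpen_compl.mem_nhds
        fun hw' => hw (hsub p hw')] with y hy
      exact hs.pushTest_eq_zero hy
  · exact (hs.isCompact_image (hφ.isDiskTest p)).of_isClosed_subset (isClosed_tsupport _)
      (hs.tsupport_pushTest (hφ.isDiskTest p))
  · exact (hs.tsupport_pushTest (hφ.isDiskTest p)).trans (hsub p)
  · refine Disjoint.mono (hs.tsupport_pushTest (hφ.isDiskTest p))
      (hs.tsupport_pushTest (hφ.isDiskTest q)) (disjoint_left.2 ?_)
    rintro _ ⟨z, hz, rfl⟩ ⟨w, hw, hzw⟩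
    have := hs.injOn (hφ.tsupport_subset q hw) (hφ.tsupport_subset p hz) hzw
    exact disjoint_left.1 (hφ.disjoint hpq) hz (this ▸ hw)

/-- The map `σ` is a bijection from the zeros of `h a` to those of the random function. Zeros of `h
a` are summed without multiplicity, which is consistent because those of the random function are
simple. -/
lemma IsSymmetry.zeroSum_pushTest (hs : IsSymmetry L σ τ σ' h) {a : ℕ → ℂ} (ha : IsTame L a)
    (hsz : HasSimpleZeros L a) {φ : ℂ → ℝ} (hφ : IsDiskTest φ) :
    zeroSum (randomFunction L a) (pushTest τ φ)
      = realZeroFunctional φ fun j => h a (diskSeq j) := by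
  have hbij : BijOn σ (zeroSet (h a)) (zeroSet (randomFunction L a)) := by
    refine ⟨fun z hz => ⟨hs.mapsTo hz.1, (hs.eq_zero_iff a ha z hz.1).1 hz.2⟩,
      hs.injOn.mono fun z hz => hz.1, fun w hw => ⟨τ w, ⟨hs.mapsTo_inv hw.1, ?_⟩,
      hs.rightInv w hw.1⟩⟩
    rw [hs.eq_zero_iff a ha _ (hs.mapsTo_inv hw.1), hs.rightInv w hw.1]
    exact hw.2
  have hsub : σ '' tsupport φ ⊆ ball 0 1 :=
    image_subset_iff.2 fun z hz => hs.mapsTo (hφ.tsupport_subset hz)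
  have hfin : (zeroSet (h a) ∩ tsupport φ).Finite := by
    refine Finite.of_finite_image ((finite_zeroSet_inter ha hsz (hs.isCompact_image hφ)
      hsub).subset ?_) (hs.injOn.mono fun z hz => hz.1.1)
    rintro _ ⟨z, hz, rfl⟩
    exact ⟨hbij.mapsTo hz.1, mem_image_of_mem _ hz.2⟩
  rw [realZeroFunctional_eq_finsum (hs.continuousOn a ha) hφ.continuous hfin,
    zeroSum_eq_finsum ha hsz]
  exact (finsum_mem_eq_of_bijOn σ hbij fun z hz => (hs.pushTest_apply φ hz.1).symm).symm

/-- Both sides are expectations of one measurable functional of values along `diskSeq`, applied to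
fields with the same law. -/
lemma IsSymmetry.integral_prod_zeroSum (hL : 1 ≤ L) (hs : IsSymmetry L σ τ σ' h)
    {φ : Fin n → ℂ → ℝ} (hφ : IsTestTuple φ) :
    ∫ a, ∏ p, zeroSum (randomFunction L a) (pushTest τ (φ p)) ∂gaussSeq
      = ∫ a, ∏ p, zeroSum (randomFunction L a) (φ p) ∂gaussSeq := by
  have hm : Measurable fun x : ℕ → ℂ => ∏ p, realZeroFunctional (φ p) x :=
    Finset.measurable_fun_prod _ fun p _ => measurable_realZeroFunctional _
  have h1 : ∫ a, ∏ p, zeroSum (randomFunction L a) (pushTest τ (φ p)) ∂gaussSeq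
      = ∫ x, ∏ p, realZeroFunctional (φ p) x ∂(gaussSeq.map fun a j => h a (diskSeq j)) := by
    rw [integral_map hs.aemeasurable hm.aestronglyMeasurable]
    refine integral_congr_ae ?_
    filter_upwards [ae_simpleZeros hL] with a ha
    exact Finset.prod_congr rfl fun p _ => hs.zeroSum_pushTest ha.1 ha.2 (hφ.isDiskTest p)
  rw [h1, hs.map_eq, integral_map (measurable_diskValues L).aemeasurable hm.aestronglyMeasurable]
  refine integral_congr_ae ?_
  filter_upwards [ae_simpleZeros hL] with a ha
  exact Finset.prod_congr rfl fun p _ =>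
    (zeroSum_eq_realZeroFunctional ha.1 ha.2 (hφ.isDiskTest p)).symm

lemma IsSymmetry.mem_config (hs : IsSymmetry L σ τ σ' h) {z : Fin n → ℂ} (hz : z ∈ config n) :
    (fun p => σ (z p)) ∈ config n :=
  ⟨fun p => hs.mapsTo (hz.1 p), fun p q hpq => hz.2 (hs.injOn (hz.1 p) (hz.1 q) hpq)⟩

lemma IsSymmetry.integral_mul_prod (hs : IsSymmetry L σ τ σ' h) (K : (Fin n → ℂ) → ℝ)
    {φ : Fin n → ℂ → ℝ} (hφ : IsTestTuple φ) :
    ∫ w : Fin n → ℂ, K w * ∏ p, pushTest τ (φ p) (w p)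
      = ∫ z : Fin n → ℂ, (K (fun p => σ (z p)) * ∏ p, |(σ' (z p)).det|) * ∏ p, φ p (z p) := by
  set s : Set (Fin n → ℂ) := univ.pi fun _ => ball 0 1
  have hsm : MeasurableSet s := MeasurableSet.univ_pi fun _ => measurableSet_ball
  set F : (Fin n → ℂ) → Fin n → ℂ := fun z p => σ (z p)
  have hF : ∀ z ∈ s, HasFDerivWithinAt F (ContinuousLinearMap.pi fun p =>
      (σ' (z p)).comp (ContinuousLinearMap.proj p)) s z := fun z hz => by
    refine HasFDerivAt.hasFDerivWithinAt (hasFDerivAt_pi.2 fun p => ?_)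
    exact (hs.hasFDerivAt (z p) (hz p trivial)).comp z (hasFDerivAt_apply p z)
  have hinj : InjOn F s := fun z hz w hw hzw => funext fun p =>
    hs.injOn (hz p trivial) (hw p trivial) (congrFun hzw p)
  have himg : F '' s = s := by
    apply Subset.antisymm
    · rintro _ ⟨z, hz, rfl⟩ p _
      exact hs.mapsTo (hz p trivial)
    · intro w hw
      exact ⟨fun p => τ (w p), fun p _ => hs.mapsTo_inv (hw p trivial),
        funext fun p => hs.rightInv _ (hw p trivial)⟩
  have hout : ∀ {ψ : Fin n → ℂ → ℝ} (G : (Fin n → ℂ) → ℝ), (∀ p, ∀ w ∉ ball (0 : ℂ) 1, ψ p w = 0) →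
      ∀ z ∉ s, G z * ∏ p, ψ p (z p) = 0 := by
    intro ψ G hψ z hz
    simp only [s, Set.mem_pi, mem_univ, true_implies, not_forall] at hz
    obtain ⟨p, hp⟩ := hz
    rw [Finset.prod_eq_zero (Finset.mem_univ p) (hψ p _ hp), mul_zero]
  rw [← setIntegral_eq_integral_of_forall_compl_eq_zero (s := s)
      (hout K fun p w hw => by rw [pushTest, indicator_of_notMem hw]),
    ← setIntegral_eq_integral_of_forall_compl_eq_zero (s := s)
      (hout (fun z => K (fun p => σ (z p)) * ∏ p, |(σ' (z p)).det|) fun p w hw =>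
        image_eq_zero_of_notMem_tsupport fun h => hw (hφ.tsupport_subset p h))]
  conv_lhs => rw [← himg]
  rw [integral_image_eq_integral_abs_det_fderiv_smul volume hsm hF hinj]
  refine setIntegral_congr_fun hsm fun z hz => ?_
  have hd : ∏ p, pushTest τ (φ p) (F z p) = ∏ p, φ p (z p) :=
    Finset.prod_congr rfl fun p _ => hs.pushTest_apply (φ p) (hz p trivial)
  simp only [smul_eq_mul]
  rw [hd, ContinuousLinearMap.det_pi, Finset.abs_prod]
  ring

/-- The transformed density gives the same integrals against all test tuples, by change of variables
and equality in law; continuity upgrades this to pointwise equality. -/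
theorem IsSymmetry.isCorrelationFunction (hL : 1 ≤ L) (hs : IsSymmetry L σ τ σ' h)
    {K : (Fin n → ℂ) → ℝ} (hK : IsCorrelationFunction gaussSeq L (fun m a => a m) n K) :
    EqOn (fun z => K (fun p => σ (z p)) * ∏ p, |(σ' (z p)).det|) K (config n) := by
  refine eqOn_of_integral_mul_prod_eq ?_ hK.continuousOn fun φ hφ => ?_
  · refine ContinuousOn.mul (hK.continuousOn.comp ?_ fun z hz => hs.mem_config hz)
      (continuousOn_finsetProd _ fun p _ => ?_)
    · exact continuousOn_pi.2 fun p => hs.continuousOn_map.comp (continuous_apply p).continuousOn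
        fun z hz => hz.1 p
    · exact (hs.continuousOn_det.comp (continuous_apply p).continuousOn fun z hz => hz.1 p).abs
  · rw [← hs.integral_mul_prod K hφ, ← hK.integral_eq _ (hs.isTestTuple hφ),
      ← hK.integral_eq φ hφ]
    exact hs.integral_prod_zeroSum hL hφ

theorem IsSymmetry.normalized_eq (hL : 1 ≤ L) (hs : IsSymmetry L σ τ σ' h)
    {K₁ : (Fin 1 → ℂ) → ℝ} {K : (Fin n → ℂ) → ℝ}
    (hK₁ : IsCorrelationFunction gaussSeq L (fun m a => a m) 1 K₁)
    (hK : IsCorrelationFunction gaussSeq L (fun m a => a m) n K)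
    (hpos : ∀ z ∈ ball (0 : ℂ) 1, 0 < K₁ fun _ => z) {z : Fin n → ℂ} (hz : z ∈ config n) :
    normalized K₁ K (fun p => σ (z p)) = normalized K₁ K z := by
  have h1 : ∀ p, K₁ (fun _ => z p) = K₁ (fun _ => σ (z p)) * |(σ' (z p)).det| := fun p => by
    have := hs.isCorrelationFunction hL hK₁ (x := fun _ => z p)
      ⟨fun _ => hz.1 p, fun _ _ _ => Subsingleton.elim _ _⟩
    simpa using this.symm
  have h2 := hs.isCorrelationFunction hL hK hz
  -- A vanishing Jacobian at `z p` would make `K₁` vanish there, against positivity.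
  have h3 : ∏ p, |(σ' (z p)).det| ≠ 0 := Finset.prod_ne_zero_iff.2 fun p _ h0 =>
    (hpos _ (hz.1 p)).ne' (by rw [h1 p, h0, mul_zero])
  unfold normalized
  simp only at h2
  rw [← h2, Finset.prod_congr rfl fun p _ => h1 p, Finset.prod_mul_distrib,
    mul_div_mul_right _ _ h3]

end

end Symmetry

end SU11

namespace SU11

/-! ### Disk automorphisms and hyperbolic distance -/

section DiskAutomorphisms

open Set Filter Topology

noncomputable section

/-- The automorphism `z ↦ (a z + b) / (b̄ z + ā)` of the disk. -/
def moebius (a b z : ℂ) : ℂ := (a * z + b) / (conj b * z + conj a)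

variable {a b z w : ℂ}

lemma one_sub_mul_conj_ne_zero (hz : z ∈ ball (0 : ℂ) 1) (hw : w ∈ ball (0 : ℂ) 1) :
    1 - z * conj w ≠ 0 := by
  rw [mem_ball_zero_iff] at hz hw
  intro h
  have h1 : ‖z * conj w‖ = 1 := by rw [← sub_eq_zero.1 h, norm_one]
  rw [norm_mul, Complex.norm_conj] at h1
  nlinarith [norm_nonneg z, norm_nonneg w]

lemma norm_sq_eq_of_form (h : a * conj a - b * conj b = 1) : ‖a‖ ^ 2 - ‖b‖ ^ 2 = 1 := by
  rw [Complex.mul_conj', Complex.mul_conj'] at h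
  exact_mod_cast h

lemma moebius_denom_ne_zero (h : a * conj a - b * conj b = 1) (hz : z ∈ ball (0 : ℂ) 1) :
    conj b * z + conj a ≠ 0 := by
  rw [mem_ball_zero_iff] at hz
  intro h0
  have h1 : ‖a‖ = ‖b‖ * ‖z‖ := by
    rw [← Complex.norm_conj a, ← norm_neg, ← eq_neg_of_add_eq_zero_left h0, norm_mul,
      Complex.norm_conj]
  have h2 := norm_sq_eq_of_form h
  have h3 : ‖a‖ ≤ ‖b‖ := h1 ▸ mul_le_of_le_one_right (norm_nonneg b) hz.le
  nlinarith [norm_nonneg a, norm_nonneg b]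

lemma moebius_sub (h : a * conj a - b * conj b = 1) (hz : z ∈ ball (0 : ℂ) 1)
    (hw : w ∈ ball (0 : ℂ) 1) : moebius a b z - moebius a b w
      = (z - w) / ((conj b * z + conj a) * (conj b * w + conj a)) := by
  have h1 := moebius_denom_ne_zero h hz
  have h2 := moebius_denom_ne_zero h hw
  unfold moebius
  rw [div_sub_div _ _ h1 h2]
  congr 1
  linear_combination (z - w) * h

/-- This transformation law has three uses: on the diagonal it shows that the disk is preserved,
with `moebius_sub` it gives invariance of the pseudo-hyperbolic distance, and its `L`-th power gives
the change of the covariance kernel. -/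
lemma one_sub_moebius_mul_conj (h : a * conj a - b * conj b = 1) (hz : z ∈ ball (0 : ℂ) 1)
    (hw : w ∈ ball (0 : ℂ) 1) : 1 - moebius a b z * conj (moebius a b w)
      = (1 - z * conj w) / ((conj b * z + conj a) * conj (conj b * w + conj a)) := by
  have h1 := moebius_denom_ne_zero h hz
  have h2 : conj (conj b * w + conj a) ≠ 0 :=
    (map_ne_zero _).2 (moebius_denom_ne_zero h hw)
  unfold moebius
  rw [map_div₀, div_mul_div_comm, one_sub_div (mul_ne_zero h1 h2)]
  congr 1
  simp only [map_add, map_mul, Complex.conj_conj]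
  linear_combination (1 - z * conj w) * h

lemma mapsTo_moebius (h : a * conj a - b * conj b = 1) :
    MapsTo (moebius a b) (ball 0 1) (ball 0 1) := by
  intro z hz
  have h1 := one_sub_moebius_mul_conj h hz hz
  have h2 := moebius_denom_ne_zero h hz
  rw [Complex.mul_conj', Complex.mul_conj', Complex.mul_conj'] at h1
  have h3 : 1 - ‖moebius a b z‖ ^ 2 = (1 - ‖z‖ ^ 2) / ‖conj b * z + conj a‖ ^ 2 := by
    exact_mod_cast h1
  have h4 : 0 < 1 - ‖moebius a b z‖ ^ 2 := by
    rw [h3]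
    refine div_pos ?_ (by positivity)
    rw [mem_ball_zero_iff] at hz
    nlinarith [norm_nonneg z]
  rw [mem_ball_zero_iff]
  nlinarith [norm_nonneg (moebius a b z)]

lemma form_inv (h : a * conj a - b * conj b = 1) :
    conj a * conj (conj a) - -b * conj (-b) = 1 := by
  simp only [map_neg, Complex.conj_conj]
  linear_combination h

lemma moebius_inv (h : a * conj a - b * conj b = 1) (hz : z ∈ ball (0 : ℂ) 1) :
    moebius (conj a) (-b) (moebius a b z) = z := by
  have h1 := moebius_denom_ne_zero h hz
  have h2 := moebius_denom_ne_zero (form_inv h) (mapsTo_moebius h hz)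
  rw [moebius, div_eq_iff h2, moebius]
  simp only [map_neg, Complex.conj_conj]
  linear_combination div_mul_cancel₀ (a * z + b) h1

lemma moebius_inv' (h : a * conj a - b * conj b = 1) (hz : z ∈ ball (0 : ℂ) 1) :
    moebius a b (moebius (conj a) (-b) z) = z := by
  simpa using moebius_inv (form_inv h) hz

lemma hasDerivAt_moebius (h : a * conj a - b * conj b = 1) (hz : z ∈ ball (0 : ℂ) 1) :
    HasDerivAt (moebius a b) (1 / (conj b * z + conj a) ^ 2) z := by
  have h1 := (((hasDerivAt_id z).const_mul a).add_const b).div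
    (((hasDerivAt_id z).const_mul (conj b)).add_const (conj a)) (moebius_denom_ne_zero h hz)
  refine h1.congr_deriv ?_
  congr 1
  simp only [id]
  linear_combination h

lemma contDiffAt_moebius (h : a * conj a - b * conj b = 1) (hz : z ∈ ball (0 : ℂ) 1) :
    ContDiffAt ℝ ∞ (moebius a b) z := by
  have h1 : ContDiffAt ℝ ∞ (fun w => a * w + b) z := by fun_prop
  have h2 : ContDiffAt ℝ ∞ (fun w => conj b * w + conj a) z := by fun_prop
  refine (h1.mul (h2.inv (moebius_denom_ne_zero h hz))).congr_of_eventuallyEq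
    (Eventually.of_forall fun w => ?_)
  exact div_eq_mul_inv _ _

/-- The elements of `SU(1,1)` act as disk automorphisms. -/
lemma exists_act_eq_moebius {A : SL(2, ℂ)} (hA : A ∈ group) :
    ∃ a b : ℂ, a * conj a - b * conj b = 1 ∧ act A = moebius a b := by
  have hA' : (A.1)ᴴ * !![1, 0; 0, -1] * A.1 = !![1, 0; 0, -1] := hA
  have hdet : A.1 0 0 * A.1 1 1 - A.1 0 1 * A.1 1 0 = 1 := by
    rw [← Matrix.det_fin_two]; exact A.2
  have h00 : conj (A.1 0 0) * A.1 0 0 - conj (A.1 1 0) * A.1 1 0 = 1 := by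
    have := congrFun (congrFun hA' 0) 0
    simpa [Matrix.mul_apply, Fin.sum_univ_two, Matrix.conjTranspose_apply, sub_eq_add_neg]
      using this
  have h01 : conj (A.1 0 0) * A.1 0 1 - conj (A.1 1 0) * A.1 1 1 = 0 := by
    have := congrFun (congrFun hA' 0) 1
    simpa [Matrix.mul_apply, Fin.sum_univ_two, Matrix.conjTranspose_apply, sub_eq_add_neg]
      using this
  have hd : A.1 1 1 = conj (A.1 0 0) := by
    linear_combination (-A.1 1 1) * h00 + conj (A.1 0 0) * hdet + A.1 1 0 * h01
  have hc' : conj (A.1 1 0) = A.1 0 1 := by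
    linear_combination (-conj (A.1 1 0)) * hdet + (A.1 0 1) * h00 - A.1 0 0 * h01
  have hc : A.1 1 0 = conj (A.1 0 1) := by rw [← hc', Complex.conj_conj]
  refine ⟨A.1 0 0, A.1 0 1, ?_, ?_⟩
  · rw [hd, hc] at hdet; exact hdet
  · funext z
    rw [act, moebius, hd, hc]

/-- The pseudo-hyperbolic distance of the disk. -/
def pseudoDist (z w : ℂ) : ℝ := ‖z - w‖ / ‖1 - z * conj w‖

lemma pseudoDist_moebius (h : a * conj a - b * conj b = 1) (hz : z ∈ ball (0 : ℂ) 1)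
    (hw : w ∈ ball (0 : ℂ) 1) :
    pseudoDist (moebius a b z) (moebius a b w) = pseudoDist z w := by
  have h1 := norm_ne_zero_iff.2 (moebius_denom_ne_zero h hz)
  have h2 := norm_ne_zero_iff.2 (moebius_denom_ne_zero h hw)
  rw [pseudoDist, moebius_sub h hz hw, one_sub_moebius_mul_conj h hz hw, norm_div, norm_div,
    norm_mul, norm_mul, Complex.norm_conj, div_div_div_cancel_right₀ (mul_ne_zero h1 h2),
    pseudoDist]

lemma norm_one_sub_mul_conj_sq (z w : ℂ) :
    ‖1 - z * conj w‖ ^ 2 = ‖z - w‖ ^ 2 + (1 - ‖z‖ ^ 2) * (1 - ‖w‖ ^ 2) := by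
  simp only [Complex.sq_norm, Complex.normSq_apply]
  simp
  ring

lemma norm_sub_sq_eq (z w : ℂ) :
    ‖z - w‖ ^ 2 = ‖z‖ ^ 2 + ‖w‖ ^ 2 - 2 * (z.re * w.re + z.im * w.im) := by
  simp only [Complex.sq_norm, Complex.normSq_apply]
  simp
  ring

lemma pseudoDist_mem_Ioo (hz : z ∈ ball (0 : ℂ) 1) (hw : w ∈ ball (0 : ℂ) 1) :
    pseudoDist z w ∈ Ioo (-1 : ℝ) 1 := by
  have h0 : 0 < ‖1 - z * conj w‖ := norm_pos_iff.2 (one_sub_mul_conj_ne_zero hz hw)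
  have h1 := norm_one_sub_mul_conj_sq z w
  rw [mem_ball_zero_iff] at hz hw
  have h2 : 0 < (1 - ‖z‖ ^ 2) * (1 - ‖w‖ ^ 2) :=
    mul_pos (by nlinarith [norm_nonneg z]) (by nlinarith [norm_nonneg w])
  refine ⟨neg_one_lt_zero.trans_le (by unfold pseudoDist; positivity), ?_⟩
  rw [pseudoDist, div_lt_one h0]
  exact lt_of_pow_lt_pow_left₀ 2 h0.le (by linarith)

lemma pseudoDist_eq_of_hypDist_eq {z' w' : ℂ} (hz : z ∈ ball (0 : ℂ) 1) (hw : w ∈ ball (0 : ℂ) 1)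
    (hz' : z' ∈ ball (0 : ℂ) 1) (hw' : w' ∈ ball (0 : ℂ) 1) (h : hypDist z w = hypDist z' w') :
    pseudoDist z w = pseudoDist z' w' := by
  unfold hypDist at h
  exact Real.artanh_injOn (pseudoDist_mem_Ioo hz hw) (pseudoDist_mem_Ioo hz' hw')
    (mul_left_cancel₀ two_ne_zero h)

/-- By `norm_one_sub_mul_conj_sq`, once the moduli are fixed the pseudo-hyperbolic distance
determines the Euclidean distance, hence the real inner product. -/
lemma inner_eq_of_pseudoDist_eq {z' w' : ℂ} (hz : z ∈ ball (0 : ℂ) 1) (hw : w ∈ ball (0 : ℂ) 1)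
    (hz' : ‖z'‖ = ‖z‖) (hw' : ‖w'‖ = ‖w‖) (h : pseudoDist z' w' = pseudoDist z w) :
    z'.re * w'.re + z'.im * w'.im = z.re * w.re + z.im * w.im := by
  have hzb : z' ∈ ball (0 : ℂ) 1 := by simpa [hz'] using hz
  have hwb : w' ∈ ball (0 : ℂ) 1 := by simpa [hw'] using hw
  have h0 := norm_ne_zero_iff.2 (one_sub_mul_conj_ne_zero hz hw)
  have h0' := norm_ne_zero_iff.2 (one_sub_mul_conj_ne_zero hzb hwb)
  rw [pseudoDist, pseudoDist, div_eq_div_iff h0' h0] at h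
  have h1 : ‖z' - w'‖ ^ 2 * ‖1 - z * conj w‖ ^ 2 = ‖z - w‖ ^ 2 * ‖1 - z' * conj w'‖ ^ 2 := by
    rw [← mul_pow, h, mul_pow]
  rw [norm_one_sub_mul_conj_sq, norm_one_sub_mul_conj_sq, hz', hw'] at h1
  have h2 : (1 - ‖z‖ ^ 2) * (1 - ‖w‖ ^ 2) ≠ 0 := by
    rw [mem_ball_zero_iff] at hz hw
    exact (mul_pos (by nlinarith [norm_nonneg z]) (by nlinarith [norm_nonneg w])).ne'
  have h3 : ‖z' - w'‖ ^ 2 = ‖z - w‖ ^ 2 := mul_right_cancel₀ h2 (by linarith)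
  rw [norm_sub_sq_eq, norm_sub_sq_eq, hz', hw'] at h3
  linarith

lemma exists_moebius_eq_zero (hz : z ∈ ball (0 : ℂ) 1) :
    ∃ a b : ℂ, a * conj a - b * conj b = 1 ∧ moebius a b z = 0 := by
  have h0 : 0 < 1 - ‖z‖ ^ 2 := by
    rw [mem_ball_zero_iff] at hz
    nlinarith [norm_nonneg z]
  refine ⟨((√(1 - ‖z‖ ^ 2))⁻¹ : ℝ), -((√(1 - ‖z‖ ^ 2))⁻¹ : ℝ) * z, ?_, ?_⟩
  · have h1 : ((√(1 - ‖z‖ ^ 2))⁻¹ : ℝ) ^ 2 * (1 - ‖z‖ ^ 2) = 1 := by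
      rw [inv_pow, Real.sq_sqrt h0.le, inv_mul_cancel₀ h0.ne']
    have h2 : ((((√(1 - ‖z‖ ^ 2))⁻¹ : ℝ) : ℂ)) ^ 2 * (1 - (‖z‖ : ℂ) ^ 2) = 1 := by exact_mod_cast h1
    rw [map_mul, map_neg, Complex.conj_ofReal]
    rw [← Complex.mul_conj'] at h2
    linear_combination h2
  · rw [moebius]
    simp

lemma exists_rotation_eq_norm (z : ℂ) :
    ∃ a : ℂ, a * conj a - 0 * conj 0 = 1 ∧ moebius a 0 z = ‖z‖ := by
  -- With `b = 0` the map is multiplication by `a / conj a = a ^ 2`, so half of the argument is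
  -- needed.
  refine ⟨Complex.exp ((-(z.arg / 2) : ℝ) * Complex.I), ?_, ?_⟩
  · rw [Complex.mul_conj', Complex.norm_exp_ofReal_mul_I]; simp
  · rw [moebius, ← Complex.exp_conj, map_mul, Complex.conj_I, Complex.conj_ofReal]
    simp only [map_zero, zero_mul, zero_add, add_zero]
    rw [div_eq_iff (Complex.exp_ne_zero _)]
    have h2 : Complex.exp (((-(z.arg / 2) : ℝ) : ℂ) * Complex.I) * Complex.exp (z.arg * Complex.I)
        = Complex.exp (((-(z.arg / 2) : ℝ) : ℂ) * -Complex.I) := by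
      rw [← Complex.exp_add]
      congr 1
      push_cast
      ring
    rw [← h2, mul_left_comm, Complex.norm_mul_exp_arg_mul_I]

end

end DiskAutomorphisms

end SU11

namespace SU11

/-! ### Invariance of the law and classification of configurations -/

section Invariance

open Set Filter Topology

noncomputable section

variable {L n : ℕ} {a b z w : ℂ}

lemma hasSum_coeff_sq (hL : 1 ≤ L) {u : ℂ} (hu : ‖u‖ < 1) :
    HasSum (fun m => (coeff L m : ℂ) ^ 2 * u ^ m) (1 / (1 - u) ^ L) := by
  obtain ⟨l, rfl⟩ := Nat.exists_eq_add_of_le' hL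
  refine (hasSum_choose_mul_geometric_of_norm_lt_one l hu).congr_fun fun m => ?_
  rw [← Complex.ofReal_pow, coeff_sq, show m + (l + 1) - 1 = m + l by omega, Nat.choose_symm_add]
  simp

lemma aemeasurable_randomFunction (hL : 1 ≤ L) (hz : z ∈ ball (0 : ℂ) 1) :
    AEMeasurable (fun a => randomFunction L a z) gaussSeq := by
  refine ⟨_, (measurable_randomFunction L).comp (measurable_id.prodMk (measurable_const (a := z))), ?_⟩
  filter_upwards [ae_isTame hL] with a ha
  exact (indicator_of_mem (show (a, z) ∈ {p : (ℕ → ℂ) × ℂ | IsTame L p.1 ∧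
    p.2 ∈ ball (0 : ℂ) 1} from ⟨ha, hz⟩)
    fun p => randomFunction L p.1 p.2).symm

lemma isGaussianField_randomFunction (hL : 1 ≤ L) (c t : ℕ → ℂ) (ht : ∀ j, t j ∈ ball (0 : ℂ) 1) :
    IsGaussianField (fun a j => c j * randomFunction L a (t j))
      fun j k => c j * conj (c k) * (1 / (1 - t j * conj (t k)) ^ L) := by
  refine isGaussianField_of_hasSum (κ := fun j m => c j * (coeff L m * t j ^ m))
    (aemeasurable_pi_iff.2 fun j => (aemeasurable_randomFunction hL (ht j)).const_mul _) ?_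
    fun j k => ?_
  · filter_upwards [ae_isTame hL] with a ha j
    refine ((ha.summable_term (ht j)).hasSum.mul_left (c j)).congr_fun fun m => ?_
    ring
  · have hu : ‖t j * conj (t k)‖ < 1 := by
      have hj := mem_ball_zero_iff.1 (ht j)
      have hk := mem_ball_zero_iff.1 (ht k)
      rw [norm_mul, Complex.norm_conj]
      nlinarith [norm_nonneg (t j), norm_nonneg (t k)]
    refine ((hasSum_coeff_sq hL hu).mul_left (c j * conj (c k))).congr_fun fun m => ?_
    simp only [map_mul, map_pow, Complex.conj_ofReal]
    ring

lemma isGaussianField_diskValues (hL : 1 ≤ L) :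
    IsGaussianField (fun a j => randomFunction L a (diskSeq j))
      fun j k => 1 / (1 - diskSeq j * conj (diskSeq k : ℂ)) ^ L := by
  simpa using isGaussianField_randomFunction hL (fun _ => 1) (fun j => diskSeq j)
    fun j => (diskSeq j).2

lemma map_diskValues (hL : 1 ≤ L) : gaussSeq.map (fun a j => randomFunction L a (diskSeq j))
    = gaussSeq.map (diskValues L) :=
  Measure.map_congr ((ae_isTame hL).mono fun _ ha => ha.diskValues_eq.symm)

/-- Dividing by the `L`-th power of the denominator exactly cancels the factor that the automorphism
introduces into the kernel, and creates no zeros. As `L` is an integer no branch has to be chosen.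
-/
lemma isSymmetry_moebius (hL : 1 ≤ L) (h : a * conj a - b * conj b = 1) :
    IsSymmetry L (moebius a b) (moebius (conj a) (-b))
      (fun z => (1 / (conj b * z + conj a) ^ 2) • (1 : ℂ →L[ℝ] ℂ))
      (fun x z => ((conj b * z + conj a) ^ L)⁻¹ * randomFunction L x (moebius a b z)) := by
  have hf := isGaussianField_randomFunction hL
    (fun j => ((conj b * diskSeq j + conj a) ^ L)⁻¹) (fun j => moebius a b (diskSeq j))
    fun j => mapsTo_moebius h (diskSeq j).2
  have hne : ∀ {z : ℂ}, z ∈ ball (0 : ℂ) 1 → conj b * z + conj a ≠ 0 :=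
    fun hz => moebius_denom_ne_zero h hz
  have hcont : ContinuousOn (moebius a b) (ball 0 1) := fun z hz =>
    (hasDerivAt_moebius h hz).continuousAt.continuousWithinAt
  have hden : Continuous fun z => conj b * z + conj a := by fun_prop
  refine ⟨mapsTo_moebius h, mapsTo_moebius (form_inv h), fun z hz => moebius_inv h hz,
    fun z hz => moebius_inv' h hz, fun z hz => (hasDerivAt_moebius h hz).complexToReal_fderiv,
    ?_, fun z hz => contDiffAt_moebius (form_inv h) hz, fun x hx => ?_, fun x _ z hz => ?_,
    hf.aemeasurable, ?_⟩
  · have h1 : ContinuousOn (fun z => 1 / (conj b * z + conj a) ^ 2) (ball 0 1) :=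
      continuousOn_const.div (hden.pow 2).continuousOn fun z hz => pow_ne_zero 2 (hne hz)
    have h2 : Continuous fun c : ℂ => (c • (1 : ℂ →L[ℝ] ℂ)).det :=
      ContinuousLinearMap.continuous_det.comp (by fun_prop)
    exact h2.comp_continuousOn h1
  · exact ((hden.pow L).continuousOn.inv₀ fun z hz => pow_ne_zero L (hne hz)).mul
      (hx.continuousOn.comp hcont (mapsTo_moebius h))
  · rw [mul_eq_zero, or_iff_right (inv_ne_zero (pow_ne_zero L (hne hz)))]
  · rw [← map_diskValues hL]
    refine hf.map_eq ?_
    convert isGaussianField_diskValues hL using 3 with j k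
    have h1 := hne (diskSeq j).2
    have h2 : conj (conj b * diskSeq k + conj a) ≠ 0 := (map_ne_zero _).2 (hne (diskSeq k).2)
    have h3 := one_sub_mul_conj_ne_zero (diskSeq j).2 (diskSeq k).2
    rw [one_sub_moebius_mul_conj h (diskSeq j).2 (diskSeq k).2, map_inv₀, map_pow, div_pow, mul_pow]
    field_simp

/-- Conjugating both the argument and the value leaves the kernel unchanged. This
orientation-reversing symmetry is needed because distances cannot tell a configuration from its
mirror image. -/
lemma isSymmetry_conj (hL : 1 ≤ L) :
    IsSymmetry L (fun z => conj z) (fun z => conj z) (fun _ => (Complex.conjCLE : ℂ →L[ℝ] ℂ))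
      (fun x z => conj (randomFunction L x (conj z))) := by
  have hmaps : MapsTo (fun z : ℂ => conj z) (ball 0 1) (ball 0 1) := fun z hz => by
    simpa using hz
  have hf := (isGaussianField_randomFunction hL (fun _ => 1) (fun j => conj (diskSeq j : ℂ))
    fun j => hmaps (diskSeq j).2).conj
  simp only [one_mul] at hf
  refine ⟨hmaps, hmaps, fun z _ => Complex.conj_conj z, fun z _ => Complex.conj_conj z,
    fun z _ => Complex.conjCLE.hasFDerivAt, continuousOn_const,
    fun z _ => Complex.conjCLE.contDiff.contDiffAt, fun x hx => ?_, fun x _ z _ => ?_,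
    hf.aemeasurable, ?_⟩
  · exact Complex.continuous_conj.comp_continuousOn
      (hx.continuousOn.comp Complex.continuous_conj.continuousOn hmaps)
  · exact map_eq_zero _
  · rw [← map_diskValues hL]
    refine hf.map_eq ?_
    convert isGaussianField_diskValues hL using 3 with j k
    simp [mul_comm]

/-- A function of configurations which is invariant under disk automorphisms and under complex
conjugation depends only on the pairwise hyperbolic distances. -/
lemma eq_of_pseudoDist_eq {F : (Fin n → ℂ) → ℝ}
    (hF : ∀ a b : ℂ, a * conj a - b * conj b = 1 → ∀ z ∈ config n,
      F (fun p => moebius a b (z p)) = F z)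
    (hF' : ∀ z ∈ config n, F (fun p => conj (z p)) = F z) {z w : Fin n → ℂ}
    (hz : z ∈ config n) (hw : w ∈ config n)
    (h : ∀ p q, pseudoDist (z p) (z q) = pseudoDist (w p) (w q)) : F z = F w := by
  have hmem : ∀ {a b : ℂ}, a * conj a - b * conj b = 1 → ∀ {z : Fin n → ℂ}, z ∈ config n →
      (fun p => moebius a b (z p)) ∈ config n := fun hab z hz =>
    -- Preservation of configurations does not involve the random function, so the parameter is
    -- taken to be `1`.
    (isSymmetry_moebius le_rfl hab).mem_config hz
  obtain hn | ⟨⟨i⟩⟩ := isEmpty_or_nonempty (Fin n)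
  · exact congrArg F (Subsingleton.elim _ _)
  -- With the `i`-th points at the origin, the distances to them are the moduli, so corresponding
  -- points have equal moduli.
  wlog h0 : z i = 0 ∧ w i = 0 generalizing z w
  · obtain ⟨a, b, hab, hi⟩ := exists_moebius_eq_zero (hz.1 i)
    obtain ⟨a', b', hab', hi'⟩ := exists_moebius_eq_zero (hw.1 i)
    rw [← hF a b hab z hz, ← hF a' b' hab' w hw]
    refine this (hmem hab hz) (hmem hab' hw) (fun p q => ?_) ⟨hi, hi'⟩
    rw [pseudoDist_moebius hab (hz.1 p) (hz.1 q), pseudoDist_moebius hab' (hw.1 p) (hw.1 q), h]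
  obtain ⟨hzi, hwi⟩ := h0
  have hnorm : ∀ p, ‖z p‖ = ‖w p‖ := fun p => by
    have := h p i
    simpa [pseudoDist, hzi, hwi] using this
  by_cases hall : ∀ p, z p = 0
  · refine congrArg F (funext fun p => ?_)
    rw [hall p, eq_comm, ← norm_eq_zero, ← hnorm p, hall p, norm_zero]
  push Not at hall
  obtain ⟨k, hk⟩ := hall
  -- Rotations fix the origin and put a nonzero `k`-th point of both configurations at the same
  -- positive real number; inner products with it then give all real parts.
  wlog h1 : z k = ‖z k‖ ∧ w k = ‖w k‖ generalizing z w
  · obtain ⟨a, ha, hak⟩ := exists_rotation_eq_norm (z k)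
    obtain ⟨a', ha', hak'⟩ := exists_rotation_eq_norm (w k)
    have hzn : ∀ {a : ℂ}, moebius a 0 0 = 0 := by intro a; simp [moebius]
    rw [← hF a 0 ha z hz, ← hF a' 0 ha' w hw]
    refine this (hmem ha hz) (hmem ha' hw) (fun p q => ?_) (by simp only [hzi, hzn])
      (by simp only [hwi, hzn]) (fun p => ?_) (by simpa [hak] using hk)
      ⟨by simp [hak], by simp [hak']⟩
    · rw [pseudoDist_moebius ha (hz.1 p) (hz.1 q), pseudoDist_moebius ha' (hw.1 p) (hw.1 q), h]
    · have h2 := pseudoDist_moebius ha (hz.1 p) (hz.1 i)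
      have h3 := pseudoDist_moebius ha' (hw.1 p) (hw.1 i)
      rw [h, ← h3] at h2
      simpa [pseudoDist, hzi, hwi, hzn] using h2
  obtain ⟨hzk, hwk⟩ := h1
  have hinner : ∀ p q, (z p).re * (z q).re + (z p).im * (z q).im
      = (w p).re * (w q).re + (w p).im * (w q).im := fun p q =>
    inner_eq_of_pseudoDist_eq (hw.1 p) (hw.1 q) (hnorm p) (hnorm q) (h p q)
  have hwz : w k = z k := by rw [hwk, hzk, ← hnorm k, ← hzk]
  have him : (z k).im = 0 := by rw [hzk, Complex.ofReal_im]
  have hrek : (z k).re ≠ 0 := fun h0 => hk (Complex.ext h0 him)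
  have hre : ∀ p, (w p).re = (z p).re := fun p => by
    have := hinner p k
    rw [hwz, him, mul_zero, mul_zero, add_zero, add_zero] at this
    exact (mul_right_cancel₀ hrek this).symm
  have him2 : ∀ p q, (w p).im * (w q).im = (z p).im * (z q).im := fun p q => by
    have := hinner p q
    rw [hre p, hre q] at this
    linarith
  by_cases hreal : ∀ p, (z p).im = 0
  · refine congrArg F (funext fun p => Complex.ext (hre p).symm ?_)
    have := him2 p p
    rw [hreal p, mul_zero, mul_self_eq_zero] at this
    rw [this, hreal p]
  push Not at hreal
  obtain ⟨q, hq⟩ := hreal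
  -- The products of imaginary parts agree, so the sign at one nonreal point decides the sign at all
  -- points: the configurations are equal or mirror images.
  rcases mul_self_eq_mul_self_iff.1 (him2 q q) with h2 | h2
  · refine congrArg F (funext fun p => Complex.ext (hre p).symm ?_)
    have := him2 p q
    rw [h2] at this
    exact (mul_right_cancel₀ hq this).symm
  · rw [← hF' z hz]
    refine congrArg F (funext fun p => Complex.ext (hre p).symm ?_)
    have := him2 p q
    rw [h2, mul_neg] at this
    rw [Complex.conj_im]
    exact mul_right_cancel₀ hq (by linarith)

/-- Only the joint law of the coefficients matters, and independence with the given marginals makes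
it `gaussSeq`. -/
lemma isCorrelationFunction_iff_gaussSeq {Ω : Type*} [MeasurableSpace Ω] {P : Measure Ω}
    [IsProbabilityMeasure P] (hL : 1 ≤ L) {a : ℕ → Ω → ℂ}
    (ha : ∀ m, HasLaw (a m) stdComplexGaussian P) (hindep : iIndepFun a P)
    (K : (Fin n → ℂ) → ℝ) :
    IsCorrelationFunction P L a n K ↔ IsCorrelationFunction gaussSeq L (fun m a => a m) n K := by
  have hlaw : HasLaw (fun x m => a m x) gaussSeq P :=
    hindep.hasLaw_infinitePi ha (aemeasurable_pi_iff.2 fun m => (ha m).aemeasurable)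
  have hmeas : ∀ φ : Fin n → ℂ → ℝ, IsTestTuple φ → AEStronglyMeasurable
      (fun a => ∏ p, zeroSum (randomFunction L a) (φ p)) (P.map fun x m => a m x) := fun φ hφ => by
    rw [hlaw.map_eq]
    exact (Finset.aemeasurable_fun_prod _ fun p _ =>
      aemeasurable_zeroSum hL (hφ.isDiskTest p)).aestronglyMeasurable
  have hint : ∀ φ : Fin n → ℂ → ℝ, IsTestTuple φ →
      (Integrable (fun x => ∏ p, zeroSum (randomFunction L fun m => a m x) (φ p)) P ↔
        Integrable (fun a => ∏ p, zeroSum (randomFunction L a) (φ p)) gaussSeq) := fun φ hφ => by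
    rw [← hlaw.map_eq]
    exact (integrable_map_measure (hmeas φ hφ) hlaw.aemeasurable).symm
  have heq : ∀ φ : Fin n → ℂ → ℝ, IsTestTuple φ →
      ∫ x, ∏ p, zeroSum (randomFunction L fun m => a m x) (φ p) ∂P
        = ∫ a, ∏ p, zeroSum (randomFunction L a) (φ p) ∂gaussSeq := fun φ hφ => by
    rw [← hlaw.map_eq]
    exact (integral_map hlaw.aemeasurable (hmeas φ hφ)).symm
  refine ⟨fun h => ⟨h.continuousOn, fun φ hφ => (hint φ hφ).1 (h.integrable φ hφ),
    fun φ hφ => (heq φ hφ).symm.trans (h.integral_eq φ hφ)⟩,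
    fun h => ⟨h.continuousOn, fun φ hφ => (hint φ hφ).2 (h.integrable φ hφ),
    fun φ hφ => (heq φ hφ).trans (h.integral_eq φ hφ)⟩⟩

end

end Invariance

end SU11

theorem mainTheorem5 {Ω : Type*} [MeasurableSpace Ω] (P : Measure Ω) [IsProbabilityMeasure P]
    (L : ℕ) (hL : 1 ≤ L) (a : ℕ → Ω → ℂ)
    (ha : ∀ m, HasLaw (a m) SU11.stdComplexGaussian P) (hindep : iIndepFun a P) :
    (∀ n : ℕ, ∃ K : (Fin n → ℂ) → ℝ, SU11.IsCorrelationFunction P L a n K) ∧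
    ∀ (n : ℕ) (K₁ : (Fin 1 → ℂ) → ℝ) (K : (Fin n → ℂ) → ℝ),
      SU11.IsCorrelationFunction P L a 1 K₁ → SU11.IsCorrelationFunction P L a n K →
      (∀ z ∈ ball (0 : ℂ) 1, 0 < K₁ fun _ => z) ∧
      (∀ A ∈ SU11.group, ∀ z ∈ SU11.config n,
        SU11.normalized K₁ K (fun p => SU11.act A (z p)) = SU11.normalized K₁ K z) ∧
      (∀ z ∈ SU11.config n, ∀ w ∈ SU11.config n,
        (∀ p q, SU11.hypDist (z p) (z q) = SU11.hypDist (w p) (w q)) →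
        SU11.normalized K₁ K z = SU11.normalized K₁ K w) := by
  refine ⟨fun n => ⟨SU11.corr L n, (SU11.isCorrelationFunction_iff_gaussSeq hL ha hindep _).2
    (SU11.isCorrelationFunction_corr hL n)⟩, fun n K₁ K hK₁ hK => ?_⟩
  rw [SU11.isCorrelationFunction_iff_gaussSeq hL ha hindep] at hK₁ hK
  have hpos : ∀ z ∈ ball (0 : ℂ) 1, 0 < K₁ fun _ => z := fun z hz => by
    rw [hK₁.eqOn (SU11.isCorrelationFunction_corr hL 1) (x := fun _ => z)
      ⟨fun _ => hz, fun _ _ _ => Subsingleton.elim _ _⟩]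
    exact SU11.corr_one_pos hL hz
  refine ⟨hpos, fun A hA z hz => ?_, fun z hz w hw h => ?_⟩
  · obtain ⟨α, β, hαβ, hA'⟩ := SU11.exists_act_eq_moebius hA
    rw [hA']
    exact (SU11.isSymmetry_moebius hL hαβ).normalized_eq hL hK₁ hK hpos hz
  · refine SU11.eq_of_pseudoDist_eq
      (fun α β hαβ z hz => (SU11.isSymmetry_moebius hL hαβ).normalized_eq hL hK₁ hK hpos hz)
      (fun z hz => (SU11.isSymmetry_conj hL).normalized_eq hL hK₁ hK hpos hz) hz hw fun p q => ?_
    exact SU11.pseudoDist_eq_of_hypDist_eq (hz.1 p) (hz.1 q) (hw.1 p) (hw.1 q) (h p q)
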